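/- An instance of the Seminar Assignment Problem (SAP) consists of a finite set $B$ of seminars, a finite set $I$ of students, for each $b\in B$ a finite set $K_b\subset\mathbb{N}$ with $0\in K_b$ (the allowable numbers of students in $b$), and profits $p(i,b)\in\mathbb{R}$, $p(i,b)\ge 0$, for $i\in I$, $b\in B$. A seminar assignment is a function $\mathcal{A}:J\to B$ with $J\subseteq I$; it is feasible if $|\mathcal{A}^{-1}(b)|\in K_b$ for all $b\in B$, and its profit is $p(\mathcal{A})=\sum_{i\in J}p(i,\mathcal{A}(i))$. SAP asks for a feasible assignment of maximum profit. A feasible seminar selection is a function $S:B\to\mathbb{N}$ with $S(b)\in K_b$ for all $b$ and $c(S):=\sum_{b}S(b)\le |I|$; $p(S)$ denotes the maximum profit of an assignment $\mathcal{A}$ with $|\mathcal{A}^{-1}(b)|=S(b)$ for all $b$, and $\mathcal{A}_S$ an assignment attaining it. Let $inc(S)$ be the set of feasible seminar selections $T$ with $T(b)\ge S(b)$ for all $b$ and $T(b)>S(b)$ for exactly one $b$. The procedure Greedy, started from a feasible seminar selection $S_0$, repeats the following as long as $inc(S_i)\ne\emptyset$: let $S_{i+1}\in inc(S_i)$ maximize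 $(p(S')-p(S_i))/(c(S')-c(S_i))$ over $S'\in inc(S_i)$. For the last selection $S_i$ let $\mathcal{A}_1=\mathcal{A}_{S_i}$, and let $\mathcal{A}_2$ be an assignment of maximum profit among the feasible assignments that assign students to no more than one seminar, this being a seminar $b$ with $S_0(b)=0$ (the empty assignment is allowed). Greedy returns whichever of $\mathcal{A}_1,\mathcal{A}_2$ has the larger profit. Ties may be broken arbitrarily everywhere. **Corollary.** There is a polynomial-time $(1-e^{-1})$-approximation algorithm for SAP: the algorithm that runs Greedy from every feasible seminar selection $S_0$ with $|\{b: S_0(b)>0\}|\le 3$ and returns the best result. More precisely: (i) for every SAP instance and however ties are broken, the assignment returned is feasible and has profit at least $(1-e^{-1})\,p(\mathcal{A}')$ for every feasible assignment $\mathcal{A}'$; (ii) there is a program for a random access machine, whose memory holds natural numbers and real numbers and whose unit-cost operations are reading, writing, addition, subtraction and comparison, that computes a result of this algorithm on every SAP instance within a number of operations bounded by a fixed polynomial in $|B|+|I|+\sum_{b\in B}|K_b|$. -/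

import Mathlib

/-! ### The seminar assignment problem -/

/-- An instance with seminars `Fin m` and students `Fin n`: the finite sets `K b` of allowable
numbers of students, each containing `0`, and the non-negative real profits `p i b`. -/
structure SAP (m n : ℕ) where
  K : Fin m → Finset ℕ
  zero_mem : ∀ b, 0 ∈ K b
  p : Fin n → Fin m → ℝ
  p_nonneg : ∀ i b, 0 ≤ p i b

/-- A seminar assignment is a partial function from students to seminars. -/
abbrev Assignment (m n : ℕ) : Type := Fin n → Option (Fin m)

/-- The number of students assigned to the seminar `b`. -/
def Assignment.count {m n : ℕ} (A : Assignment m n) (b : Fin m) : ℕ :=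
  (Finset.univ.filter (fun i => A i = some b)).card

/-- A map from seminars to numbers of students. -/
abbrev Selection (m : ℕ) : Type := Fin m → ℕ

/-- The cost `c(S)`. -/
def Selection.cost {m : ℕ} (S : Selection m) : ℕ := ∑ b, S b

namespace SAP

variable {m n : ℕ} (x : SAP m n)

/-- The total profit of an assignment. -/
def profit (A : Assignment m n) : ℝ :=
  ∑ i, match A i with
    | none => 0
    | some b => x.p i b

/-- Feasibility of an assignment. -/
def Feasible (A : Assignment m n) : Prop := ∀ b, A.count b ∈ x.K b

/-- `A` is a feasible solution whose profit is at least `α` times the profit of any feasible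
solution. -/
def IsApprox (α : ℝ) (A : Assignment m n) : Prop :=
  x.Feasible A ∧ ∀ A' : Assignment m n, x.Feasible A' → α * x.profit A' ≤ x.profit A

/-- `S` is a feasible seminar selection. -/
def FeasibleSel (S : Selection m) : Prop := (∀ b, S b ∈ x.K b) ∧ S.cost ≤ n

/-- `S` corresponds to the assignment `A`. -/
def Corresponds (S : Selection m) (A : Assignment m n) : Prop := ∀ b, A.count b = S b

/-- The profit `p(S)` of a selection: the maximum profit of an assignment corresponding to it.
For a feasible selection the set is finite and non-empty, so that the supremum is a maximum. -/
noncomputable def selProfit (S : Selection m) : ℝ :=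
  sSup {v : ℝ | ∃ A : Assignment m n, Corresponds S A ∧ v = x.profit A}

/-- `A` is an optimal assignment for the selection `S`. -/
def IsOptimalFor (S : Selection m) (A : Assignment m n) : Prop :=
  Corresponds S A ∧ ∀ A' : Assignment m n, Corresponds S A' → x.profit A' ≤ x.profit A

/-- `T ∈ inc(S)`: `T` is feasible, `T ≥ S` everywhere, and `T` allocates more students than `S`
to exactly one seminar. -/
def Inc (S T : Selection m) : Prop :=
  x.FeasibleSel T ∧ (∀ b, S b ≤ T b) ∧ ∃! b, S b < T b

/-- Marginal profit over marginal cost of `T` relative to `S`. -/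
noncomputable def density (S T : Selection m) : ℝ :=
  (x.selProfit T - x.selProfit S) / ((T.cost : ℝ) - (S.cost : ℝ))

/-- One iteration of the loop of Greedy, with ties broken arbitrarily. -/
def GreedyStep (S S' : Selection m) : Prop :=
  x.Inc S S' ∧ ∀ T, x.Inc S T → x.density S T ≤ x.density S S'

/-- `A` is feasible and assigns students to at most one seminar, which is one with `S₀ b = 0`. -/
def SingleSeminar (S₀ : Selection m) (A : Assignment m n) : Prop :=
  x.Feasible A ∧ (∀ i j b b', A i = some b → A j = some b' → b = b') ∧
    ∀ i b, A i = some b → S₀ b = 0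

/-- `A` is a possible result of Greedy with initial selection `S₀`. -/
def GreedyOutput (S₀ : Selection m) (A : Assignment m n) : Prop :=
  ∃ (S : Selection m) (A₁ A₂ : Assignment m n),
    Relation.ReflTransGen x.GreedyStep S₀ S ∧ (¬ ∃ T, x.Inc S T) ∧
    x.IsOptimalFor S A₁ ∧
    (x.SingleSeminar S₀ A₂ ∧
      ∀ A' : Assignment m n, x.SingleSeminar S₀ A' → x.profit A' ≤ x.profit A₂) ∧
    ((A = A₁ ∧ x.profit A₂ ≤ x.profit A₁) ∨ (A = A₂ ∧ x.profit A₁ ≤ x.profit A₂))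

/-- `S₀` is a feasible selection that uses at most three seminars. -/
def IsStart (S₀ : Selection m) : Prop :=
  x.FeasibleSel S₀ ∧ (Finset.univ.filter (fun b => 0 < S₀ b)).card ≤ 3

/-- `A` is a possible result of running Greedy from every feasible selection that uses at most
three seminars (`F S₀` is the result of the run from `S₀`) and returning the best result. -/
def EnumGreedyOutput (A : Assignment m n) : Prop :=
  ∃ F : Selection m → Assignment m n,
    (∀ S₀, x.IsStart S₀ → x.GreedyOutput S₀ (F S₀)) ∧
    ∃ S₀, x.IsStart S₀ ∧ A = F S₀ ∧ ∀ S₁, x.IsStart S₁ → x.profit (F S₁) ≤ x.profit A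

end SAP

/-! ### Random access machines over the integers and the reals

Structured programs for a random access machine whose memory consists of two-dimensional arrays
of natural numbers and of real numbers. Array names are constants of the program, the two indices
are computed. Every operation costs one unit. The only arithmetic operations are addition and
subtraction, and real numbers influence the control flow only through comparisons; hence a
polynomial number of operations on integral or rational data takes polynomial time on a Turing
machine as well. -/

namespace RAM

/-- The memory: `nat a i j` and `real a i j` are the entries `(i, j)` of the arrays named `a`. -/
structure Mem where
  nat : ℕ → ℕ → ℕ → ℕ
  real : ℕ → ℕ → ℕ → ℝ

/-- Expressions for natural numbers; `sub` is truncated. -/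
inductive NExpr where
  | const (k : ℕ)
  | load (a : ℕ) (i j : NExpr)
  | add (e₁ e₂ : NExpr)
  | sub (e₁ e₂ : NExpr)

def NExpr.eval (s : Mem) : NExpr → ℕ
  | .const k => k
  | .load a i j => s.nat a (i.eval s) (j.eval s)
  | .add e₁ e₂ => e₁.eval s + e₂.eval s
  | .sub e₁ e₂ => e₁.eval s - e₂.eval s

def NExpr.cost : NExpr → ℕ
  | .const _ => 1
  | .load _ i j => i.cost + j.cost + 1
  | .add e₁ e₂ => e₁.cost + e₂.cost + 1
  | .sub e₁ e₂ => e₁.cost + e₂.cost + 1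

/-- Expressions for real numbers. -/
inductive RExpr where
  | zero
  | load (a : ℕ) (i j : NExpr)
  | add (e₁ e₂ : RExpr)
  | sub (e₁ e₂ : RExpr)

noncomputable def RExpr.eval (s : Mem) : RExpr → ℝ
  | .zero => 0
  | .load a i j => s.real a (i.eval s) (j.eval s)
  | .add e₁ e₂ => e₁.eval s + e₂.eval s
  | .sub e₁ e₂ => e₁.eval s - e₂.eval s

def RExpr.cost : RExpr → ℕ
  | .zero => 1
  | .load _ i j => i.cost + j.cost + 1
  | .add e₁ e₂ => e₁.cost + e₂.cost + 1
  | .sub e₁ e₂ => e₁.cost + e₂.cost + 1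

/-- Tests. -/
inductive Test where
  | natLe (e₁ e₂ : NExpr)
  | realLe (e₁ e₂ : RExpr)
  | not (t : Test)
  | and (t₁ t₂ : Test)

def Test.holds (s : Mem) : Test → Prop
  | .natLe e₁ e₂ => e₁.eval s ≤ e₂.eval s
  | .realLe e₁ e₂ => e₁.eval s ≤ e₂.eval s
  | .not t => ¬ t.holds s
  | .and t₁ t₂ => t₁.holds s ∧ t₂.holds s

def Test.cost : Test → ℕ
  | .natLe e₁ e₂ => e₁.cost + e₂.cost + 1
  | .realLe e₁ e₂ => e₁.cost + e₂.cost + 1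
  | .not t => t.cost + 1
  | .and t₁ t₂ => t₁.cost + t₂.cost + 1

/-- Programs. -/
inductive Prog where
  | skip
  | natStore (a : ℕ) (i j e : NExpr)
  | realStore (a : ℕ) (i j : NExpr) (e : RExpr)
  | seq (P Q : Prog)
  | ite (t : Test) (P Q : Prog)
  | while (t : Test) (P : Prog)

def Mem.setNat (s : Mem) (a i j v : ℕ) : Mem where
  nat := fun a' i' j' => if a' = a ∧ i' = i ∧ j' = j then v else s.nat a' i' j'
  real := s.real

noncomputable def Mem.setReal (s : Mem) (a i j : ℕ) (v : ℝ) : Mem where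
  nat := s.nat
  real := fun a' i' j' => if a' = a ∧ i' = i ∧ j' = j then v else s.real a' i' j'

/-- `Exec P s t s'`: started with memory `s`, the program `P` halts after exactly `t` operations
with memory `s'`. -/
inductive Exec : Prog → Mem → ℕ → Mem → Prop
  | skip (s : Mem) : Exec .skip s 1 s
  | natStore (s : Mem) (a : ℕ) (i j e : NExpr) :
      Exec (.natStore a i j e) s (i.cost + j.cost + e.cost + 1)
        (s.setNat a (i.eval s) (j.eval s) (e.eval s))
  | realStore (s : Mem) (a : ℕ) (i j : NExpr) (e : RExpr) :
      Exec (.realStore a i j e) s (i.cost + j.cost + e.cost + 1)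
        (s.setReal a (i.eval s) (j.eval s) (e.eval s))
  | seq {P Q : Prog} {s s' s'' : Mem} {t t' : ℕ} :
      Exec P s t s' → Exec Q s' t' s'' → Exec (.seq P Q) s (t + t') s''
  | ite_true {b : Test} {P Q : Prog} {s s' : Mem} {t : ℕ} :
      b.holds s → Exec P s t s' → Exec (.ite b P Q) s (b.cost + t) s'
  | ite_false {b : Test} {P Q : Prog} {s s' : Mem} {t : ℕ} :
      ¬ b.holds s → Exec Q s t s' → Exec (.ite b P Q) s (b.cost + t) s'
  | while_true {b : Test} {P : Prog} {s s' s'' : Mem} {t t' : ℕ} :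
      b.holds s → Exec P s t s' → Exec (.while b P) s' t' s'' →
      Exec (.while b P) s (b.cost + t + t') s''
  | while_false {b : Test} {P : Prog} {s : Mem} :
      ¬ b.holds s → Exec (.while b P) s b.cost s

end RAM

namespace SAP

variable {m n : ℕ} (x : SAP m n)

/-- The size of the input: the number of seminars, of students, and of entries of the lists of
allowable sizes. (It is bounded by the length of any explicit encoding with `m ≥ 1`, since
there are `n * m` profits.) -/
def size : ℕ := m + n + ∑ b, (x.K b).card

/-- The initial memory for the input `x`. The integer arrays `0` and `1` hold `m` and `n` at
`(0, 0)`, array `2` holds the number of elements of `K b` at `(b, 0)`, array `3` holds the `j`-th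
element of `K b` at `(b, j)`, in increasing order; the real array `0` holds `p i b` at `(i, b)`.
All other entries are `0`. -/
noncomputable def initMem : RAM.Mem where
  nat := fun a i j =>
    if a = 0 ∧ i = 0 ∧ j = 0 then m
    else if a = 1 ∧ i = 0 ∧ j = 0 then n
    else if h : i < m then
      if a = 2 ∧ j = 0 then (x.K ⟨i, h⟩).card
      else if a = 3 then ((x.K ⟨i, h⟩).sort (· ≤ ·)).getD j 0
      else 0
    else 0
  real := fun a i j =>
    if a = 0 then
      if h : i < n ∧ j < m then x.p ⟨i, h.1⟩ ⟨j, h.2⟩ else 0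
    else 0

end SAP

/-- The integer array `4` of the memory holds the assignment `A`: at `(i, 0)` it holds `0` if the
student `i` is not assigned, and `b + 1` if `i` is assigned to the seminar `b`. -/
def RAM.Mem.Holds {m n : ℕ} (s : RAM.Mem) (A : Assignment m n) : Prop :=
  ∀ i : Fin n, s.nat 4 i 0 =
    match A i with
    | none => 0
    | some b => (b : ℕ) + 1

/-! The guarantee is that of the greedy algorithm for a monotone submodular function under a budget,
applied to the dual value of selections. For selections with at most as many places as there are
students, the dual value is the profit of a selection (strong duality,
`SAP.dualValue_eq_selProfit`); but it is defined, monotone and submodular for all selections, since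
the meet and the join of two price vectors are a dual solution for the join and the meet of the
selections (`SAP.dualValue_sup_add_dualValue_inf`). Among the starts there is one, below an optimal
selection `T`, after which raising a single seminar to its size in `T` gains at most a third of the
profit of the start (`SAP.exists_start`). Along a greedy run from it, the gap to the optimum shrinks
by the factor `exp (-Δc / (n - c(S₀)))` in every step of cost `Δc`, as long as the densest raise
towards `T` is affordable. If it is not, then the virtual step to it would reduce the gap to `e⁻¹`
times the initial gap; as this step gains at most a third of the profit of the start, and `1/3 ≤
e⁻¹`, the guarantee is already met without it (`SAP.exists_affordable_raise`). The runs from this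
start need no assignments to single seminars for their guarantee.

The program computes optimal assignments for selections by the primal-dual method: it places the
students one by one, along tight paths from the node of the unassigned students, and keeps prices at
which every student is content with her place (`SAP.Tree.grow`, `SAP.Trace.step`,
`SAP.optimize_supports`). Such prices certify optimality, and since they are non-negative they also
give strong duality; there is no other proof of strong duality here than the correctness of this
program. Densities are compared by cross-multiplication, the products being repeated sums.

Running times are controlled by a purely syntactic bound, `RAM.Prog.timeBound z`, valid if no loop
makes more than `z` iterations; it is a polynomial in `z`. Thus the proofs of correctness only have
to bound the iterations of each loop by `z = x.size + 1`. What a program leaves unchanged is read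
off its text in the same way (`RAM.Frame`).

The program keeps one best assignment for all starts instead of one for each start, which suffices
since ties may be broken arbitrarily (`SAP.Generated.enumGreedyOutput`). -/

/-! ### Total correctness of programs for the random access machine -/

namespace RAM

/-- Does the program contain a store to the array `c` of natural numbers? -/
def Prog.writesNat : Prog → ℕ → Bool
  | .skip, _ => false
  | .natStore a _ _ _, c => Nat.beq a c
  | .realStore _ _ _ _, _ => false
  | .seq P Q, c => P.writesNat c || Q.writesNat c
  | .ite _ P Q, c => P.writesNat c || Q.writesNat c
  | .while _ P, c => P.writesNat c

/-- Does the program contain a store to the array `c` of real numbers? -/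
def Prog.writesReal : Prog → ℕ → Bool
  | .skip, _ => false
  | .natStore _ _ _ _, _ => false
  | .realStore a _ _ _, c => Nat.beq a c
  | .seq P Q, c => P.writesReal c || Q.writesReal c
  | .ite _ P Q, c => P.writesReal c || Q.writesReal c
  | .while _ P, c => P.writesReal c

/-- A bound for the running time of a program all of whose loops, whenever they are entered, make
at most `z` iterations. -/
def Prog.timeBound (z : ℕ) : Prog → ℕ
  | .skip => 1
  | .natStore _ i j e => i.cost + j.cost + e.cost + 1
  | .realStore _ i j e => i.cost + j.cost + e.cost + 1
  | .seq P Q => P.timeBound z + Q.timeBound z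
  | .ite b P Q => b.cost + (P.timeBound z + Q.timeBound z)
  | .while b P => z * (b.cost + P.timeBound z) + b.cost

theorem Prog.exists_polynomial_timeBound (P : Prog) :
    ∃ q : Polynomial ℕ, ∀ z, P.timeBound z = q.eval z := by
  induction P with
  | skip => exact ⟨.C 1, fun z => by simp [timeBound]⟩
  | natStore a i j e => exact ⟨.C (i.cost + j.cost + e.cost + 1), fun z => by
      rw [Polynomial.eval_C, timeBound]⟩
  | realStore a i j e => exact ⟨.C (i.cost + j.cost + e.cost + 1), fun z => by
      rw [Polynomial.eval_C, timeBound]⟩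
  | seq P Q hP hQ =>
    obtain ⟨p, hp⟩ := hP
    obtain ⟨q, hq⟩ := hQ
    exact ⟨p + q, fun z => by rw [Polynomial.eval_add, timeBound, hp, hq]⟩
  | ite b P Q hP hQ =>
    obtain ⟨p, hp⟩ := hP
    obtain ⟨q, hq⟩ := hQ
    exact ⟨.C b.cost + (p + q), fun z => by
      rw [Polynomial.eval_add, Polynomial.eval_add, Polynomial.eval_C, timeBound, hp, hq]⟩
  | _ b P hP =>
    obtain ⟨p, hp⟩ := hP
    exact ⟨.X * (.C b.cost + p) + .C b.cost, fun z => by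
      rw [Polynomial.eval_add, Polynomial.eval_mul, Polynomial.eval_add, Polynomial.eval_C,
        Polynomial.eval_X, timeBound, hp]⟩

/-- The memories `s` and `s'` agree on all arrays to which the program `P` does not write. -/
structure Frame (P : Prog) (s s' : Mem) : Prop where
  nat : ∀ c, P.writesNat c = false → s'.nat c = s.nat c
  real : ∀ c, P.writesReal c = false → s'.real c = s.real c

theorem Frame.refl (P : Prog) (s : Mem) : Frame P s s := ⟨fun _ _ => rfl, fun _ _ => rfl⟩

theorem Frame.trans {P : Prog} {s s' s'' : Mem} (h : Frame P s s') (h' : Frame P s' s'') :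
    Frame P s s'' :=
  ⟨fun c hc => (h'.nat c hc).trans (h.nat c hc), fun c hc => (h'.real c hc).trans (h.real c hc)⟩

theorem Frame.mono {P Q : Prog} {s s' : Mem} (h : Frame P s s')
    (hn : ∀ c, Q.writesNat c = false → P.writesNat c = false)
    (hr : ∀ c, Q.writesReal c = false → P.writesReal c = false) : Frame Q s s' :=
  ⟨fun c hc => h.nat c (hn c hc), fun c hc => h.real c (hr c hc)⟩

theorem nat_setNat_of_ne {s : Mem} {a c : ℕ} (h : c ≠ a) (i j v : ℕ) :
    (s.setNat a i j v).nat c = s.nat c := by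
  funext i' j'
  simp [Mem.setNat, h]

theorem real_setReal_of_ne {s : Mem} {a c : ℕ} (h : c ≠ a) (i j : ℕ) (v : ℝ) :
    (s.setReal a i j v).real c = s.real c := by
  funext i' j'
  simp [Mem.setReal, h]

theorem Exec.frame {P : Prog} {s s' : Mem} {t : ℕ} (h : Exec P s t s') : Frame P s s' := by
  induction h with
  | skip s => exact .refl _ _
  | natStore s a i j e =>
    refine ⟨fun c hc => nat_setNat_of_ne ?_ _ _ _, fun _ _ => rfl⟩
    rintro rfl
    simp [Prog.writesNat] at hc
  | realStore s a i j e =>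
    refine ⟨fun _ _ => rfl, fun c hc => real_setReal_of_ne ?_ _ _ _⟩
    rintro rfl
    simp [Prog.writesReal] at hc
  | seq _ _ h₁ h₂ =>
    refine (h₁.mono ?_ ?_).trans (h₂.mono ?_ ?_) <;>
      simp +contextual [Prog.writesNat, Prog.writesReal]
  | ite_true _ _ h =>
    refine h.mono ?_ ?_ <;> simp +contextual [Prog.writesNat, Prog.writesReal]
  | ite_false _ _ h =>
    refine h.mono ?_ ?_ <;> simp +contextual [Prog.writesNat, Prog.writesReal]
  | while_true _ _ _ h₁ h₂ => exact Frame.trans ⟨h₁.nat, h₁.real⟩ h₂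
  | while_false _ => exact .refl _ _

/-- Total correctness within the time bound: started with memory `s`, the program `P` halts after
at most `P.timeBound z` operations with a memory that satisfies `Q`. -/
def Runs (z : ℕ) (P : Prog) (s : Mem) (Q : Mem → Prop) : Prop :=
  ∃ t s', Exec P s t s' ∧ t ≤ P.timeBound z ∧ Q s'

namespace Runs

variable {z : ℕ} {P P' : Prog} {s : Mem} {Q Q' : Mem → Prop}

theorem conseq (h : Runs z P s Q) (hQ : ∀ s', Frame P s s' → Q s' → Q' s') : Runs z P s Q' := by
  obtain ⟨t, s', he, ht, hs⟩ := h
  exact ⟨t, s', he, ht, hQ s' he.frame hs⟩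

theorem skip (h : Q s) : Runs z .skip s Q := ⟨1, s, .skip s, le_rfl, h⟩

theorem natStore {a : ℕ} {i j e : NExpr} (h : Q (s.setNat a (i.eval s) (j.eval s) (e.eval s))) :
    Runs z (.natStore a i j e) s Q := ⟨_, _, .natStore s a i j e, le_rfl, h⟩

theorem realStore {a : ℕ} {i j : NExpr} {e : RExpr}
    (h : Q (s.setReal a (i.eval s) (j.eval s) (e.eval s))) :
    Runs z (.realStore a i j e) s Q := ⟨_, _, .realStore s a i j e, le_rfl, h⟩

theorem seq (h : Runs z P s Q) (h' : ∀ s', Frame P s s' → Q s' → Runs z P' s' Q') :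
    Runs z (.seq P P') s Q' := by
  obtain ⟨t, s', he, ht, hs⟩ := h
  obtain ⟨t', s'', he', ht', hs'⟩ := h' s' he.frame hs
  exact ⟨_, s'', he.seq he', Nat.add_le_add ht ht', hs'⟩

theorem natStore_seq {a : ℕ} {i j e : NExpr}
    (h : Runs z P (s.setNat a (i.eval s) (j.eval s) (e.eval s)) Q) :
    Runs z (.seq (.natStore a i j e) P) s Q := by
  obtain ⟨t, s', he, ht, hs⟩ := h
  exact ⟨_, s', (Exec.natStore s a i j e).seq he, Nat.add_le_add le_rfl ht, hs⟩

theorem ite {b : Test} (ht : b.holds s → Runs z P s Q) (hf : ¬ b.holds s → Runs z P' s Q) :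
    Runs z (.ite b P P') s Q := by
  by_cases hb : b.holds s
  · obtain ⟨t, s', he, ht, hs⟩ := ht hb
    exact ⟨_, s', .ite_true hb he, by rw [Prog.timeBound]; lia, hs⟩
  · obtain ⟨t, s', he, ht, hs⟩ := hf hb
    exact ⟨_, s', .ite_false hb he, by rw [Prog.timeBound]; lia, hs⟩

/-- The rule for loops, with the invariant `I` and a variant `k` that decreases in each
iteration. -/
theorem whileLoop {b : Test} (I : ℕ → Mem → Prop) {k₀ : ℕ} (h₀ : I k₀ s) (hz : k₀ ≤ z)
    (hP : ∀ k s', Frame (.while b P) s s' → I k s' → b.holds s' →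
      Runs z P s' (fun s'' => ∃ k' < k, I k' s'')) :
    Runs z (.while b P) s (fun s' => (∃ k, I k s') ∧ ¬ b.holds s') := by
  have key : ∀ k s', Frame (.while b P) s s' → I k s' → ∃ t s'', Exec (.while b P) s' t s'' ∧
      t ≤ k * (b.cost + P.timeBound z) + b.cost ∧ (∃ k, I k s'') ∧ ¬ b.holds s'' := by
    intro k
    induction k using Nat.strong_induction_on with
    | _ k ih =>
      intro s' hF hI
      by_cases hb : b.holds s'
      · obtain ⟨t, s₁, he, ht, k', hk, hI'⟩ := hP k s' hF hI hb
        obtain ⟨t', s₂, he', ht', hs⟩ :=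
          ih k' hk s₁ (hF.trans (⟨he.frame.nat, he.frame.real⟩)) hI'
        refine ⟨_, s₂, .while_true hb he he', ?_, hs⟩
        have : (k' + 1) * (b.cost + P.timeBound z) ≤ k * (b.cost + P.timeBound z) :=
          Nat.mul_le_mul_right _ hk
        rw [Nat.succ_mul] at this
        lia
      · exact ⟨_, s', .while_false hb, by lia, ⟨k, hI⟩, hb⟩
  obtain ⟨t, s', he, ht, hs⟩ := key k₀ s (.refl _ _) h₀
  exact ⟨t, s', he, ht.trans (by rw [Prog.timeBound]; gcongr), hs⟩

end Runs

/-- The scalar variable kept at `(0, 0)` in the array `a`. -/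
def NExpr.var (a : ℕ) : NExpr := .load a (.const 0) (.const 0)

/-- The entry `i` of the array `a`, used as a one-dimensional array. -/
def NExpr.entry (a : ℕ) (i : NExpr) : NExpr := .load a i (.const 0)

/-- The real scalar variable kept at `(0, 0)` in the array `a`. -/
def RExpr.var (a : ℕ) : RExpr := .load a (.const 0) (.const 0)

/-- The entry `i` of the real array `a`, used as a one-dimensional array. -/
def RExpr.entry (a : ℕ) (i : NExpr) : RExpr := .load a i (.const 0)

@[simp] theorem NExpr.eval_var (s : Mem) (a : ℕ) : (NExpr.var a).eval s = s.nat a 0 0 := rfl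
@[simp] theorem NExpr.eval_entry (s : Mem) (a : ℕ) (i : NExpr) :
    (NExpr.entry a i).eval s = s.nat a (i.eval s) 0 := rfl
@[simp] theorem RExpr.eval_var (s : Mem) (a : ℕ) : (RExpr.var a).eval s = s.real a 0 0 := rfl
@[simp] theorem RExpr.eval_entry (s : Mem) (a : ℕ) (i : NExpr) :
    (RExpr.entry a i).eval s = s.real a (i.eval s) 0 := rfl

namespace Prog

/-- `a := e` for a scalar variable. -/
def assign (a : ℕ) (e : NExpr) : Prog := .natStore a (.const 0) (.const 0) e

/-- `a := e` for a real scalar variable. -/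
def assignReal (a : ℕ) (e : RExpr) : Prog := .realStore a (.const 0) (.const 0) e

/-- Execute `P` for the values `0, …, e - 1` of the variable `a`. -/
def forLoop (a : ℕ) (e : NExpr) (P : Prog) : Prog :=
  .seq (assign a (.const 0))
    (.while (.not (.natLe e (.var a))) (.seq P (assign a (.add (.var a) (.const 1)))))

end Prog

/-- The rule for counting loops. The invariant `I k` describes the memory before the iteration `k`
and must not depend on the loop variable. -/
theorem Runs.forLoop {z a N : ℕ} {e : NExpr} {P : Prog} {s : Mem} (I : ℕ → Mem → Prop)
    (hz : N ≤ z) (ha : P.writesNat a = false)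
    (he : ∀ s', Frame (.forLoop a e P) s s' → e.eval s' = N)
    (hI : ∀ k s v, I k s → I k (s.setNat a 0 0 v)) (h₀ : I 0 s)
    (hP : ∀ k s', k < N → Frame (.forLoop a e P) s s' → s'.nat a 0 0 = k → I k s' →
      Runs z P s' (I (k + 1))) :
    Runs z (.forLoop a e P) s (I N) := by
  have hw : ∀ s' s'', Frame (.while (.not (.natLe e (.var a)))
      (.seq P (.assign a (.add (.var a) (.const 1))))) s' s'' → Frame (.forLoop a e P) s' s'' :=
    fun s' s'' h => h.mono
      (fun c hc => by
        simp only [Prog.forLoop, Prog.writesNat, Prog.assign, Bool.or_eq_false_iff] at hc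
        simp only [Prog.writesNat, Prog.assign, Bool.or_eq_false_iff]
        exact hc.2)
      (fun c hc => by simpa [Prog.forLoop, Prog.writesReal, Prog.assign] using hc)
  refine natStore_seq ?_
  let s₁ := s.setNat a ((NExpr.const 0).eval s) ((NExpr.const 0).eval s) ((NExpr.const 0).eval s)
  have h₁ : Frame (.forLoop a e P) s s₁ := by
    refine ⟨fun c hc => nat_setNat_of_ne ?_ _ _ _, fun _ _ => rfl⟩
    rintro rfl
    simp [Prog.forLoop, Prog.writesNat, Prog.assign] at hc
  refine (whileLoop (fun r s' => ∃ k, k + r = N ∧ s'.nat a 0 0 = k ∧ I k s')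
    (k₀ := N) ⟨0, by simp, by simp [Mem.setNat, NExpr.eval], hI _ _ _ h₀⟩ hz ?_).conseq ?_
  · rintro r s' hF ⟨k, hk, hak, hIk⟩ hb
    have hF' := h₁.trans (hw _ _ hF)
    have hkN : k < N := by simpa [Test.holds, he s' hF', hak] using hb
    refine seq (hP k s' hkN hF' hak hIk) fun s'' hF'' hI' => natStore ?_
    have hak' : s''.nat a 0 0 = k := by rw [hF''.nat a ha, hak]
    refine ⟨r - 1, by lia, k + 1, by lia, ?_, ?_⟩
    · simp [Mem.setNat, NExpr.eval, hak']
    · exact hI _ _ _ hI'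
  · rintro s' hF ⟨⟨r, k, hk, hak, hIk⟩, hb⟩
    have : N ≤ k := by simpa [Test.holds, he s' (h₁.trans (hw _ _ hF)), hak] using hb
    rwa [show N = k by lia]

end RAM

/-! ### The dual value of a selection -/

namespace SAP

variable {m n : ℕ} (x : SAP m n)

/-- The gain of the student `i` at prices `q` for the seminars, if she chooses `o`. Staying
unassigned has profit and price `0`. -/
def gain (q : Fin m → ℝ) (i : Fin n) (o : Option (Fin m)) : ℝ := o.elim 0 fun b => x.p i b - q b

/-- The largest gain that the student `i` can achieve at prices `q`. -/
noncomputable def maxGain (q : Fin m → ℝ) (i : Fin n) : ℝ :=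
  Finset.univ.sup' ⟨none, Finset.mem_univ _⟩ (x.gain q i)

/-- The objective of the linear programming dual of the assignment problem with `S b` places in
the seminar `b`. -/
noncomputable def dualObjective (q : Fin m → ℝ) (S : Selection m) : ℝ :=
  ∑ i, x.maxGain q i + ∑ b, q b * S b

/-- The dual value of a selection. In contrast to `selProfit`, it is meaningful for selections
that have more places than there are students. -/
noncomputable def dualValue (S : Selection m) : ℝ :=
  ⨅ q : {q : Fin m → ℝ // 0 ≤ q}, x.dualObjective q S

/-- At prices `q`, every student is content with her place in the assignment `A`. -/
def Supports (q : Fin m → ℝ) (A : Assignment m n) : Prop :=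
  ∀ i o, x.gain q i o ≤ x.gain q i (A i)

theorem gain_le_maxGain (q : Fin m → ℝ) (i : Fin n) (o : Option (Fin m)) :
    x.gain q i o ≤ x.maxGain q i :=
  Finset.le_sup' (x.gain q i) (Finset.mem_univ o)

theorem maxGain_nonneg (q : Fin m → ℝ) (i : Fin n) : 0 ≤ x.maxGain q i :=
  x.gain_le_maxGain q i none

theorem profit_eq_sum_gain (q : Fin m → ℝ) (A : Assignment m n) :
    x.profit A = ∑ i, x.gain q i (A i) + ∑ b, q b * A.count b := by
  have h : ∑ b, q b * A.count b = ∑ i, (A i).elim 0 q := by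
    simp_rw [Assignment.count, Finset.card_filter, Nat.cast_sum, Finset.mul_sum]
    rw [Finset.sum_comm]
    refine Finset.sum_congr rfl fun i _ => ?_
    cases A i <;> simp
  rw [h, profit, ← Finset.sum_add_distrib]
  refine Finset.sum_congr rfl fun i _ => ?_
  cases A i <;> simp [gain]

/-- Weak duality. -/
theorem profit_le_dualObjective (q : Fin m → ℝ) {S : Selection m} {A : Assignment m n}
    (h : Corresponds S A) : x.profit A ≤ x.dualObjective q S := by
  rw [x.profit_eq_sum_gain q, dualObjective]
  simp_rw [h _]
  gcongr
  exact x.gain_le_maxGain q _ _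

theorem Supports.profit_eq {q : Fin m → ℝ} {S : Selection m} {A : Assignment m n}
    (h : x.Supports q A) (hA : Corresponds S A) : x.profit A = x.dualObjective q S := by
  rw [x.profit_eq_sum_gain q, dualObjective]
  simp_rw [hA _]
  congr 1
  exact Finset.sum_congr rfl fun i _ =>
    le_antisymm (x.gain_le_maxGain q _ _) (Finset.sup'_le _ _ fun o _ => h i o)

theorem Supports.isOptimalFor {q : Fin m → ℝ} {S : Selection m} {A : Assignment m n}
    (h : x.Supports q A) (hA : Corresponds S A) : x.IsOptimalFor S A :=
  ⟨hA, fun _ hA' => (h.profit_eq x hA).symm ▸ x.profit_le_dualObjective q hA'⟩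

theorem IsOptimalFor.selProfit_eq {S : Selection m} {A : Assignment m n}
    (h : x.IsOptimalFor S A) : x.selProfit S = x.profit A :=
  IsGreatest.csSup_eq ⟨⟨A, h.1, rfl⟩, by rintro _ ⟨A', hA', rfl⟩; exact h.2 A' hA'⟩

theorem dualObjective_nonneg {q : Fin m → ℝ} (hq : 0 ≤ q) (S : Selection m) :
    0 ≤ x.dualObjective q S :=
  add_nonneg (Finset.sum_nonneg fun i _ => x.maxGain_nonneg q i)
    (Finset.sum_nonneg fun b _ => mul_nonneg (hq b) (Nat.cast_nonneg _))

theorem dualValue_le {q : Fin m → ℝ} (hq : 0 ≤ q) (S : Selection m) :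
    x.dualValue S ≤ x.dualObjective q S :=
  ciInf_le (f := fun q : {q : Fin m → ℝ // 0 ≤ q} => x.dualObjective q S)
    ⟨0, by rintro _ ⟨q, rfl⟩; exact x.dualObjective_nonneg q.2 S⟩ ⟨q, hq⟩

instance : Nonempty {q : Fin m → ℝ // 0 ≤ q} := ⟨⟨0, le_rfl⟩⟩

theorem dualValue_nonneg (S : Selection m) : 0 ≤ x.dualValue S :=
  le_ciInf fun q => x.dualObjective_nonneg q.2 S

theorem dualValue_mono {S T : Selection m} (h : S ≤ T) : x.dualValue S ≤ x.dualValue T :=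
  le_ciInf fun q => (x.dualValue_le q.2 S).trans <|
    add_le_add_right (Finset.sum_le_sum fun b _ =>
      mul_le_mul_of_nonneg_left (Nat.cast_le.2 (h b)) (q.2 b)) _

theorem gain_anti {q q' : Fin m → ℝ} (h : q ≤ q') (i : Fin n) (o : Option (Fin m)) :
    x.gain q' i o ≤ x.gain q i o := by
  cases o with
  | none => exact le_rfl
  | some b => exact sub_le_sub_left (h b) _

theorem maxGain_anti {q q' : Fin m → ℝ} (h : q ≤ q') (i : Fin n) :
    x.maxGain q' i ≤ x.maxGain q i :=
  Finset.sup'_le _ _ fun o _ => (x.gain_anti h i o).trans (x.gain_le_maxGain q i o)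

theorem maxGain_inf_add_maxGain_sup (q q' : Fin m → ℝ) (i : Fin n) :
    x.maxGain (q ⊓ q') i + x.maxGain (q ⊔ q') i ≤ x.maxGain q i + x.maxGain q' i := by
  have h : x.maxGain (q ⊓ q') i ≤ max (x.maxGain q i) (x.maxGain q' i) := by
    refine Finset.sup'_le _ _ fun o _ => ?_
    cases o with
    | none => exact le_max_of_le_left (x.maxGain_nonneg q i)
    | some b =>
      rcases le_total (q b) (q' b) with hb | hb
      · refine le_max_of_le_left (le_trans (le_of_eq ?_) (x.gain_le_maxGain q i (some b)))
        simp [gain, hb]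
      · refine le_max_of_le_right (le_trans (le_of_eq ?_) (x.gain_le_maxGain q' i (some b)))
        simp [gain, hb]
  have h₁ := x.maxGain_anti (le_sup_left : q ≤ q ⊔ q') i
  have h₂ := x.maxGain_anti (le_sup_right : q' ≤ q ⊔ q') i
  rcases le_max_iff.1 h with h | h <;> linarith

theorem dualObjective_inf_add_dualObjective_sup (q q' : Fin m → ℝ) (S T : Selection m) :
    x.dualObjective (q ⊓ q') (S ⊔ T) + x.dualObjective (q ⊔ q') (S ⊓ T) ≤
      x.dualObjective q S + x.dualObjective q' T := by
  have h₁ : ∑ i, x.maxGain (q ⊓ q') i + ∑ i, x.maxGain (q ⊔ q') i ≤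
      ∑ i, x.maxGain q i + ∑ i, x.maxGain q' i := by
    simp_rw [← Finset.sum_add_distrib]
    exact Finset.sum_le_sum fun i _ => x.maxGain_inf_add_maxGain_sup q q' i
  have h₂ : ∑ b, (q ⊓ q') b * ((S ⊔ T) b : ℕ) + ∑ b, (q ⊔ q') b * ((S ⊓ T) b : ℕ) ≤
      ∑ b, q b * S b + ∑ b, q' b * T b := by
    simp_rw [← Finset.sum_add_distrib]
    refine Finset.sum_le_sum fun b _ => ?_
    simp only [Pi.sup_apply, Pi.inf_apply]
    rcases le_total (q b) (q' b) with hq | hq <;> rcases le_total (S b) (T b) with hS | hS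
    all_goals
      simp only [hq, hS, sup_of_le_left, sup_of_le_right, inf_of_le_left, inf_of_le_right]
      have : (S b : ℝ) ≤ T b ∨ (T b : ℝ) ≤ S b := le_total _ _
      have hS' := Nat.cast_le (α := ℝ).2 hS
      nlinarith [mul_nonneg (sub_nonneg.2 hq) (sub_nonneg.2 hS')]
  simp only [dualObjective]
  linarith

/-- The dual value is submodular: replacing two price vectors by their meet and join does not
increase the sum of the dual objectives for the join and the meet of two selections. -/
theorem dualValue_sup_add_dualValue_inf (S T : Selection m) :
    x.dualValue (S ⊔ T) + x.dualValue (S ⊓ T) ≤ x.dualValue S + x.dualValue T :=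
  le_ciInf_add_ciInf fun q q' =>
    (add_le_add (x.dualValue_le (le_inf q.2 q'.2) _)
      (x.dualValue_le (q.2.trans le_sup_left) _)).trans
      (x.dualObjective_inf_add_dualObjective_sup q q' S T)

theorem dualValue_eq_profit {q : Fin m → ℝ} (hq : 0 ≤ q) {S : Selection m} {A : Assignment m n}
    (h : x.Supports q A) (hA : Corresponds S A) : x.dualValue S = x.profit A :=
  le_antisymm ((x.dualValue_le hq S).trans (h.profit_eq x hA).ge)
    (le_ciInf fun q' => x.profit_le_dualObjective q' hA)

end SAP

/-! ### The approximation guarantee of the greedy algorithm -/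

namespace Selection

variable {m : ℕ}

/-- The selection `S` with the number of places in the seminar `b` raised to at least `k`. -/
def raise (S : Selection m) (b : Fin m) (k : ℕ) : Selection m := Function.update S b (max (S b) k)

theorem le_raise (S : Selection m) (b : Fin m) (k : ℕ) : S ≤ S.raise b k := by
  intro c
  by_cases h : c = b
  · subst h; simp [raise]
  · simp [raise, h]

theorem raise_le {S T : Selection m} {b : Fin m} {k : ℕ} (h : S ≤ T) (hk : k ≤ T b) :
    S.raise b k ≤ T := by
  intro c
  by_cases hc : c = b
  · subst hc; simpa [raise] using ⟨h c, hk⟩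
  · simpa [raise, hc] using h c

theorem cost_mono {S T : Selection m} (h : S ≤ T) : S.cost ≤ T.cost :=
  Finset.sum_le_sum fun b _ => h b

theorem cost_raise (S : Selection m) (b : Fin m) (k : ℕ) :
    (S.raise b k).cost = S.cost + (k - S b) := by
  rw [cost, cost, ← Finset.add_sum_erase _ _ (Finset.mem_univ b),
    ← Finset.add_sum_erase Finset.univ S (Finset.mem_univ b)]
  have : ∑ c ∈ Finset.univ.erase b, S.raise b k c = ∑ c ∈ Finset.univ.erase b, S c :=
    Finset.sum_congr rfl fun c hc => by simp [raise, (Finset.mem_erase.1 hc).1]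
  rw [this]
  simp only [raise, Function.update_self]
  lia

/-- Submodularity bounds the profit of a join by the profits of the single raises. -/
theorem sub_le_sum_raise {f : Selection m → ℝ}
    (hf : ∀ S T, f (S ⊔ T) + f (S ⊓ T) ≤ f S + f T) (S T : Selection m) :
    f (S ⊔ T) - f S ≤ ∑ b, (f (S.raise b (T b)) - f S) := by
  have key : ∀ D : Finset (Fin m), f (fun b => if b ∈ D then max (S b) (T b) else S b) - f S ≤
      ∑ b ∈ D, (f (S.raise b (T b)) - f S) := by
    intro D
    induction D using Finset.induction_on with
    | empty => simp
    | insert b D hb ih =>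
      rw [Finset.sum_insert hb]
      have h := hf (fun b => if b ∈ D then max (S b) (T b) else S b) (S.raise b (T b))
      have h₁ : (fun b => if b ∈ D then max (S b) (T b) else S b) ⊔ S.raise b (T b) =
          fun c => if c ∈ insert b D then max (S c) (T c) else S c := by
        funext c
        by_cases hc : c = b
        · subst hc; simp [raise, hb]
        · by_cases hD : c ∈ D <;> simp [raise, hc, hD]
      have h₂ : (fun b => if b ∈ D then max (S b) (T b) else S b) ⊓ S.raise b (T b) = S := by
        funext c
        by_cases hc : c = b
        · subst hc; simp [raise, hb]
        · by_cases hD : c ∈ D <;> simp [raise, hc, hD]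
      rw [h₁, h₂] at h
      linarith
  have h := key Finset.univ
  simp only [Finset.mem_univ, if_true] at h
  exact h

end Selection

namespace SAP

variable {m n : ℕ} (x : SAP m n)

theorem sub_le_of_le_of_submodular {f : Selection m → ℝ} (hmono : ∀ S T, S ≤ T → f S ≤ f T)
    (hf : ∀ S T, f (S ⊔ T) + f (S ⊓ T) ≤ f S + f T) {X S : Selection m} (h : X ≤ S) (b : Fin m)
    (k : ℕ) : f (S.raise b k) - f S ≤ f (X.raise b k) - f X := by
  have h₁ : S ⊔ X.raise b k = S.raise b k := by
    funext c
    have hc := h c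
    by_cases hcb : c = b
    · subst hcb
      simp only [Selection.raise, Pi.sup_apply, Function.update_self]
      lia
    · simpa [Selection.raise, hcb] using hc
  have h₂ := hf S (X.raise b k)
  have h₃ := hmono X _ (le_inf h (X.le_raise b k))
  rw [h₁] at h₂
  linarith

theorem Inc.raise {S : Selection m} (hS : x.FeasibleSel S) {b : Fin m} {k : ℕ} (hk : k ∈ x.K b)
    (hb : S b < k) (hc : (S.raise b k).cost ≤ n) : x.Inc S (S.raise b k) := by
  refine ⟨⟨fun c => ?_, hc⟩, S.le_raise b k, b, ?_, ?_⟩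
  · by_cases h : c = b
    · subst h; simpa [Selection.raise, hb.le] using hk
    · simpa [Selection.raise, h] using hS.1 c
  · simpa [Selection.raise] using hb
  · intro c hc
    by_contra h
    simp [Selection.raise, h] at hc

/-- Three rounds of taking the seminar with the largest increase lead to a start from which every
further seminar of the optimal solution gains at most a third of the profit of the start. -/
theorem exists_start {f : Selection m → ℝ} (hmono : ∀ S T, S ≤ T → f S ≤ f T)
    (hf : ∀ S T, f (S ⊔ T) + f (S ⊓ T) ≤ f S + f T) (h0 : 0 ≤ f 0) {T : Selection m}
    (hT : x.FeasibleSel T) :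
    ∃ S₀, x.IsStart S₀ ∧ S₀ ≤ T ∧
      ∀ S, S₀ ≤ S → ∀ b, f (S.raise b (T b)) - f S ≤ f S₀ / 3 := by
  rcases isEmpty_or_nonempty (Fin m) with hm | hm
  · exact ⟨T, ⟨hT, by simp⟩, le_rfl, fun S _ b => hm.elim b⟩
  have hmax : ∀ X : Selection m, ∃ b, ∀ c, f (X.raise c (T c)) ≤ f (X.raise b (T b)) :=
    fun X => Finite.exists_max _
  choose best hbest using hmax
  let next : Selection m → Selection m := fun X => X.raise (best X) (T (best X))
  have hle : ∀ X, X ≤ next X := fun X => X.le_raise _ _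
  have hnext : ∀ X, X ≤ T → next X ≤ T := fun X h => Selection.raise_le h le_rfl
  have hmem : ∀ X : Selection m, (∀ b, X b = 0 ∨ X b = T b) →
      ∀ b, next X b = 0 ∨ next X b = T b := by
    intro X hX b
    have := hX b
    by_cases h : b = best X
    · simp only [next, Selection.raise, h, Function.update_self]
      rw [h] at this
      lia
    · simpa [next, Selection.raise, h] using this
  have hsupp : ∀ X : Selection m, (Finset.univ.filter fun b => 0 < next X b).card ≤
      (Finset.univ.filter fun b => 0 < X b).card + 1 := by
    intro X
    refine (Finset.card_le_card ?_).trans (Finset.card_insert_le (best X) _)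
    intro b hb
    by_cases h : b = best X
    · simp [h]
    · have hb' := (Finset.mem_filter.1 hb).2
      simp only [next, Selection.raise, Function.update_of_ne h] at hb'
      simpa [h] using hb'
  have hT0 : (0 : Selection m) ≤ T := fun b => Nat.zero_le _
  refine ⟨next (next (next 0)), ⟨⟨fun b => ?_, ?_⟩, ?_⟩, hnext _ (hnext _ (hnext _ hT0)), ?_⟩
  · rcases hmem _ (hmem _ (hmem 0 fun b => .inl rfl)) b with h | h <;> rw [h]
    exacts [x.zero_mem b, hT.1 b]
  · exact (Selection.cost_mono (hnext _ (hnext _ (hnext _ hT0)))).trans hT.2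
  · have h₁ := hsupp 0
    have h₂ := hsupp (next 0)
    have h₃ := hsupp (next (next 0))
    have h₀ : (Finset.univ.filter fun b => 0 < (0 : Selection m) b).card = 0 := by simp
    lia
  · intro S hS b
    have h₂ := (hle (next (next 0))).trans hS
    have h₁ := (hle (next 0)).trans h₂
    have h₀ := (hle 0).trans h₁
    have g₀ := sub_le_of_le_of_submodular hmono hf h₀ b (T b)
    have g₁ := sub_le_of_le_of_submodular hmono hf h₁ b (T b)
    have g₂ := sub_le_of_le_of_submodular hmono hf h₂ b (T b)
    have k₀ := hbest 0 b
    have k₁ := hbest (next 0) b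
    have k₂ := hbest (next (next 0)) b
    simp only [next] at *
    linarith

/-- While the greedy selection `S` has not reached the guarantee, some raise of a seminar to its
number of places in the optimal selection `T` is affordable and at least as dense as the gap to
the optimum. The alternative to being affordable is a raise beyond the budget; the exponential
bound on the gap then holds after this virtual step, whose profit is at most a third of the profit
of the start. -/
theorem exists_affordable_raise {f : Selection m → ℝ} (hmono : ∀ S T, S ≤ T → f S ≤ f T)
    (hf : ∀ S T, f (S ⊔ T) + f (S ⊓ T) ≤ f S + f T) (h0 : 0 ≤ f 0) {T S₀ S : Selection m}
    (hT : T.cost ≤ n) (hS₀ : S₀ ≤ T)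
    (hthird : ∀ S, S₀ ≤ S → ∀ b, f (S.raise b (T b)) - f S ≤ f S₀ / 3) (hS : S₀ ≤ S)
    (hgap : f T - f S ≤
      Real.exp (-((S.cost - S₀.cost : ℝ) / (n - S₀.cost))) * (f T - f S₀))
    (hlt : f S < (1 - Real.exp (-1)) * f T) :
    ∃ b, S b < T b ∧ (S.raise b (T b)).cost ≤ n ∧ (S₀.cost : ℝ) < n ∧
      (f T - f S) * (T b - S b) ≤ (f (S.raise b (T b)) - f S) * (n - S₀.cost) := by
  have hfT : 0 ≤ f T := h0.trans (hmono _ _ fun b => Nat.zero_le _)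
  have hfS₀ : 0 ≤ f S₀ := h0.trans (hmono _ _ fun b => Nat.zero_le _)
  have hexp : 0 < Real.exp (-1) := Real.exp_pos _
  have hexp3 : 1 / 3 ≤ Real.exp (-1) := by
    rw [Real.exp_neg, ← one_div]
    exact one_div_le_one_div_of_le (Real.exp_pos _) (Real.exp_one_lt_d9.le.trans (by norm_num))
  have hpos : 0 < f T - f S := by nlinarith
  -- The seminars in which `S` has fewer places than `T` need at most `n - c(S₀)` further places.
  have hcost : ∑ b, ((T b - S b : ℕ) : ℝ) ≤ n - S₀.cost := by
    have h₁ : ∑ b, (T b - S b) + S₀.cost ≤ T.cost := by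
      rw [Selection.cost, Selection.cost, ← Finset.sum_add_distrib]
      refine Finset.sum_le_sum fun b _ => ?_
      have := hS b
      have := hS₀ b
      lia
    have h₂ : ((∑ b, (T b - S b) + S₀.cost : ℕ) : ℝ) ≤ n := by exact_mod_cast h₁.trans hT
    push_cast at h₂ ⊢
    linarith
  have hsum := Selection.sub_le_sum_raise hf S T
  have hsup : f T ≤ f (S ⊔ T) := hmono _ _ le_sup_right
  obtain ⟨b, hb, hdens⟩ : ∃ b, S b < T b ∧
      (f T - f S) * (T b - S b) ≤ (f (S.raise b (T b)) - f S) * (n - S₀.cost) := by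
    by_contra! hcon
    have hN : (0 : ℝ) ≤ n - S₀.cost :=
      (Finset.sum_nonneg fun b _ => Nat.cast_nonneg _).trans hcost
    have hle : ∀ b, (f (S.raise b (T b)) - f S) * (n - S₀.cost) ≤
        (f T - f S) * ((T b - S b : ℕ) : ℝ) := by
      intro b
      by_cases hb : S b < T b
      · rw [Nat.cast_sub hb.le]
        exact (hcon b hb).le
      · have hr : S.raise b (T b) = S := by
          rw [Selection.raise, max_eq_left (not_lt.1 hb), Function.update_eq_self]
        rw [hr, sub_self, zero_mul]
        positivity
    obtain ⟨b, hb⟩ : ∃ b, S b < T b := by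
      by_contra! h
      have := hmono T S h
      linarith
    have hlt' : ∑ b, (f (S.raise b (T b)) - f S) * (n - S₀.cost) <
        ∑ b, (f T - f S) * ((T b - S b : ℕ) : ℝ) := by
      refine Finset.sum_lt_sum (fun b _ => hle b) ⟨b, Finset.mem_univ _, ?_⟩
      rw [Nat.cast_sub hb.le]
      exact hcon b hb
    rw [← Finset.sum_mul, ← Finset.mul_sum] at hlt'
    have h₁ := mul_le_mul_of_nonneg_left hcost hpos.le
    have h₂ := mul_le_mul_of_nonneg_right (show f T - f S ≤
      ∑ b, (f (S.raise b (T b)) - f S) by linarith) hN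
    linarith
  have hN : (0 : ℝ) < n - S₀.cost := by
    refine lt_of_lt_of_le ?_ hcost
    refine Finset.sum_pos' (fun b _ => Nat.cast_nonneg _) ⟨b, Finset.mem_univ _, ?_⟩
    exact Nat.cast_pos.2 (by lia)
  refine ⟨b, hb, ?_, by linarith, hdens⟩
  by_contra! hover
  rw [Selection.cost_raise] at hover
  have hover' : (n : ℝ) < S.cost + (T b - S b) := by
    rw [← Nat.cast_sub hb.le]
    exact_mod_cast hover
  have hmarg := hthird S hS b
  set d : ℝ := (T b - S b) / (n - S₀.cost)
  have hd : (f T - f S) * d ≤ f (S.raise b (T b)) - f S := by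
    rw [← mul_div_assoc, div_le_iff₀ hN]
    exact hdens
  have h₁ : f T - f (S.raise b (T b)) ≤ Real.exp (-d) * (f T - f S) := by
    have := Real.add_one_le_exp (-d)
    nlinarith
  have h₂ : Real.exp (-d) * Real.exp (-((S.cost - S₀.cost : ℝ) / (n - S₀.cost))) ≤
      Real.exp (-1) := by
    rw [← Real.exp_add, Real.exp_le_exp, ← neg_add, ← add_div, neg_le_neg_iff, le_div_iff₀ hN]
    linarith
  have h₃ : 0 ≤ f T - f S₀ := sub_nonneg.2 (hmono _ _ hS₀)
  have h₄ : f T - f (S.raise b (T b)) ≤ Real.exp (-1) * (f T - f S₀) :=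
    calc _ ≤ Real.exp (-d) * (f T - f S) := h₁
      _ ≤ Real.exp (-d) * (Real.exp (-((S.cost - S₀.cost : ℝ) / (n - S₀.cost))) *
          (f T - f S₀)) := mul_le_mul_of_nonneg_left hgap (Real.exp_pos _).le
      _ = (Real.exp (-d) * Real.exp (-((S.cost - S₀.cost : ℝ) / (n - S₀.cost)))) *
          (f T - f S₀) := by ring
      _ ≤ _ := mul_le_mul_of_nonneg_right h₂ h₃
  nlinarith

theorem FeasibleSel.of_reflTransGen {S₀ S : Selection m} (h₀ : x.FeasibleSel S₀)
    (h : Relation.ReflTransGen x.GreedyStep S₀ S) : x.FeasibleSel S := by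
  induction h with
  | refl => exact h₀
  | tail _ h _ => exact h.1.1

theorem Inc.cost_lt {S T : Selection m} (h : x.Inc S T) : S.cost < T.cost := by
  obtain ⟨b, hb, -⟩ := h.2.2
  exact Finset.sum_lt_sum (fun c _ => h.2.1 c) ⟨b, Finset.mem_univ _, hb⟩

/-- Every terminal selection of a greedy run from the start of `exists_start` meets the
guarantee. -/
theorem greedy_guarantee {f : Selection m → ℝ} (hmono : ∀ S T, S ≤ T → f S ≤ f T)
    (hf : ∀ S T, f (S ⊔ T) + f (S ⊓ T) ≤ f S + f T) (h0 : 0 ≤ f 0)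
    (hfp : ∀ S : Selection m, S.cost ≤ n → x.selProfit S = f S) {T S₀ : Selection m}
    (hT : x.FeasibleSel T) (hstart : x.IsStart S₀) (hS₀ : S₀ ≤ T)
    (hthird : ∀ S, S₀ ≤ S → ∀ b, f (S.raise b (T b)) - f S ≤ f S₀ / 3) {S : Selection m}
    (hS : Relation.ReflTransGen x.GreedyStep S₀ S) (hend : ¬ ∃ S', x.Inc S S') :
    (1 - Real.exp (-1)) * f T ≤ f S := by
  have key : S₀ ≤ S ∧ ((1 - Real.exp (-1)) * f T ≤ f S ∨ f T - f S ≤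
      Real.exp (-((S.cost - S₀.cost : ℝ) / (n - S₀.cost))) * (f T - f S₀)) := by
    clear hend
    induction hS with
    | refl => exact ⟨le_rfl, .inr (by simp)⟩
    | @tail S S' hSr hstep ih =>
      obtain ⟨hle, ih⟩ := ih
      have hSS' : S ≤ S' := hstep.1.2.1
      refine ⟨hle.trans hSS', ?_⟩
      have hmonoS := hmono _ _ hSS'
      by_cases hlt : (1 - Real.exp (-1)) * f T ≤ f S
      · exact .inl (hlt.trans hmonoS)
      rw [not_le] at hlt
      have hgap := ih.resolve_left (not_le.2 hlt)
      obtain ⟨b, hb, hc, hN, hdens⟩ := exists_affordable_raise hmono hf h0 hT.2 hS₀ hthird hle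
        hgap hlt
      have hfeas := FeasibleSel.of_reflTransGen x hstart.1 hSr
      have hinc := Inc.raise x hfeas (hT.1 b) hb hc
      have hd := hstep.2 _ hinc
      rw [density, density, hfp _ hc, hfp _ hfeas.2, hfp _ hstep.1.1.2, Selection.cost_raise,
        Nat.cast_add, Nat.cast_sub hb.le, add_sub_cancel_left] at hd
      have hb' : (0 : ℝ) < T b - S b := sub_pos.2 (Nat.cast_lt.2 hb)
      have hN' : (0 : ℝ) < n - S₀.cost := sub_pos.2 hN
      have hc' : (0 : ℝ) < S'.cost - S.cost := sub_pos.2 (Nat.cast_lt.2 (hstep.1.cost_lt x))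
      right
      have h₁ : (f T - f S) / (n - S₀.cost) ≤ (f S' - f S) / (S'.cost - S.cost) := by
        refine le_trans ?_ hd
        rw [div_le_div_iff₀ hN' hb']
        exact hdens
      have hpos : 0 ≤ f T - f S := by
        have hfT : 0 ≤ f T := h0.trans (hmono _ _ fun b => Nat.zero_le _)
        nlinarith [Real.exp_pos (-1)]
      set d : ℝ := (S'.cost - S.cost) / (n - S₀.cost) with hd_def
      have h₂ : (f T - f S) * d ≤ f S' - f S := by
        rw [hd_def, ← mul_div_assoc, div_le_iff₀ hN']
        rwa [div_le_div_iff₀ hN' hc'] at h₁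
      have h₃ : f T - f S' ≤ Real.exp (-d) * (f T - f S) := by
        have := Real.add_one_le_exp (-d)
        nlinarith
      refine h₃.trans ((mul_le_mul_of_nonneg_left hgap (Real.exp_pos _).le).trans_eq ?_)
      rw [← mul_assoc, ← Real.exp_add, hd_def]
      congr 2
      ring
  by_contra hlt
  obtain ⟨b, hb, hc, -⟩ := exists_affordable_raise hmono hf h0 hT.2 hS₀ hthird key.1
    (key.2.resolve_left hlt) (not_le.1 hlt)
  exact hend ⟨_, Inc.raise x (FeasibleSel.of_reflTransGen x hstart.1 hS) (hT.1 b) hb hc⟩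

end SAP

/-! ### Alternating trees with prices

The nodes of the search are the numbers `0, …, m`: the seminars and, as node `m`, the place of the
unassigned students. -/

namespace SAP

/-- The loss of the student `i` at prices `q`, if she moves from her node `A i` to the node `v`,
where `w` contains the profits. -/
def slack (w : ℕ → ℕ → ℝ) (A : ℕ → ℕ) (q : ℕ → ℝ) (i v : ℕ) : ℝ :=
  w i (A i) - q (A i) - (w i v - q v)

/-- The number of students at the node `v`. -/
def load (n : ℕ) (A : ℕ → ℕ) (v : ℕ) : ℕ := ((Finset.range n).filter (A · = v)).card

theorem load_update {n : ℕ} (A : ℕ → ℕ) {i : ℕ} (hi : i < n) (w v : ℕ) :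
    load n (Function.update A i w) v + (if v = A i then 1 else 0) =
      load n A v + if v = w then 1 else 0 := by
  have h : ∀ B : ℕ → ℕ, load n B v =
      (if B i = v then 1 else 0) + ∑ j ∈ (Finset.range n).erase i, if B j = v then 1 else 0 := by
    intro B
    rw [load, Finset.card_filter]
    exact (Finset.add_sum_erase _ (fun j => if B j = v then 1 else 0)
      (Finset.mem_range.2 hi)).symm
  rw [h, h, Function.update_self]
  have : ∑ j ∈ (Finset.range n).erase i, (if Function.update A i w j = v then 1 else 0) =
      ∑ j ∈ (Finset.range n).erase i, if A j = v then 1 else 0 :=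
    Finset.sum_congr rfl fun j hj => by rw [Function.update_of_ne (Finset.mem_erase.1 hj).1]
  rw [this]
  simp only [eq_comm (a := v)]
  lia

theorem sum_load {m n : ℕ} {A : ℕ → ℕ} (h : ∀ i < n, A i < m) :
    ∑ v ∈ Finset.range m, load n A v = n := by
  have := Finset.card_eq_sum_card_fiberwise (s := Finset.range n) (t := Finset.range m) (f := A)
    fun i hi => by simpa using h i (by simpa using hi)
  simpa [load] using this.symm

/-- The prices `q` support the placement `A` of the students at the nodes. -/
structure NodeSupports (m n : ℕ) (w : ℕ → ℕ → ℝ) (A : ℕ → ℕ) (q : ℕ → ℝ) : Prop where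
  le : ∀ i < n, A i ≤ m
  slack_nonneg : ∀ i < n, ∀ v ≤ m, 0 ≤ slack w A q i v

/-- The number of nodes that have not been reached. -/
def unreached (m : ℕ) (R : ℕ → ℕ) : ℕ := ((Finset.range (m + 1)).filter (R · = 0)).card

/-- The nodes `v` with `R v ≠ 0` form a tree with root `m` and ranks `ρ`: the student `par v`
sits at the predecessor of `v` and can move to `v` without loss. -/
structure Tree (m n : ℕ) (w : ℕ → ℕ → ℝ) (A : ℕ → ℕ) (q : ℕ → ℝ) (R par ρ : ℕ → ℕ) : Prop where
  supports : NodeSupports m n w A q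
  price_root : q m = 0
  root : R m ≠ 0
  par_lt : ∀ v < m, R v ≠ 0 → par v < n
  reached_par : ∀ v < m, R v ≠ 0 → R (A (par v)) ≠ 0
  rank_lt : ∀ v < m, R v ≠ 0 → ρ (A (par v)) < ρ v
  slack_par : ∀ v < m, R v ≠ 0 → slack w A q (par v) v = 0
  rank_le : ∀ v ≤ m, R v ≠ 0 → ρ v + unreached m R ≤ m

theorem unreached_update {m : ℕ} {R : ℕ → ℕ} {v : ℕ} (hv : v ≤ m) (h : R v = 0) :
    unreached m (Function.update R v 1) + 1 = unreached m R := by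
  have : (Finset.range (m + 1)).filter (R · = 0) =
      insert v ((Finset.range (m + 1)).filter (Function.update R v 1 · = 0)) := by
    ext u
    by_cases hu : u = v
    · subst hu; simp [h]; lia
    · simp [hu]
  rw [unreached, unreached, this, Finset.card_insert_of_notMem (by simp)]

/-- Lowering the prices of the unreached nodes by the smallest slack `δ` of an edge that leaves
the tree makes this edge tight and keeps the prices supporting. -/
theorem Tree.grow {m n : ℕ} {w : ℕ → ℕ → ℝ} {A : ℕ → ℕ} {q q' : ℕ → ℝ} {R par ρ : ℕ → ℕ}
    (h : Tree m n w A q R par ρ) {i v : ℕ} {δ : ℝ} (hi : i < n) (hRi : R (A i) ≠ 0) (hv : v ≤ m)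
    (hRv : R v = 0) (hδ : δ = slack w A q i v)
    (hmin : ∀ j u, j < n → R (A j) ≠ 0 → u ≤ m → R u = 0 → δ ≤ slack w A q j u)
    (hq' : ∀ u ≤ m, q' u = if R u = 0 then q u - δ else q u) :
    ∃ ρ', Tree m n w A q' (Function.update R v 1) (Function.update par v i) ρ' := by
  have hδ0 : 0 ≤ δ := hδ ▸ h.supports.slack_nonneg i hi v hv
  have hvm : v ≠ m := fun e => h.root (e ▸ hRv)
  have hun := unreached_update hv hRv
  have hne : ∀ u, R u ≠ 0 → u ≠ v := fun u hu e => hu (e ▸ hRv)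
  have hAm : ∀ u < m, R u ≠ 0 → A (par u) ≤ m := fun u hu hR =>
    h.supports.le _ (h.par_lt u hu hR)
  -- The new node is last in rank: the ranks so far are at most `m` minus the number of nodes that
  -- were unreached, which now decreases by one.
  refine ⟨Function.update ρ v (m - unreached m (Function.update R v 1)), ?_, ?_, ?_, ?_, ?_, ?_,
    ?_, ?_⟩
  · refine ⟨h.supports.le, fun j hj u hu => ?_⟩
    have h₀ := h.supports.slack_nonneg j hj u hu
    simp only [slack] at h₀ ⊢
    rw [hq' _ (h.supports.le j hj), hq' u hu]
    by_cases hj' : R (A j) = 0 <;> by_cases hu' : R u = 0 <;>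
      simp only [hj', hu', if_true, if_false]
    · linarith
    · linarith
    · have := hmin j u hj hj' hu hu'
      simp only [slack] at this
      linarith
    · linarith
  · rw [hq' m le_rfl, if_neg h.root, h.price_root]
  · rw [Function.update_of_ne (Ne.symm hvm)]
    exact h.root
  · intro u hu hR
    by_cases e : u = v
    · rw [e, Function.update_self]; exact hi
    · rw [Function.update_of_ne e] at hR ⊢
      exact h.par_lt u hu hR
  · intro u hu hR
    by_cases e : u = v
    · rwa [e, Function.update_self, Function.update_of_ne (hne _ hRi)]
    · rw [Function.update_of_ne e] at hR ⊢
      have := h.reached_par u hu hR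
      rwa [Function.update_of_ne (hne _ this)]
  · intro u hu hR
    by_cases e : u = v
    · rw [e, Function.update_self, Function.update_self, Function.update_of_ne (hne _ hRi)]
      have := h.rank_le _ (h.supports.le i hi) hRi
      lia
    · rw [Function.update_of_ne e] at hR
      rw [Function.update_of_ne e, Function.update_of_ne e,
        Function.update_of_ne (hne _ (h.reached_par u hu hR))]
      exact h.rank_lt u hu hR
  · intro u hu hR
    by_cases e : u = v
    · rw [e, Function.update_self, slack, hq' _ (h.supports.le i hi), hq' v hv, if_neg hRi,
        if_pos hRv, hδ, slack]
      ring
    · rw [Function.update_of_ne e] at hR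
      have := h.slack_par u hu hR
      simp only [slack] at this
      rw [Function.update_of_ne e, slack, hq' _ (hAm u hu hR), hq' u hu.le, if_neg hR,
        if_neg (h.reached_par u hu hR), this]
  · intro u hu hR
    by_cases e : u = v
    · rw [e, Function.update_self]
      have : unreached m R ≤ m := le_trans (Nat.le_add_left _ _) (h.rank_le m le_rfl h.root)
      lia
    · rw [Function.update_of_ne e] at hR ⊢
      have := h.rank_le u hu hR
      lia

/-- The state of the augmentation along a tree path, when the place at the node `c` is still to be
filled: everything that is needed of the tree concerns the nodes of rank at most `ρ c`. -/
structure Trace (m n : ℕ) (w : ℕ → ℕ → ℝ) (A : ℕ → ℕ) (q : ℕ → ℝ) (par ρ : ℕ → ℕ)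
    (R : ℕ → ℕ) (c : ℕ) : Prop where
  supports : NodeSupports m n w A q
  cur_le : c ≤ m
  reached : R c ≠ 0
  par_lt : ∀ v < m, R v ≠ 0 → ρ v ≤ ρ c → par v < n
  reached_par : ∀ v < m, R v ≠ 0 → ρ v ≤ ρ c → R (A (par v)) ≠ 0
  rank_lt : ∀ v < m, R v ≠ 0 → ρ v ≤ ρ c → ρ (A (par v)) < ρ v
  slack_par : ∀ v < m, R v ≠ 0 → ρ v ≤ ρ c → slack w A q (par v) v = 0

theorem Tree.trace {m n : ℕ} {w : ℕ → ℕ → ℝ} {A : ℕ → ℕ} {q : ℕ → ℝ} {R par ρ : ℕ → ℕ}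
    (h : Tree m n w A q R par ρ) {c : ℕ} (hc : c ≤ m) (hR : R c ≠ 0) :
    Trace m n w A q par ρ R c :=
  ⟨h.supports, hc, hR, fun v hv hR _ => h.par_lt v hv hR, fun v hv hR _ => h.reached_par v hv hR,
    fun v hv hR _ => h.rank_lt v hv hR, fun v hv hR _ => h.slack_par v hv hR⟩

theorem Trace.step {m n : ℕ} {w : ℕ → ℕ → ℝ} {A : ℕ → ℕ} {q : ℕ → ℝ} {R par ρ : ℕ → ℕ} {c : ℕ}
    (h : Trace m n w A q par ρ R c) (hc : c < m) :
    Trace m n w (Function.update A (par c) c) q par ρ R (A (par c)) := by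
  have hlt := h.rank_lt c hc h.reached le_rfl
  have hpar := h.par_lt c hc h.reached le_rfl
  -- A student who has moved is not needed again: she sat at a node of the rank bound, while the
  -- remaining edges leave nodes of smaller rank.
  have hne : ∀ v < m, R v ≠ 0 → ρ v ≤ ρ (A (par c)) → par v ≠ par c := by
    intro v hv hR hρ e
    have := h.rank_lt v hv hR (hρ.trans hlt.le)
    rw [e] at this
    lia
  refine ⟨⟨fun i hi => ?_, fun i hi v hv => ?_⟩, h.supports.le _ hpar,
    h.reached_par c hc h.reached le_rfl, fun v hv hR hρ => h.par_lt v hv hR (hρ.trans hlt.le),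
    fun v hv hR hρ => ?_, fun v hv hR hρ => ?_, fun v hv hR hρ => ?_⟩
  · by_cases e : i = par c
    · rw [e, Function.update_self]; exact hc.le
    · rw [Function.update_of_ne e]; exact h.supports.le i hi
  · have h₀ := h.supports.slack_nonneg i hi v hv
    by_cases e : i = par c
    · have h₁ := h.slack_par c hc h.reached le_rfl
      subst e
      simp only [slack, Function.update_self] at h₀ h₁ ⊢
      linarith
    · simpa only [slack, Function.update_of_ne e] using h₀
  · rw [Function.update_of_ne (hne v hv hR hρ)]
    exact h.reached_par v hv hR (hρ.trans hlt.le)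
  · rw [Function.update_of_ne (hne v hv hR hρ)]
    exact h.rank_lt v hv hR (hρ.trans hlt.le)
  · simp only [slack, Function.update_of_ne (hne v hv hR hρ)]
    exact h.slack_par v hv hR (hρ.trans hlt.le)

/-- `i`, `v`, `δ` describe an element of `C` of smallest slack; `v = m` stands for `C` being
empty. -/
def IsMinEdge (m : ℕ) (C : ℕ → ℕ → Prop) (f : ℕ → ℕ → ℝ) (i v : ℕ) (δ : ℝ) : Prop :=
  (v = m ∧ ∀ j u, ¬ C j u) ∨ (v < m ∧ C i v ∧ δ = f i v ∧ ∀ j u, C j u → δ ≤ f j u)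

theorem IsMinEdge.congr {m : ℕ} {C C' : ℕ → ℕ → Prop} {f : ℕ → ℕ → ℝ} {i v : ℕ} {δ : ℝ}
    (h : IsMinEdge m C f i v δ) (hC : ∀ j u, C' j u ↔ C j u) : IsMinEdge m C' f i v δ := by
  simpa only [IsMinEdge, hC] using h

theorem IsMinEdge.replace {m : ℕ} {C C' : ℕ → ℕ → Prop} {f : ℕ → ℕ → ℝ} {i v i' v' : ℕ} {δ : ℝ}
    (h : IsMinEdge m C f i v δ) (hv' : v' < m) (hC : ∀ j u, C' j u ↔ C j u ∨ (j = i' ∧ u = v'))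
    (hδ : ¬ (v < m ∧ δ ≤ f i' v')) : IsMinEdge m C' f i' v' (f i' v') := by
  refine .inr ⟨hv', (hC _ _).2 (.inr ⟨rfl, rfl⟩), rfl, fun j u hj => ?_⟩
  rcases (hC j u).1 hj with hj | ⟨rfl, rfl⟩
  · rcases h with ⟨-, h⟩ | ⟨hv, -, -, h⟩
    · exact absurd hj (h j u)
    · have := h j u hj
      by_contra hlt
      exact hδ ⟨hv, by linarith⟩
  · exact le_rfl

theorem IsMinEdge.keep {m : ℕ} {C C' : ℕ → ℕ → Prop} {f : ℕ → ℕ → ℝ} {i v i' v' : ℕ} {δ : ℝ}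
    (h : IsMinEdge m C f i v δ) (hC : ∀ j u, C' j u ↔ C j u ∨ (j = i' ∧ u = v'))
    (hδ : v < m ∧ δ ≤ f i' v') : IsMinEdge m C' f i v δ := by
  rcases h with ⟨hv, -⟩ | ⟨hv, hC₀, e, h⟩
  · lia
  · refine .inr ⟨hv, (hC _ _).2 (.inl hC₀), e, fun j u hj => ?_⟩
    rcases (hC j u).1 hj with hj | ⟨rfl, rfl⟩
    exacts [h j u hj, hδ.2]

end SAP

/-! ### Rules for common program patterns -/

namespace RAM

theorem beq_eq_false_of_ne {a b : ℕ} (h : a ≠ b) : Nat.beq a b = false := by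
  rwa [← Bool.not_eq_true, Nat.beq_eq]

namespace Runs

variable {z : ℕ} {P : Prog} {s : Mem} {Q : Mem → Prop}

theorem assign {a : ℕ} {e : NExpr} (h : Q (s.setNat a 0 0 (e.eval s))) :
    Runs z (.assign a e) s Q := natStore h

theorem assignReal {a : ℕ} {e : RExpr} (h : Q (s.setReal a 0 0 (e.eval s))) :
    Runs z (.assignReal a e) s Q := realStore h

theorem assign_seq {a : ℕ} {e : NExpr} (h : ∀ s', Frame (.assign a e) s s' →
    s'.nat a 0 0 = e.eval s → Runs z P s' Q) : Runs z (.seq (.assign a e) P) s Q :=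
  seq (Q := fun s' => s'.nat a 0 0 = e.eval s) (assign (by simp [Mem.setNat])) h

theorem assignReal_seq {a : ℕ} {e : RExpr} (h : ∀ s', Frame (.assignReal a e) s s' →
    s'.real a 0 0 = e.eval s → Runs z P s' Q) : Runs z (.seq (.assignReal a e) P) s Q :=
  seq (Q := fun s' => s'.real a 0 0 = e.eval s) (assignReal (by simp [Mem.setReal])) h

theorem store_seq {a : ℕ} {i e : NExpr} (h : ∀ s', Frame (.natStore a i (.const 0) e) s s' →
    (∀ j, s'.nat a j 0 = Function.update (fun j => s.nat a j 0) (i.eval s) (e.eval s) j) →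
      Runs z P s' Q) : Runs z (.seq (.natStore a i (.const 0) e) P) s Q :=
  seq (Q := fun s' => ∀ j, s'.nat a j 0 =
      Function.update (fun j => s.nat a j 0) (i.eval s) (e.eval s) j)
    (natStore fun j => by
      by_cases hj : j = i.eval s
      · subst hj; simp [Mem.setNat, NExpr.eval]
      · simp [Mem.setNat, hj]) h

end Runs

/-- `a[l] := f` for `l = 0, …, e - 1`. -/
def Prog.fill (l : ℕ) (e : NExpr) (a : ℕ) (f : NExpr) : Prog :=
  .forLoop l e (.natStore a (.var l) (.const 0) f)

theorem Runs.fill {z N l a : ℕ} {e f : NExpr} {s : Mem} (g : ℕ → ℕ) (hz : N ≤ z) (hla : l ≠ a)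
    (he : ∀ s', Frame (.fill l e a f) s s' → e.eval s' = N)
    (hf : ∀ k < N, ∀ s', Frame (.fill l e a f) s s' → s'.nat l 0 0 = k → f.eval s' = g k) :
    Runs z (.fill l e a f) s fun s' => ∀ k < N, s'.nat a k 0 = g k := by
  refine Runs.forLoop (fun N s' => ∀ k < N, s'.nat a k 0 = g k) hz ?_ he ?_ ?_ ?_
  · simp [Prog.writesNat, beq_eq_false_of_ne hla.symm]
  · intro k s v h j hj
    rw [nat_setNat_of_ne hla.symm]
    exact h j hj
  · simp
  · intro k s' hk hF hl hI
    refine natStore fun j hj => ?_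
    by_cases hjk : j = k
    · subst hjk
      simp [Mem.setNat, hl, hf j hk s' hF hl, NExpr.eval]
    · simpa [Mem.setNat, hl, hjk] using hI j (by lia)

/-- `r := ∑ f` for `l = 0, …, e - 1`. -/
def Prog.sumReal (l : ℕ) (e : NExpr) (r : ℕ) (f : RExpr) : Prog :=
  .seq (.assignReal r .zero) (.forLoop l e (.assignReal r (.add (.var r) f)))

theorem Runs.sumReal {z N l r : ℕ} {e : NExpr} {f : RExpr} {s : Mem} (g : ℕ → ℝ) (hz : N ≤ z)
    (he : ∀ s', Frame (.sumReal l e r f) s s' → e.eval s' = N)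
    (hf : ∀ k < N, ∀ s', Frame (.sumReal l e r f) s s' → s'.nat l 0 0 = k → f.eval s' = g k) :
    Runs z (.sumReal l e r f) s fun s' => s'.real r 0 0 = ∑ k ∈ Finset.range N, g k := by
  have h₂ : ∀ s₁ s₂, Frame (.forLoop l e (.assignReal r (.add (.var r) f))) s₁ s₂ →
      Frame (.sumReal l e r f) s₁ s₂ := fun s₁ s₂ h => h.mono
    (fun c hc => by simpa [Prog.sumReal, Prog.writesNat, Prog.assignReal] using hc)
    (fun c hc => by
      simp only [Prog.sumReal, Prog.writesReal, Bool.or_eq_false_iff] at hc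
      exact hc.2)
  refine assignReal_seq fun s₁ hF₁ h₁ => ?_
  have h₁' : Frame (.sumReal l e r f) s s₁ := hF₁.mono
    (fun c hc => by simp [Prog.writesNat, Prog.assignReal])
    (fun c hc => by
      simp only [Prog.sumReal, Prog.writesReal, Prog.assignReal, Bool.or_eq_false_iff] at hc
      exact hc.1)
  refine Runs.forLoop (fun N s' => s'.real r 0 0 = ∑ k ∈ Finset.range N, g k) hz rfl
    (fun s' h => he s' (h₁'.trans (h₂ _ _ h))) (fun _ _ _ h => h) (by simpa [RExpr.eval] using h₁)
    fun k s' hk hF hl hI => assignReal ?_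
  simp [Mem.setReal, RExpr.eval, hI, hf k hk s' (h₁'.trans (h₂ _ _ hF)) hl, Finset.sum_range_succ]

/-- `r := ∑ f` for `l = 0, …, e - 1`. -/
def Prog.sumNat (l : ℕ) (e : NExpr) (r : ℕ) (f : NExpr) : Prog :=
  .seq (.assign r (.const 0)) (.forLoop l e (.assign r (.add (.var r) f)))

theorem Runs.sumNat {z N l r : ℕ} {e : NExpr} {f : NExpr} {s : Mem} (g : ℕ → ℕ) (hz : N ≤ z)
    (hlr : l ≠ r) (he : ∀ s', Frame (.sumNat l e r f) s s' → e.eval s' = N)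
    (hf : ∀ k < N, ∀ s', Frame (.sumNat l e r f) s s' → s'.nat l 0 0 = k → f.eval s' = g k) :
    Runs z (.sumNat l e r f) s fun s' => s'.nat r 0 0 = ∑ k ∈ Finset.range N, g k := by
  have h₂ : ∀ s₁ s₂, Frame (.forLoop l e (.assign r (.add (.var r) f))) s₁ s₂ →
      Frame (.sumNat l e r f) s₁ s₂ := fun s₁ s₂ h => h.mono
    (fun c hc => by
      simp only [Prog.sumNat, Prog.writesNat, Bool.or_eq_false_iff] at hc
      exact hc.2)
    (fun c hc => by simp [Prog.writesReal, Prog.assign, Prog.forLoop])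
  refine assign_seq fun s₁ hF₁ h₁ => ?_
  have h₁' : Frame (.sumNat l e r f) s s₁ := hF₁.mono
    (fun c hc => by
      simp only [Prog.sumNat, Prog.writesNat, Prog.assign, Bool.or_eq_false_iff] at hc
      exact hc.1)
    (fun c hc => by simp [Prog.writesReal, Prog.assign])
  refine Runs.forLoop (fun N s' => s'.nat r 0 0 = ∑ k ∈ Finset.range N, g k) hz
    (by simp [Prog.assign, Prog.writesNat, beq_eq_false_of_ne hlr.symm])
    (fun s' h => he s' (h₁'.trans (h₂ _ _ h)))
    (fun _ _ _ h => by rwa [nat_setNat_of_ne hlr.symm]) (by simpa [NExpr.eval] using h₁)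
    fun k s' hk hF hl hI => assign ?_
  simp [Mem.setNat, NExpr.eval, hI, hf k hk s' (h₁'.trans (h₂ _ _ hF)) hl, Finset.sum_range_succ]

end RAM

/-! ### The program for an optimal assignment of a selection

The nodes of the students are kept in the array `5` and the prices in the real array `1`. The tree
consists of the marks `R` in the array `6` and the students `par` in the array `7`. The variables
`12`, `13` and the real variable `2` hold the student, the node and the slack of the best edge
found; `14` holds the seminar in which a place is filled, and `8`, `9`, `18` serve the
augmentation. -/

namespace RAM

/-- The loss of the student in the variable `10`, if she moves to the node in the variable `11`. -/
def slackExpr : RExpr :=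
  .sub (.sub (.load 0 (.var 10) (.entry 5 (.var 10))) (.entry 1 (.entry 5 (.var 10))))
    (.sub (.load 0 (.var 10) (.var 11)) (.entry 1 (.var 11)))

/-- Find an edge of smallest slack that leaves the tree. -/
def findEdge : Prog :=
  .seq (.assign 13 (.var 0)) <|
  .forLoop 10 (.var 1) <|
    .ite (.natLe (.const 1) (.entry 6 (.entry 5 (.var 10))))
      (.forLoop 11 (.add (.var 0) (.const 1)) <|
        .ite (.and (.natLe (.entry 6 (.var 11)) (.const 0))
            (.not (.and (.not (.natLe (.var 0) (.var 13))) (.realLe (.var 2) slackExpr))))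
          (.seq (.assignReal 2 slackExpr) <| .seq (.assign 12 (.var 10)) (.assign 13 (.var 11)))
          .skip)
      .skip

/-- Lower the prices of the unreached nodes by the smallest slack. -/
def lowerPrices : Prog :=
  .forLoop 17 (.add (.var 0) (.const 1)) <|
    .ite (.natLe (.entry 6 (.var 17)) (.const 0))
      (.realStore 1 (.var 17) (.const 0) (.sub (.entry 1 (.var 17)) (.var 2)))
      .skip

/-- Grow the tree until it contains the seminar in the variable `14`. -/
def growTree : Prog :=
  .seq (.fill 17 (.add (.var 0) (.const 1)) 6 (.const 0)) <|
  .seq (.natStore 6 (.var 0) (.const 0) (.const 1)) <|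
  .while (.natLe (.entry 6 (.var 14)) (.const 0)) <|
    .seq findEdge <|
    .seq lowerPrices <|
    .seq (.natStore 6 (.var 13) (.const 0) (.const 1)) <|
    .natStore 7 (.var 13) (.const 0) (.var 12)

/-- Move the students along the tree path to the seminar in the variable `14`. -/
def tracePath : Prog :=
  .seq (.assign 8 (.var 14)) <|
  .while (.not (.natLe (.var 0) (.var 8))) <|
    .seq (.assign 9 (.entry 7 (.var 8))) <|
    .seq (.assign 18 (.entry 5 (.var 9))) <|
    .seq (.natStore 5 (.var 9) (.const 0) (.var 8)) <|
    .assign 8 (.var 18)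

theorem findEdge_runs {z m n : ℕ} {s : Mem} (hzm : m + 1 ≤ z) (hzn : n ≤ z)
    (hm : s.nat 0 0 0 = m) (hn : s.nat 1 0 0 = n) (hR : s.nat 6 m 0 ≠ 0) :
    Runs z findEdge s fun s' => SAP.IsMinEdge m
      (fun i v => i < n ∧ s.nat 6 (s.nat 5 i 0) 0 ≠ 0 ∧ v ≤ m ∧ s.nat 6 v 0 = 0)
      (SAP.slack (s.real 0) (fun i => s.nat 5 i 0) (fun v => s.real 1 v 0))
      (s'.nat 12 0 0) (s'.nat 13 0 0) (s'.real 2 0 0) := by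
  refine Runs.assign_seq fun s₁ hF₁ h₁ => ?_
  simp only [NExpr.eval_var, hm] at h₁
  refine Runs.forLoop (fun k s' => SAP.IsMinEdge m
    (fun i v => i < k ∧ s.nat 6 (s.nat 5 i 0) 0 ≠ 0 ∧ v ≤ m ∧ s.nat 6 v 0 = 0)
      (SAP.slack (s.real 0) (fun i => s.nat 5 i 0) (fun v => s.real 1 v 0))
      (s'.nat 12 0 0) (s'.nat 13 0 0) (s'.real 2 0 0)) hzn rfl ?_ (fun _ _ _ h => h) ?_ ?_
  · intro s' hF
    rw [NExpr.eval_var, hF.nat 1 rfl, hF₁.nat 1 rfl, hn]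
  · exact .inl ⟨h₁, by simp⟩
  intro i s₂ hi hF₂ hi₂ hI
  have e0 : s₂.nat 0 = s.nat 0 := (hF₂.nat 0 rfl).trans (hF₁.nat 0 rfl)
  have e5 : s₂.nat 5 = s.nat 5 := (hF₂.nat 5 rfl).trans (hF₁.nat 5 rfl)
  have e6 : s₂.nat 6 = s.nat 6 := (hF₂.nat 6 rfl).trans (hF₁.nat 6 rfl)
  have r0 : s₂.real 0 = s.real 0 := (hF₂.real 0 rfl).trans (hF₁.real 0 rfl)
  have r1 : s₂.real 1 = s.real 1 := (hF₂.real 1 rfl).trans (hF₁.real 1 rfl)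
  refine Runs.ite (fun hb => ?_) fun hb => Runs.skip ?_
  · have hb' : s.nat 6 (s.nat 5 i 0) 0 ≠ 0 := by
      simp only [Test.holds, NExpr.eval, NExpr.eval_entry, NExpr.eval_var, e6, e5, hi₂] at hb
      lia
    refine Runs.conseq (Runs.forLoop (N := m + 1) (fun k s' => SAP.IsMinEdge m
      (fun j v => (j < i ∨ j = i ∧ v < k) ∧ s.nat 6 (s.nat 5 j 0) 0 ≠ 0 ∧ v ≤ m ∧
        s.nat 6 v 0 = 0)
      (SAP.slack (s.real 0) (fun i => s.nat 5 i 0) (fun v => s.real 1 v 0))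
      (s'.nat 12 0 0) (s'.nat 13 0 0) (s'.real 2 0 0)) hzm rfl ?_ (fun _ _ _ h => h) ?_
      ?_) ?_
    · intro s' hF
      rw [NExpr.eval, NExpr.eval_var, hF.nat 0 rfl, e0, hm, NExpr.eval]
    · exact hI.congr fun j u => by simp
    · intro v s₃ hv hF₃ hv₃ hI
      have e0' := (hF₃.nat 0 rfl).trans e0
      have e5' := (hF₃.nat 5 rfl).trans e5
      have e6' := (hF₃.nat 6 rfl).trans e6
      have r0' := (hF₃.real 0 rfl).trans r0
      have r1' := (hF₃.real 1 rfl).trans r1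
      have hi₃ : s₃.nat 10 0 0 = i := by rw [hF₃.nat 10 rfl, hi₂]
      have hsl : slackExpr.eval s₃ = SAP.slack (s.real 0) (fun i => s.nat 5 i 0)
          (fun v => s.real 1 v 0) i v := by
        simp [slackExpr, RExpr.eval, r0', r1', e5', hi₃, hv₃, SAP.slack]
      have htest : ∀ T : Test, (Test.and (.natLe (.entry 6 (.var 11)) (.const 0)) T).holds s₃ ↔
          s.nat 6 v 0 = 0 ∧ T.holds s₃ := by
        simp [Test.holds, NExpr.eval, e6', hv₃]
      refine Runs.ite (fun hb => ?_) fun hb => Runs.skip ?_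
      · rw [htest] at hb
        have hvm : v ≠ m := fun e => hR (e ▸ hb.1)
        have hrep := hI.replace (C' := fun j u => (j < i ∨ j = i ∧ u < v + 1) ∧
          s.nat 6 (s.nat 5 j 0) 0 ≠ 0 ∧ u ≤ m ∧ s.nat 6 u 0 = 0) (i' := i) (v' := v) (by lia)
          (fun j u => by
            constructor
            · rintro ⟨h, h'⟩
              by_cases e : j = i ∧ u = v
              · exact .inr e
              · exact .inl ⟨by lia, h'⟩
            · rintro (⟨h, h'⟩ | ⟨rfl, rfl⟩)
              · exact ⟨by lia, h'⟩
              · exact ⟨by lia, hb', by lia, hb.1⟩)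
          (by simpa [Test.holds, e0', hm, hsl] using hb.2)
        refine Runs.assignReal_seq fun s₄ hF₄ h₄ => Runs.assign_seq fun s₅ hF₅ h₅ =>
          Runs.assign ?_
        have h2 : s₅.real 2 0 0 = SAP.slack (s.real 0) (fun i => s.nat 5 i 0)
          (fun v => s.real 1 v 0) i v := by rw [hF₅.real 2 rfl, h₄, hsl]
        have h12 : s₅.nat 12 0 0 = i := by
          rw [h₅, NExpr.eval_var, hF₄.nat 10 rfl, hi₃]
        have h11 : s₅.nat 11 0 0 = v := by rw [hF₅.nat 11 rfl, hF₄.nat 11 rfl, hv₃]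
        simpa [Mem.setNat, h2, h12, h11] using hrep
      · rw [htest] at hb
        by_cases hRv : s.nat 6 v 0 = 0
        · refine hI.keep (i' := i) (v' := v) (fun j u => ?_) ?_
          · constructor
            · rintro ⟨h, h'⟩
              by_cases e : j = i ∧ u = v
              · exact .inr e
              · exact .inl ⟨by lia, h'⟩
            · rintro (⟨h, h'⟩ | ⟨rfl, rfl⟩)
              · exact ⟨by lia, h'⟩
              · exact ⟨by lia, hb', by lia, hRv⟩
          · simpa [Test.holds, e0', hm, hsl, hRv] using hb
        · refine hI.congr fun j u => ⟨fun ⟨h, h'⟩ => ⟨?_, h'⟩, fun ⟨h, h'⟩ => ⟨by lia, h'⟩⟩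
          have : u ≠ v := fun e => hRv (e ▸ h'.2.2)
          lia
    · intro s' _ h
      exact h.congr fun j u => ⟨fun ⟨h, h'⟩ => ⟨by lia, h'⟩, fun ⟨h, h'⟩ => ⟨by lia, h'⟩⟩
  · refine hI.congr fun j u => ⟨fun ⟨h, h'⟩ => ⟨?_, h'⟩, fun ⟨h, h'⟩ => ⟨by lia, h'⟩⟩
    have : j ≠ i := by
      rintro rfl
      simp only [Test.holds, NExpr.eval, NExpr.eval_entry, NExpr.eval_var, e6, e5, hi₂] at hb
      lia
    lia

theorem lowerPrices_runs {z m : ℕ} {s : Mem} (hzm : m + 1 ≤ z) (hm : s.nat 0 0 0 = m) :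
    Runs z lowerPrices s fun s' => ∀ v ≤ m, s'.real 1 v 0 =
      if s.nat 6 v 0 = 0 then s.real 1 v 0 - s.real 2 0 0 else s.real 1 v 0 := by
  refine Runs.conseq (Runs.forLoop (N := m + 1) (fun k s' => ∀ v, s'.real 1 v 0 =
    if v < k ∧ s.nat 6 v 0 = 0 then s.real 1 v 0 - s.real 2 0 0 else s.real 1 v 0) hzm rfl ?_
    (fun _ _ _ h => h) ?_ ?_) ?_
  · intro s' hF
    rw [NExpr.eval, NExpr.eval_var, hF.nat 0 rfl, hm, NExpr.eval]
  · simp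
  · intro k s' hk hF hk' hI
    have e6 := hF.nat 6 rfl
    have r2 := hF.real 2 rfl
    refine Runs.ite (fun hb => Runs.realStore fun v => ?_) fun hb => Runs.skip fun v => ?_
    · have hb' : s.nat 6 k 0 = 0 := by
        simpa [Test.holds, NExpr.eval, e6, hk'] using hb
      by_cases hv : v = k
      · subst hv
        simp [Mem.setReal, RExpr.eval, hk', NExpr.eval, hI v, r2, hb']
      · have : v < k + 1 ↔ v < k := by lia
        simpa [Mem.setReal, hk', hv, this] using hI v
    · have hb' : s.nat 6 k 0 ≠ 0 := by
        simpa [Test.holds, NExpr.eval, e6, hk'] using hb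
      rw [hI v]
      congr 1
      refine propext ⟨fun h => ⟨by lia, h.2⟩, fun h => ⟨?_, h.2⟩⟩
      have : v ≠ k := fun e => hb' (e ▸ h.2)
      lia
  · intro s' _ h v hv
    simp [h v, Nat.lt_succ_of_le hv]

end RAM

namespace RAM

theorem growTree_runs {z m n : ℕ} {s : Mem} (hzm : m + 1 ≤ z) (hzn : n ≤ z)
    (hm : s.nat 0 0 0 = m) (hn : s.nat 1 0 0 = n)
    (hA : SAP.NodeSupports m n (s.real 0) (fun i => s.nat 5 i 0) (fun v => s.real 1 v 0))
    (hq : s.real 1 m 0 = 0) (hfree : ∃ i < n, s.nat 5 i 0 = m) (ht : s.nat 14 0 0 < m) :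
    Runs z growTree s fun s' => s'.nat 6 (s.nat 14 0 0) 0 ≠ 0 ∧
      ∃ ρ, SAP.Tree m n (s.real 0) (fun i => s.nat 5 i 0) (fun v => s'.real 1 v 0)
        (fun v => s'.nat 6 v 0) (fun v => s'.nat 7 v 0) ρ := by
  refine Runs.seq (Runs.fill (N := m + 1) (fun _ => 0) hzm (by decide)
    (fun s' h => by rw [NExpr.eval, NExpr.eval_var, h.nat 0 rfl, hm, NExpr.eval])
    fun _ _ _ _ _ => rfl) fun s₁ hF₁ h₁ => ?_
  refine Runs.store_seq fun s₂ hF₂ h₂ => ?_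
  have e5 : s₂.nat 5 = s.nat 5 := (hF₂.nat 5 rfl).trans (hF₁.nat 5 rfl)
  have r0 : s₂.real 0 = s.real 0 := (hF₂.real 0 rfl).trans (hF₁.real 0 rfl)
  have r1 : s₂.real 1 = s.real 1 := (hF₂.real 1 rfl).trans (hF₁.real 1 rfl)
  have e0 : s₂.nat 0 = s.nat 0 := (hF₂.nat 0 rfl).trans (hF₁.nat 0 rfl)
  have e1 : s₂.nat 1 = s.nat 1 := (hF₂.nat 1 rfl).trans (hF₁.nat 1 rfl)
  have e14 : s₂.nat 14 = s.nat 14 := (hF₂.nat 14 rfl).trans (hF₁.nat 14 rfl)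
  have hR₂ : (fun v => s₂.nat 6 v 0) = Function.update (fun v => s₁.nat 6 v 0) m 1 := by
    funext v
    rw [h₂, NExpr.eval_var, hF₁.nat 0 rfl, hm, NExpr.eval]
  have hun : SAP.unreached m (fun v => s₂.nat 6 v 0) = m := by
    have h := SAP.unreached_update (R := fun v => s₁.nat 6 v 0) le_rfl (h₁ m (by lia))
    have h' : SAP.unreached m (fun v => s₁.nat 6 v 0) = m + 1 := by
      rw [SAP.unreached, Finset.filter_true_of_mem, Finset.card_range]
      exact fun v hv => h₁ v (Finset.mem_range.1 hv)
    rw [hR₂]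
    lia
  have hne : ∀ v ≤ m, s₂.nat 6 v 0 ≠ 0 → v = m := by
    intro v hv hR
    by_contra e
    rw [congrFun hR₂ v, Function.update_of_ne e] at hR
    exact hR (h₁ v (by lia))
  refine Runs.conseq (Runs.whileLoop (k₀ := m) (fun k s' =>
    SAP.unreached m (fun v => s'.nat 6 v 0) = k ∧
    ∃ ρ, SAP.Tree m n (s.real 0) (fun i => s.nat 5 i 0) (fun v => s'.real 1 v 0)
        (fun v => s'.nat 6 v 0) (fun v => s'.nat 7 v 0) ρ) ⟨hun, fun _ => 0, ?_⟩ (by lia) ?_) ?_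
  · refine ⟨by simpa only [r1] using hA, by simpa only [r1] using hq, ?_, ?_, ?_, ?_, ?_, ?_⟩
    · rw [congrFun hR₂ m]
      simp
    all_goals intro v hv hR; have := hne v (by lia) hR
    any_goals lia
  · rintro k s₃ hF₃ ⟨hk, ρ, hT⟩ hb
    have e0' : s₃.nat 0 0 0 = m := by rw [hF₃.nat 0 rfl, e0, hm]
    have e1' : s₃.nat 1 0 0 = n := by rw [hF₃.nat 1 rfl, e1, hn]
    have e5' : s₃.nat 5 = s.nat 5 := (hF₃.nat 5 rfl).trans e5
    have e14' : s₃.nat 14 = s.nat 14 := (hF₃.nat 14 rfl).trans e14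
    have r0' : s₃.real 0 = s.real 0 := (hF₃.real 0 rfl).trans r0
    have hb' : s₃.nat 6 (s.nat 14 0 0) 0 = 0 := by
      simpa [Test.holds, NExpr.eval, e14'] using hb
    refine Runs.seq (findEdge_runs hzm hzn e0' e1' hT.root) fun s₄ hF₄ h₄ => ?_
    rw [r0', e5'] at h₄
    rcases h₄ with ⟨-, h₄⟩ | ⟨hv, ⟨hi, hRi, -, hRv⟩, hδ, hmin⟩
    · -- an unassigned student always gives an edge from the root to the target seminar
      obtain ⟨i, hi, hiA⟩ := hfree
      exact absurd ⟨hi, by rw [hiA]; exact hT.root, ht.le, hb'⟩ (h₄ i (s.nat 14 0 0))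
    refine Runs.seq (lowerPrices_runs hzm (by rw [hF₄.nat 0 rfl, e0'])) fun s₅ hF₅ h₅ => ?_
    rw [hF₄.nat 6 rfl, hF₄.real 1 rfl] at h₅
    refine Runs.store_seq fun s₆ hF₆ h₆ => Runs.natStore ?_
    obtain ⟨ρ', hT'⟩ := hT.grow hi hRi hv.le hRv hδ (fun j u a b c d => hmin j u ⟨a, b, c, d⟩) h₅
    have hR : (fun v => s₆.nat 6 v 0) =
        Function.update (fun v => s₃.nat 6 v 0) (s₄.nat 13 0 0) 1 := by
      funext v
      rw [h₆, NExpr.eval_var, hF₅.nat 13 rfl, hF₅.nat 6 rfl, hF₄.nat 6 rfl, NExpr.eval]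
    have hpar : (fun v => (s₆.setNat 7 ((NExpr.var 13).eval s₆) ((NExpr.const 0).eval s₆)
        ((NExpr.var 12).eval s₆)).nat 7 v 0) =
        Function.update (fun v => s₃.nat 7 v 0) (s₄.nat 13 0 0) (s₄.nat 12 0 0) := by
      funext v
      have a7 : s₆.nat 7 = s₃.nat 7 := by rw [hF₆.nat 7 rfl, hF₅.nat 7 rfl, hF₄.nat 7 rfl]
      have a12 : s₆.nat 12 = s₄.nat 12 := by rw [hF₆.nat 12 rfl, hF₅.nat 12 rfl]
      have a13 : s₆.nat 13 = s₄.nat 13 := by rw [hF₆.nat 13 rfl, hF₅.nat 13 rfl]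
      simp [Mem.setNat, NExpr.eval, a7, a12, a13, Function.update_apply]
    have hq' : (fun v => s₆.real 1 v 0) = fun v => s₅.real 1 v 0 := by rw [hF₆.real 1 rfl]
    have hdec := SAP.unreached_update (R := fun v => s₃.nat 6 v 0) hv.le hRv
    refine ⟨SAP.unreached m (fun v => s₆.nat 6 v 0), by rw [hR]; lia, rfl, ρ', ?_⟩
    rw [← hR, ← hpar, ← hq'] at hT'
    exact hT'
  · rintro s' hF ⟨⟨k, -, hT⟩, hb⟩
    refine ⟨?_, hT⟩
    have e14' := (hF.nat 14 rfl).trans e14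
    simp only [Test.holds, NExpr.eval, NExpr.eval_entry, NExpr.eval_var, e14'] at hb
    lia

theorem tracePath_runs {z m n : ℕ} {s : Mem} {ρ : ℕ → ℕ} (hzm : m + 1 ≤ z)
    (hm : s.nat 0 0 0 = m) (ht : s.nat 14 0 0 < m) (hR : s.nat 6 (s.nat 14 0 0) 0 ≠ 0)
    (hT : SAP.Tree m n (s.real 0) (fun i => s.nat 5 i 0) (fun v => s.real 1 v 0)
        (fun v => s.nat 6 v 0) (fun v => s.nat 7 v 0) ρ) :
    Runs z tracePath s fun s' =>
      SAP.NodeSupports m n (s.real 0) (fun i => s'.nat 5 i 0) (fun v => s.real 1 v 0) ∧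
      ∀ v, SAP.load n (fun i => s'.nat 5 i 0) v + (if v = m then 1 else 0) =
        SAP.load n (fun i => s.nat 5 i 0) v + if v = s.nat 14 0 0 then 1 else 0 := by
  refine Runs.assign_seq fun s₁ hF₁ h₁ => ?_
  rw [NExpr.eval_var] at h₁
  refine Runs.conseq (Runs.whileLoop (k₀ := ρ (s.nat 14 0 0)) (fun k s' =>
    ρ (s'.nat 8 0 0) = k ∧ SAP.Trace m n (s.real 0) (fun i => s'.nat 5 i 0)
      (fun v => s.real 1 v 0) (fun v => s.nat 7 v 0) ρ (fun v => s.nat 6 v 0) (s'.nat 8 0 0) ∧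
      ∀ v, SAP.load n (fun i => s'.nat 5 i 0) v + (if v = s'.nat 8 0 0 then 1 else 0) =
        SAP.load n (fun i => s.nat 5 i 0) v + if v = s.nat 14 0 0 then 1 else 0)
    ⟨by rw [h₁], ?_, ?_⟩ ?_ ?_) ?_
  · rw [h₁, hF₁.nat 5 rfl]
    exact hT.trace ht.le hR
  · intro v
    rw [h₁, hF₁.nat 5 rfl]
  · have := hT.rank_le _ ht.le hR
    lia
  · rintro k s₂ hF₂ ⟨hk, hI, hload⟩ hb
    have e0 : s₂.nat 0 0 0 = m := by rw [hF₂.nat 0 rfl, hF₁.nat 0 rfl, hm]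
    have e7 : s₂.nat 7 = s.nat 7 := (hF₂.nat 7 rfl).trans (hF₁.nat 7 rfl)
    have hlt : s₂.nat 8 0 0 < m := by simpa [Test.holds, e0] using hb
    refine Runs.assign_seq fun s₃ hF₃ h₃ => Runs.assign_seq fun s₄ hF₄ h₄ =>
      Runs.store_seq fun s₅ hF₅ h₅ => Runs.assign ?_
    simp only [NExpr.eval_entry, NExpr.eval_var, e7] at h₃
    simp only [NExpr.eval_entry, NExpr.eval_var, hF₃.nat 5 rfl, h₃] at h₄
    have hA : (fun i => s₅.nat 5 i 0) = Function.update (fun i => s₂.nat 5 i 0)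
        (s.nat 7 (s₂.nat 8 0 0) 0) (s₂.nat 8 0 0) := by
      funext i
      rw [h₅, NExpr.eval_var, NExpr.eval_var, hF₄.nat 9 rfl, h₃, hF₄.nat 8 rfl, hF₃.nat 8 rfl,
        hF₄.nat 5 rfl, hF₃.nat 5 rfl]
    have h8 : (s₅.setNat 8 0 0 ((NExpr.var 18).eval s₅)).nat 8 0 0 =
        s₂.nat 5 (s.nat 7 (s₂.nat 8 0 0) 0) 0 := by
      simp [Mem.setNat, hF₅.nat 18 rfl, h₄]
    have h5 : (fun i => (s₅.setNat 8 0 0 ((NExpr.var 18).eval s₅)).nat 5 i 0) =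
      fun i => s₅.nat 5 i 0 := rfl
    refine ⟨ρ (s₂.nat 5 (s.nat 7 (s₂.nat 8 0 0) 0) 0), ?_, by rw [h8], ?_, fun v => ?_⟩
    · rw [← hk]
      exact hI.rank_lt _ hlt hI.reached le_rfl
    · rw [h8, h5, hA]
      exact hI.step hlt
    · rw [h8, h5, hA, SAP.load_update _ (hI.par_lt _ hlt hI.reached le_rfl)]
      exact hload v
  · rintro s' hF ⟨⟨k, -, hI, hload⟩, hb⟩
    have e0 : s'.nat 0 0 0 = m := by rw [hF.nat 0 rfl, hF₁.nat 0 rfl, hm]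
    have h8 : s'.nat 8 0 0 = m :=
      le_antisymm hI.cur_le (by simpa [Test.holds, e0] using hb)
    rw [h8] at hload
    exact ⟨hI.supports, hload⟩

/-- Initialise with all students unassigned. The price of a seminar is the sum of all its profits,
so that no student gains by moving there; that of the node `m` is a sum of zeros. -/
def initPlacement : Prog :=
  .seq (.fill 17 (.var 1) 5 (.var 0)) <|
  .forLoop 17 (.add (.var 0) (.const 1)) <|
    .seq (.sumReal 10 (.var 1) 4 (.load 0 (.var 10) (.var 17))) <|
    .realStore 1 (.var 17) (.const 0) (.var 4)

/-- Compute, for the selection in the array `15`, an optimal assignment in the array `5` and its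
profit in the real variable `3`: the places are filled one by one. -/
def optimize : Prog :=
  .seq initPlacement <|
  .seq (.forLoop 14 (.var 0) <| .forLoop 16 (.entry 15 (.var 14)) <| .seq growTree tracePath) <|
  .sumReal 10 (.var 1) 3 (.load 0 (.var 10) (.entry 5 (.var 10)))

theorem initPlacement_runs {z m n : ℕ} {s : Mem} (hzm : m + 1 ≤ z) (hzn : n ≤ z)
    (hm : s.nat 0 0 0 = m) (hn : s.nat 1 0 0 = n)
    (hw : ∀ i < n, ∀ v ≤ m, 0 ≤ s.real 0 i v) (hw0 : ∀ i < n, s.real 0 i m = 0) :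
    Runs z initPlacement s fun s' =>
      SAP.NodeSupports m n (s.real 0) (fun i => s'.nat 5 i 0) (fun v => s'.real 1 v 0) ∧
      s'.real 1 m 0 = 0 ∧ (∀ v ≤ m, 0 ≤ s'.real 1 v 0) ∧ ∀ i < n, s'.nat 5 i 0 = m := by
  refine Runs.seq (Runs.fill (N := n) (fun _ => m) hzn (by decide)
    (fun s' h => by rw [NExpr.eval_var, h.nat 1 rfl, hn])
    fun k _ s' h _ => by rw [NExpr.eval_var, h.nat 0 rfl, hm]) fun s₁ hF₁ h₁ => ?_
  refine Runs.conseq (Runs.forLoop (N := m + 1) (fun k s' => ∀ v < k, s'.real 1 v 0 =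
    ∑ i ∈ Finset.range n, s.real 0 i v) hzm rfl ?_ (fun _ _ _ h => h) (by simp) ?_) ?_
  · intro s' hF
    rw [NExpr.eval, NExpr.eval_var, hF.nat 0 rfl, hF₁.nat 0 rfl, hm, NExpr.eval]
  · intro k s₂ hk hF₂ hk₂ hI
    refine Runs.seq (Runs.sumReal (N := n) (fun i => s.real 0 i k) hzn
      (fun s' h => by rw [NExpr.eval_var, h.nat 1 rfl, hF₂.nat 1 rfl, hF₁.nat 1 rfl, hn])
      fun i _ s' h hi => ?_) fun s₃ hF₃ h₃ => Runs.realStore fun v hv => ?_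
    · rw [RExpr.eval, NExpr.eval_var, NExpr.eval_var, hi, h.nat 17 rfl, hk₂, h.real 0 rfl,
        hF₂.real 0 rfl, hF₁.real 0 rfl]
    · have e17 : s₃.nat 17 0 0 = k := by rw [hF₃.nat 17 rfl, hk₂]
      by_cases e : v = k
      · subst e
        simp [Mem.setReal, NExpr.eval, e17, h₃]
      · simpa [Mem.setReal, NExpr.eval, e17, e, hF₃.real 1 rfl] using hI v (by lia)
  · intro s' hF hq
    have h5 : ∀ i < n, s'.nat 5 i 0 = m := by rw [hF.nat 5 rfl]; exact h₁
    have hqm : s'.real 1 m 0 = 0 := by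
      rw [hq m (by lia)]
      exact Finset.sum_eq_zero fun i hi => hw0 i (Finset.mem_range.1 hi)
    refine ⟨⟨fun i hi => (h5 i hi).le, fun i hi v hv => ?_⟩, hqm, fun v hv => ?_, h5⟩
    · rw [SAP.slack, h5 i hi, hw0 i hi, hqm, hq v (by lia)]
      have := Finset.single_le_sum (f := fun i => s.real 0 i v)
        (fun j hj => hw j (Finset.mem_range.1 hj) v hv) (Finset.mem_range.2 hi)
      linarith
    · rw [hq v (by lia)]
      exact Finset.sum_nonneg fun j hj => hw j (Finset.mem_range.1 hj) v hv

end RAM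

namespace RAM

/-- The loop invariant of `optimize`: the placement in the array `5` is supported by the
non-negative prices in the real array `1`, and puts `c v` students at the seminar `v`. -/
structure Placed (m n : ℕ) (w : ℕ → ℕ → ℝ) (c : ℕ → ℕ) (s : Mem) : Prop where
  supports : SAP.NodeSupports m n w (fun i => s.nat 5 i 0) (fun v => s.real 1 v 0)
  price_root : s.real 1 m 0 = 0
  price_nonneg : ∀ v ≤ m, 0 ≤ s.real 1 v 0
  load_eq : ∀ v < m, SAP.load n (fun i => s.nat 5 i 0) v = c v

theorem augment_runs {z m n : ℕ} {s : Mem} {c : ℕ → ℕ} (hzm : m + 1 ≤ z) (hzn : n ≤ z)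
    (hm : s.nat 0 0 0 = m) (hn : s.nat 1 0 0 = n)
    (hw : ∀ i < n, ∀ v ≤ m, 0 ≤ s.real 0 i v) (hw0 : ∀ i < n, s.real 0 i m = 0)
    (ht : s.nat 14 0 0 < m) (h : Placed m n (s.real 0) c s)
    (hc : ∑ v ∈ Finset.range m, c v < n) :
    Runs z (.seq growTree tracePath) s
      (Placed m n (s.real 0) (fun v => c v + if v = s.nat 14 0 0 then 1 else 0)) := by
  obtain ⟨i₀, hi₀, hA₀⟩ : ∃ i < n, s.nat 5 i 0 = m := by
    by_contra! hne
    have := SAP.sum_load (m := m) (n := n) (A := fun i => s.nat 5 i 0)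
      fun i hi => lt_of_le_of_ne (h.supports.le i hi) (hne i hi)
    rw [Finset.sum_congr rfl fun v hv => h.load_eq v (Finset.mem_range.1 hv)] at this
    lia
  refine Runs.seq (growTree_runs hzm hzn hm hn h.supports h.price_root ⟨i₀, hi₀, hA₀⟩ ht)
    fun s₁ hF₁ ⟨hR, ρ, hT⟩ => ?_
  have e14 := hF₁.nat 14 rfl
  have e5 := hF₁.nat 5 rfl
  have r0 := hF₁.real 0 rfl
  refine Runs.conseq (tracePath_runs (ρ := ρ) (n := n) hzm (by rw [hF₁.nat 0 rfl, hm])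
    (by rwa [e14]) (by rwa [e14]) (by rwa [e5, r0])) fun s₂ hF₂ ⟨hsupp, hload⟩ => ?_
  have r1 := hF₂.real 1 rfl
  rw [r0] at hsupp
  refine ⟨by rwa [r1], by rw [r1]; exact hT.price_root, fun v hv => ?_, fun v hv => ?_⟩
  · -- the student `i₀` was content to stay unassigned, so no profit of hers exceeds the price
    have := hT.supports.slack_nonneg i₀ hi₀ v hv
    simp only [SAP.slack, hA₀, hw0 i₀ hi₀, hT.price_root] at this
    have := hw i₀ hi₀ v hv
    rw [r1]
    linarith
  · have := hload v
    rw [if_neg hv.ne, e5, e14, h.load_eq v hv] at this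
    exact this

theorem optimize_runs {z m n : ℕ} {s : Mem} (hzm : m + 1 ≤ z) (hzn : n ≤ z)
    (hm : s.nat 0 0 0 = m) (hn : s.nat 1 0 0 = n)
    (hw : ∀ i < n, ∀ v ≤ m, 0 ≤ s.real 0 i v) (hw0 : ∀ i < n, s.real 0 i m = 0)
    (hc : ∑ v ∈ Finset.range m, s.nat 15 v 0 ≤ n) :
    Runs z optimize s fun s' => Placed m n (s.real 0) (fun v => s.nat 15 v 0) s' ∧
      s'.real 3 0 0 = ∑ i ∈ Finset.range n, s.real 0 i (s'.nat 5 i 0) := by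
  refine Runs.seq (initPlacement_runs hzm hzn hm hn hw hw0)
    fun s₁ hF₁ ⟨hsupp, hq0, hq, hA⟩ => ?_
  have hle : ∀ b < m, s.nat 15 b 0 ≤ n := fun b hb =>
    (Finset.single_le_sum (f := fun v => s.nat 15 v 0) (fun _ _ => Nat.zero_le _)
      (Finset.mem_range.2 hb)).trans hc
  refine Runs.seq (Q := Placed m n (s.real 0) (fun v => s.nat 15 v 0)) ?_ fun s₂ hF₂ h₂ => ?_
  · refine Runs.conseq (Runs.forLoop (N := m) (fun b =>
      Placed m n (s.real 0) (fun v => if v < b then s.nat 15 v 0 else 0)) (by lia) rfl ?_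
      (fun _ _ _ h => ⟨h.1, h.2, h.3, h.4⟩) ⟨hsupp, hq0, hq, fun v hv => ?_⟩ ?_) ?_
    · intro s' hF
      rw [NExpr.eval_var, hF.nat 0 rfl, hF₁.nat 0 rfl, hm]
    · rw [if_neg (by lia), SAP.load, Finset.card_eq_zero, Finset.filter_eq_empty_iff]
      intro i hi
      rw [hA i (Finset.mem_range.1 hi)]
      exact hv.ne'
    · intro b s' hb hF hb' hI
      have e15 : s'.nat 15 = s.nat 15 := (hF.nat 15 rfl).trans (hF₁.nat 15 rfl)
      have e0 : s'.nat 0 = s.nat 0 := (hF.nat 0 rfl).trans (hF₁.nat 0 rfl)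
      have e1 : s'.nat 1 = s.nat 1 := (hF.nat 1 rfl).trans (hF₁.nat 1 rfl)
      have r0 : s'.real 0 = s.real 0 := (hF.real 0 rfl).trans (hF₁.real 0 rfl)
      refine Runs.conseq (Runs.forLoop (N := s.nat 15 b 0) (fun k => Placed m n (s.real 0)
        (fun v => if v < b then s.nat 15 v 0 else if v = b then k else 0))
        ((hle b hb).trans hzn) rfl ?_ (fun _ _ _ h => ⟨h.1, h.2, h.3, h.4⟩) ?_ ?_) ?_
      · intro s'' hF'
        rw [NExpr.eval_entry, NExpr.eval_var, hF'.nat 15 rfl, e15, hF'.nat 14 rfl, hb']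
      · refine ⟨hI.1, hI.2, hI.3, fun v hv => ?_⟩
        rw [hI.4 v hv]
        simp
      · intro k s'' hk hF' hk' hI'
        have e14 : s''.nat 14 0 0 = b := by rw [hF'.nat 14 rfl, hb']
        have r0' : s''.real 0 = s.real 0 := (hF'.real 0 rfl).trans r0
        rw [← r0'] at hI'
        refine Runs.conseq (augment_runs hzm hzn (by rw [hF'.nat 0 rfl, e0, hm])
          (by rw [hF'.nat 1 rfl, e1, hn]) (by rwa [r0']) (by rwa [r0']) (by rwa [e14]) hI' ?_) ?_
        · refine lt_of_lt_of_le (Finset.sum_lt_sum (fun v _ => ?_)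
            ⟨b, Finset.mem_range.2 hb, ?_⟩) hc
          · split_ifs with h₁ h₂
            · exact le_rfl
            · rw [h₂]; exact hk.le
            · exact Nat.zero_le _
          · simpa using hk
        · rintro s₃ - h₃
          rw [r0', e14] at h₃
          refine ⟨h₃.1, h₃.2, h₃.3, fun v hv => ?_⟩
          rw [h₃.4 v hv]
          split_ifs <;> lia
      · rintro s₃ - h₃
        refine ⟨h₃.1, h₃.2, h₃.3, fun v hv => ?_⟩
        rw [h₃.4 v hv]
        by_cases e : v = b
        · simp [e]
        · have : v < b + 1 ↔ v < b := by lia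
          simp [e, this]
    · rintro s' - h
      refine ⟨h.1, h.2, h.3, fun v hv => ?_⟩
      rw [h.4 v hv, if_pos hv]
  · refine Runs.conseq (Runs.sumReal (N := n) (fun i => s.real 0 i (s₂.nat 5 i 0)) hzn
      (fun s' h => by rw [NExpr.eval_var, h.nat 1 rfl, hF₂.nat 1 rfl, hF₁.nat 1 rfl, hn])
      fun i _ s' h hi => ?_) fun s' hF h => ?_
    · rw [RExpr.eval, NExpr.eval_entry, NExpr.eval_var, hi, h.nat 5 rfl, h.real 0 rfl,
        hF₂.real 0 rfl, hF₁.real 0 rfl]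
    · have e5 := hF.nat 5 rfl
      have r1 := hF.real 1 rfl
      exact ⟨⟨by rw [e5, r1]; exact h₂.1, by rw [r1]; exact h₂.2, by rw [r1]; exact h₂.3,
        by rw [e5]; exact h₂.4⟩, by rw [e5, h]⟩

end RAM

/-! ### The input in the memory, and strong duality -/

namespace SAP

variable {m n : ℕ} (x : SAP m n)

/-- The memory contains the input `x`. -/
structure Input (s : RAM.Mem) : Prop where
  nat : ∀ a < 4, s.nat a = x.initMem.nat a
  real : s.real 0 = x.initMem.real 0

theorem Input.seminars {x : SAP m n} {s : RAM.Mem} (h : x.Input s) : s.nat 0 0 0 = m := by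
  rw [h.nat 0 (by lia)]
  simp [initMem]

theorem Input.students {x : SAP m n} {s : RAM.Mem} (h : x.Input s) : s.nat 1 0 0 = n := by
  rw [h.nat 1 (by lia)]
  simp [initMem]

theorem Input.card {x : SAP m n} {s : RAM.Mem} (h : x.Input s) (b : Fin m) :
    s.nat 2 b 0 = (x.K b).card := by
  rw [h.nat 2 (by lia)]
  simp [initMem]

theorem Input.entry_mem {x : SAP m n} {s : RAM.Mem} (h : x.Input s) (b : Fin m) {j : ℕ}
    (hj : j < (x.K b).card) : s.nat 3 b j ∈ x.K b := by
  rw [h.nat 3 (by lia)]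
  have hj' : j < ((x.K b).sort (· ≤ ·)).length := by rwa [Finset.length_sort]
  simp only [initMem, Fin.is_lt, Fin.eta]
  simp [List.getD_eq_getElem?_getD, List.getElem?_eq_getElem hj',
    ← Finset.mem_sort (α := ℕ) (· ≤ ·)]

theorem Input.exists_entry {x : SAP m n} {s : RAM.Mem} (h : x.Input s) (b : Fin m) {k : ℕ}
    (hk : k ∈ x.K b) : ∃ j < (x.K b).card, s.nat 3 b j = k := by
  rw [← Finset.mem_sort (· ≤ ·)] at hk
  obtain ⟨j, hj, e⟩ := List.getElem_of_mem hk
  refine ⟨j, by rwa [Finset.length_sort] at hj, ?_⟩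
  rw [h.nat 3 (by lia)]
  simp only [initMem, Fin.is_lt, Fin.eta]
  simp [List.getD_eq_getElem?_getD, List.getElem?_eq_getElem hj, e]

theorem Input.profit_none {x : SAP m n} {s : RAM.Mem} (h : x.Input s) (i : ℕ) :
    s.real 0 i m = 0 := by
  rw [h.real]
  simp [initMem]

theorem Input.profit_some {x : SAP m n} {s : RAM.Mem} (h : x.Input s) (i : Fin n) (b : Fin m) :
    s.real 0 i b = x.p i b := by
  rw [h.real]
  simp [initMem]

theorem Input.profit_nonneg {x : SAP m n} {s : RAM.Mem} (h : x.Input s) (i v : ℕ) :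
    0 ≤ s.real 0 i v := by
  rw [h.real]
  simp only [initMem, if_true]
  split_ifs
  exacts [x.p_nonneg _ _, le_rfl]

theorem Input.frame {x : SAP m n} {s s' : RAM.Mem} (h : x.Input s) {P : RAM.Prog}
    (hF : RAM.Frame P s s') (hn : (P.writesNat 0 || P.writesNat 1 || P.writesNat 2 ||
      P.writesNat 3 || P.writesReal 0) = false) : x.Input s' := by
  simp only [Bool.or_eq_false_iff] at hn
  refine ⟨fun a ha => ?_, (hF.real 0 hn.2).trans h.real⟩
  rw [← h.nat a ha]
  refine hF.nat a ?_
  interval_cases a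
  exacts [hn.1.1.1.1, hn.1.1.1.2, hn.1.1.2, hn.1.2]

/-- The number of the node at which an assignment places a student. -/
def node (o : Option (Fin m)) : ℕ := o.elim m fun b => b

/-- The array `a` of the memory contains the assignment `A`; the entry `m` marks the unassigned
students. -/
def StoredIn (A : Assignment m n) (a : ℕ) (s : RAM.Mem) : Prop :=
  ∀ i : Fin n, s.nat a i 0 = node (A i)

theorem exists_storedIn {a : ℕ} {s : RAM.Mem} (h : ∀ i < n, s.nat a i 0 ≤ m) :
    ∃ A : Assignment m n, StoredIn A a s := by
  refine ⟨fun i => if h : s.nat a i 0 < m then some ⟨_, h⟩ else none, fun i => ?_⟩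
  by_cases hi : s.nat a i 0 < m
  · simp [hi, node]
  · have := h i i.2
    simp only [hi, node, dif_neg, not_false_eq_true, Option.elim]
    lia

theorem StoredIn.count_eq {A : Assignment m n} {a : ℕ} {s : RAM.Mem} (h : StoredIn A a s)
    (b : Fin m) : A.count b = load n (fun i => s.nat a i 0) b := by
  rw [Assignment.count, load, Finset.card_filter, Finset.card_filter, Finset.sum_range]
  refine Finset.sum_congr rfl fun i _ => ?_
  rw [h i]
  cases A i with
  | none => simp [node, b.2.ne']
  | some c => by_cases e : c = b <;> simp [node, e, Fin.val_inj]

theorem node_le (o : Option (Fin m)) : node o ≤ m := by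
  cases o with
  | none => exact le_rfl
  | some b => exact b.2.le

theorem Input.sub_price_node {x : SAP m n} {s : RAM.Mem} (h : x.Input s) {q : ℕ → ℝ}
    (hq : q m = 0) (i : Fin n) (o : Option (Fin m)) :
    s.real 0 i (node o) - q (node o) = x.gain (fun b => q b) i o := by
  cases o with
  | none => simp [node, gain, h.profit_none, hq]
  | some b => simp [node, gain, h.profit_some]

theorem Input.sum_eq_profit {x : SAP m n} {s s' : RAM.Mem} (h : x.Input s) {a : ℕ}
    {A : Assignment m n} (hA : StoredIn A a s') :
    ∑ i ∈ Finset.range n, s.real 0 i (s'.nat a i 0) = x.profit A := by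
  rw [Finset.sum_range, profit]
  refine Finset.sum_congr rfl fun i _ => ?_
  rw [hA i]
  cases A i with
  | none => simp [node, h.profit_none]
  | some b => simp [node, h.profit_some]

/-- The array `a` of the memory contains the selection `S`. -/
def SelectedIn (S : Selection m) (a : ℕ) (s : RAM.Mem) : Prop := ∀ b : Fin m, s.nat a b 0 = S b

theorem SelectedIn.sum_eq {S : Selection m} {a : ℕ} {s : RAM.Mem} (h : SelectedIn S a s) :
    ∑ v ∈ Finset.range m, s.nat a v 0 = S.cost := by
  rw [Finset.sum_range, Selection.cost]
  exact Finset.sum_congr rfl fun b _ => h b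

/-- The program `optimize` finds an optimal assignment together with supporting prices. -/
theorem optimize_supports {z : ℕ} {x : SAP m n} {s : RAM.Mem} (hz : x.size < z) (h : x.Input s)
    {S : Selection m} (hS : SelectedIn S 15 s) (hc : S.cost ≤ n) :
    RAM.Runs z RAM.optimize s fun s' => ∃ (A : Assignment m n) (q : Fin m → ℝ), 0 ≤ q ∧
      x.Supports q A ∧ Corresponds S A ∧ StoredIn A 5 s' ∧ s'.real 3 0 0 = x.profit A := by
  rw [size] at hz
  refine (RAM.optimize_runs (z := z) (n := n) (by lia) (by lia) h.seminars h.students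
    (fun i _ v _ => h.profit_nonneg i v) (fun i _ => h.profit_none i)
    (hS.sum_eq.trans_le hc)).conseq fun s' _ ⟨hP, hprof⟩ => ?_
  obtain ⟨A, hA⟩ := exists_storedIn (a := 5) hP.supports.le
  refine ⟨A, fun b => s'.real 1 b 0, fun b => hP.price_nonneg b b.2.le, fun i o => ?_,
    fun b => ?_, hA, hprof.trans (h.sum_eq_profit hA)⟩
  · have := hP.supports.slack_nonneg i i.2 (node o) (node_le o)
    simp only [slack] at this
    rw [hA i] at this
    rw [← h.sub_price_node (q := fun v => s'.real 1 v 0) hP.price_root,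
      ← h.sub_price_node (q := fun v => s'.real 1 v 0) hP.price_root]
    linarith
  · rw [hA.count_eq, hP.load_eq b b.2, hS b]

theorem optimize_isOptimalFor {z : ℕ} {x : SAP m n} {s : RAM.Mem} (hz : x.size < z)
    (h : x.Input s) {S : Selection m} (hS : SelectedIn S 15 s) (hc : S.cost ≤ n) :
    RAM.Runs z RAM.optimize s fun s' => ∃ A : Assignment m n, x.IsOptimalFor S A ∧
      StoredIn A 5 s' ∧ s'.real 3 0 0 = x.profit A :=
  (optimize_supports hz h hS hc).conseq fun _ _ ⟨A, _, _, hq, hA, h'⟩ =>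
    ⟨A, hq.isOptimalFor x hA, h'⟩

/-- Strong duality. The assignment and the prices are those that the program `optimize` computes. -/
theorem dualValue_eq_selProfit {S : Selection m} (hS : S.cost ≤ n) :
    x.selProfit S = x.dualValue S := by
  let s : RAM.Mem := ⟨fun a i j => if a = 15 then (if h : i < m then S ⟨i, h⟩ else 0) else
    x.initMem.nat a i j, x.initMem.real⟩
  have hs : x.Input s := ⟨fun a ha => by
    funext i j
    exact if_neg (by lia), rfl⟩
  obtain ⟨t, s', -, -, A, q, hq, hsupp, hA, -⟩ :=
    optimize_supports (Nat.lt_succ_self _) hs (S := S) (fun b => by simp [s]) hS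
  rw [(hsupp.isOptimalFor x hA).selProfit_eq x, x.dualValue_eq_profit hq hsupp hA]

/-- The guarantee of the enumerated greedy algorithm, however ties are broken. -/
theorem EnumGreedyOutput.isApprox {A : Assignment m n} (h : x.EnumGreedyOutput A) :
    x.IsApprox (1 - Real.exp (-1)) A := by
  obtain ⟨F, hF, S₀, hS₀, rfl, hbest⟩ := h
  refine ⟨?_, fun A' hA' => ?_⟩
  · obtain ⟨S, A₁, A₂, hreach, -, hA₁, hA₂, ⟨h, -⟩ | ⟨h, -⟩⟩ := hF S₀ hS₀ <;> rw [h]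
    · intro b
      rw [hA₁.1 b]
      exact (FeasibleSel.of_reflTransGen x hS₀.1 hreach).1 b
    · exact hA₂.1.1
  · let T : Selection m := A'.count
    have hcost : T.cost ≤ n := by
      simp_rw [T, Selection.cost, Assignment.count, Finset.card_filter]
      rw [Finset.sum_comm]
      refine (Finset.sum_le_card_nsmul _ _ 1 fun i _ => ?_).trans (by simp)
      cases A' i <;> simp
    have hT : x.FeasibleSel T := ⟨hA', hcost⟩
    obtain ⟨S₁, hS₁, hle, hthird⟩ := x.exists_start (f := x.dualValue)
      (fun _ _ h => x.dualValue_mono h) x.dualValue_sup_add_dualValue_inf (x.dualValue_nonneg 0) hT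
    refine le_trans ?_ (hbest S₁ hS₁)
    obtain ⟨S, A₁, A₂, hreach, hend, hA₁, hA₂, hor⟩ := hF S₁ hS₁
    have hg := x.greedy_guarantee (fun _ _ h => x.dualValue_mono h)
      x.dualValue_sup_add_dualValue_inf (x.dualValue_nonneg 0)
      (fun S hS => x.dualValue_eq_selProfit hS) hT hS₁ hle hthird hreach hend
    rw [← x.dualValue_eq_selProfit (FeasibleSel.of_reflTransGen x hS₁.1 hreach).2,
      hA₁.selProfit_eq] at hg
    have hA'T : x.profit A' ≤ x.dualValue T :=
      le_ciInf fun q => x.profit_le_dualObjective q fun _ => rfl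
    have he : 0 ≤ 1 - Real.exp (-1) := by
      rw [sub_nonneg, Real.exp_le_one_iff]
      norm_num
    have h₁ := (mul_le_mul_of_nonneg_left hA'T he).trans hg
    rcases hor with ⟨e, h⟩ | ⟨e, h⟩ <;> rw [e]
    exacts [h₁, h₁.trans h]

end SAP

/-! ### The greedy program

The array `20` holds the current selection, the real variable `5` its profit. The best assignment so
far is kept in the array `30`, with its profit in the real variable `10`. -/

namespace RAM

/-- Execute `P` for all seminars `b` and all indices `j` of entries of the list of allowable sizes
of `b`, kept in the variables `l` and `l'`. -/
def Prog.forPair (l l' : ℕ) (P : Prog) : Prog :=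
  .forLoop l (.var 0) (.forLoop l' (.entry 2 (.var l)) P)

/-- Copy the selection in the array `20` to the array `15`. -/
def loadTarget : Prog := .fill 17 (.var 0) 15 (.entry 20 (.var 17))

/-- Replace the best assignment so far, in the array `30` and of profit in the real variable `10`,
by the one just computed if this has a larger profit. -/
def offer : Prog :=
  .ite (.not (.realLe (.var 3) (.var 10)))
    (.seq (.fill 17 (.var 1) 30 (.entry 5 (.var 17))) (.assignReal 10 (.var 3)))
    .skip

/-- The candidate number of places, for the loop variables `l` and `l'` of `Prog.forPair`. -/
def NExpr.size (l l' : ℕ) : NExpr := .load 3 (.var l) (.var l')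

/-- Consider raising the seminar in the variable `21` to its allowable size of index in the
variable `22`. The best raise so far has the marginal profit in the real variable `6`, the marginal
cost in the variable `24` (`0` if there is none), and the seminar and its size in the variables
`25` and `26`. The fractions are compared after multiplication by the denominators. -/
def considerRaise : Prog :=
  .ite (.natLe (.size 21 22) (.entry 20 (.var 21))) .skip <|
  .seq loadTarget <|
  .seq (.natStore 15 (.var 21) (.const 0) (.size 21 22)) <|
  .seq (.sumNat 17 (.var 0) 23 (.entry 15 (.var 17))) <|
  .ite (.not (.natLe (.var 23) (.var 1))) .skip <|
  .seq optimize <|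
  .seq (.assign 27 (.sub (.size 21 22) (.entry 20 (.var 21)))) <|
  .seq (.assignReal 7 (.sub (.var 3) (.var 5))) <|
  .seq (.sumReal 17 (.var 24) 8 (.var 7)) <|
  .seq (.sumReal 17 (.var 27) 9 (.var 6)) <|
  .ite (.and (.not (.natLe (.var 24) (.const 0))) (.realLe (.var 8) (.var 9))) .skip <|
  .seq (.assignReal 6 (.var 7)) <|
  .seq (.assign 24 (.var 27)) <|
  .seq (.assign 25 (.var 21)) <|
  .assign 26 (.size 21 22)

/-- Find the densest raise of the selection in the array `20`. -/
def searchRaise : Prog :=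
  .seq loadTarget <|
  .seq optimize <|
  .seq (.assignReal 5 (.var 3)) <|
  .seq (.assign 24 (.const 0)) <|
  .forPair 21 22 considerRaise

/-- Run the greedy loop from the selection in the array `20` and offer the final assignment. -/
def greedyRun : Prog :=
  .seq searchRaise <|
  .seq (.while (.natLe (.const 1) (.var 24)) <|
    .seq (.natStore 20 (.var 25) (.const 0) (.var 26)) searchRaise) <|
  .seq loadTarget <|
  .seq optimize offer

end RAM

namespace SAP

open RAM

variable {m n : ℕ} {x : SAP m n} {z : ℕ} {s : Mem}

theorem card_le_size (x : SAP m n) (b : Fin m) : (x.K b).card ≤ x.size :=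
  (Finset.single_le_sum (f := fun b => (x.K b).card) (fun _ _ => Nat.zero_le _)
    (Finset.mem_univ b)).trans (Nat.le_add_left _ _)

/-- The rule for loops over all pairs of a seminar and an allowable size, for a part `π s` of the
memory that develops along a preorder `R`: what the iteration for the size `k` of `c` achieves
persists, and so holds in the end for all pairs. -/
theorem forPair_runs {α : Type*} (π : Mem → α) (J : α → Prop) (R : α → α → Prop)
    (G : Fin m → ℕ → α → Prop) {l l' : ℕ} {P : Prog}
    (hz : x.size < z) (h : x.Input s)
    (hin : ((Prog.forPair l l' P).writesNat 0 || (Prog.forPair l l' P).writesNat 1 ||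
      (Prog.forPair l l' P).writesNat 2 || (Prog.forPair l l' P).writesNat 3 ||
      (Prog.forPair l l' P).writesReal 0) = false)
    (hl : (Prog.forLoop l' (.entry 2 (.var l)) P).writesNat l = false)
    (hl' : P.writesNat l' = false)
    (hπ : ∀ s v, π (s.setNat l 0 0 v) = π s) (hπ' : ∀ s v, π (s.setNat l' 0 0 v) = π s)
    (hrefl : ∀ u, R u u) (htrans : ∀ u v w, R u v → R v w → R u w)
    (hG : ∀ c k u v, R u v → G c k u → G c k v) (hJ : J (π s))
    (hP : ∀ s' (c : Fin m) j, Frame (.forPair l l' P) s s' → x.Input s' → s'.nat l 0 0 = c →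
      s'.nat l' 0 0 = j → j < (x.K c).card → s'.nat 3 c j ∈ x.K c → J (π s') →
      Runs z P s' (fun s'' => J (π s'') ∧ R (π s') (π s'') ∧ G c (s'.nat 3 c j) (π s''))) :
    Runs z (.forPair l l' P) s (fun s' => J (π s') ∧ R (π s) (π s') ∧
      ∀ c, ∀ k ∈ x.K c, G c k (π s')) := by
  have hm : m ≤ z := by rw [size] at hz; lia
  refine Runs.conseq (Runs.forLoop (N := m) (fun b s' => J (π s') ∧ R (π s) (π s') ∧
    ∀ c : Fin m, c < b → ∀ k ∈ x.K c, G c k (π s')) hm hl ?_ ?_ ?_ ?_) ?_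
  · intro s' hF
    exact (h.frame hF hin).seminars
  · intro k s v hI
    simpa only [hπ] using hI
  · exact ⟨hJ, hrefl _, fun c hc => absurd hc (Nat.not_lt_zero _)⟩
  · rintro b s₁ hb hF₁ hb₁ ⟨hJ₁, hR₁, hG₁⟩
    have h₁ := h.frame hF₁ hin
    have hw : ∀ s', Frame (.forLoop l' (.entry 2 (.var l)) P) s₁ s' →
        Frame (.forPair l l' P) s s' := fun s' hF => hF₁.trans <| hF.mono (Q := .forPair l l' P)
      (fun c hc => by
        rw [Prog.forPair, Prog.forLoop, Prog.writesNat, Prog.writesNat, Prog.writesNat] at hc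
        simp only [ Bool.or_eq_false_iff] at hc
        exact hc.2.1)
      (fun c hc => by
        rw [Prog.forPair, Prog.forLoop, Prog.writesReal, Prog.writesReal, Prog.writesReal] at hc
        simp only [ Bool.or_eq_false_iff] at hc
        exact hc.2.1)
    refine Runs.conseq (Runs.forLoop (N := (x.K ⟨b, hb⟩).card) (fun j s' => J (π s') ∧
      R (π s) (π s') ∧ (∀ c : Fin m, c < b → ∀ k ∈ x.K c, G c k (π s')) ∧
      ∀ j' < j, G ⟨b, hb⟩ (x.initMem.nat 3 b j') (π s'))
      ((x.card_le_size _).trans hz.le) hl' ?_ ?_ ?_ ?_) ?_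
    · intro s' hF
      have := (h.frame (hw _ hF) hin).card ⟨b, hb⟩
      rw [NExpr.eval_entry, NExpr.eval_var, hF.nat l hl, hb₁]
      exact this
    · intro k s v hI
      simpa only [hπ'] using hI
    · exact ⟨hJ₁, hR₁, hG₁, fun j' hj' => absurd hj' (Nat.not_lt_zero _)⟩
    · rintro j s₂ hj hF₂ hj₂ ⟨hJ₂, hR₂, hG₂, hG₂'⟩
      have h₂ := h.frame (hw _ hF₂) hin
      refine (hP s₂ ⟨b, hb⟩ j (hw _ hF₂) h₂ (by rw [hF₂.nat l hl, hb₁]) hj₂ hj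
        (h₂.entry_mem _ hj) hJ₂).conseq fun s₃ hF₃ ⟨hJ₃, hR₃, hG₃⟩ =>
        ⟨hJ₃, htrans _ _ _ hR₂ hR₃, fun c hc k hk => hG c k _ _ hR₃ (hG₂ c hc k hk),
          fun j' hj' => ?_⟩
      by_cases e : j' = j
      · rw [h₂.nat 3 (by lia)] at hG₃
        rw [e]
        exact hG₃
      · exact hG _ _ _ _ hR₃ (hG₂' j' (by lia))
    · rintro s' hF ⟨hJ', hR', hG', hG''⟩
      refine ⟨hJ', hR', fun c hc k hk => ?_⟩
      by_cases e : c = ⟨b, hb⟩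
      · subst e
        have h₂ := h.frame (hw _ hF) hin
        obtain ⟨j, hj, rfl⟩ := h₂.exists_entry _ hk
        rw [h₂.nat 3 (by lia)]
        exact hG'' j hj
      · have : (c : ℕ) ≠ b := fun e' => e (Fin.ext e')
        exact hG' c (by lia) k hk
  · rintro s' - ⟨hJ', hR', hG'⟩
    exact ⟨hJ', hR', fun c k hk => hG' c c.2 k hk⟩

theorem loadTarget_runs (hz : x.size < z) (h : x.Input s) {S : Selection m}
    (hS : SelectedIn S 20 s) : Runs z loadTarget s (SelectedIn S 15) := by
  rw [size] at hz
  refine Runs.conseq (Runs.fill (N := m) (fun v => s.nat 20 v 0) (by lia) (by decide)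
    (fun s' hF => (h.frame hF rfl).seminars) fun k _ s' hF hk => ?_)
    fun s' _ h' b => (h' b b.2).trans (hS b)
  rw [NExpr.eval_entry, NExpr.eval_var, hk, hF.nat 20 rfl]

/-- The best assignment so far, as recorded in the memory. -/
def BestIn (x : SAP m n) (A : Assignment m n) (s : Mem) : Prop :=
  StoredIn A 30 s ∧ s.real 10 0 0 = x.profit A

theorem offer_runs (hz : x.size < z) (h : x.Input s) {A B : Assignment m n}
    (hA : StoredIn A 5 s) (hp : s.real 3 0 0 = x.profit A) (hB : x.BestIn B s) :
    Runs z offer s fun s' => ∃ B', x.BestIn B' s' ∧ (B' = B ∨ B' = A) ∧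
      x.profit B ≤ x.profit B' ∧ x.profit A ≤ x.profit B' := by
  rw [size] at hz
  refine Runs.ite (fun hb => ?_) fun hb => Runs.skip ?_
  · have hb' : x.profit B < x.profit A := by simpa [Test.holds, hp, hB.2] using hb
    refine Runs.seq (Runs.fill (N := n) (fun i => s.nat 5 i 0) (by lia) (by decide)
      (fun s' hF => (h.frame hF rfl).students) fun k _ s' hF hk => ?_)
      fun s₁ hF₁ h₁ => Runs.assignReal ⟨A, ⟨fun i => ?_, ?_⟩, .inr rfl, hb'.le, le_rfl⟩
    · rw [NExpr.eval_entry, NExpr.eval_var, hk, hF.nat 5 rfl]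
    · exact (h₁ i i.2).trans (hA i)
    · simp [Mem.setReal, hF₁.real 3 rfl, hp]
  · have hb' : x.profit A ≤ x.profit B := by simpa [Test.holds, hp, hB.2] using hb
    exact ⟨B, hB, .inl rfl, le_rfl, hb'⟩

theorem Inc.exists_raise {S T : Selection m} (h : x.Inc S T) :
    ∃ c, ∃ k ∈ x.K c, S c < k ∧ T = S.raise c k := by
  obtain ⟨hT, hle, c, hc, huniq⟩ := h
  refine ⟨c, T c, hT.1 c, hc, funext fun b => ?_⟩
  by_cases e : b = c
  · subst e
    simp [Selection.raise, hc.le]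
  · rw [Selection.raise, Function.update_of_ne e]
    exact le_antisymm (not_lt.1 fun h => e (huniq b h)) (hle b)

/-- A raise recorded by `considerRaise`: marginal profit, marginal cost, seminar and size. -/
structure RaiseRecord where
  num : ℝ
  den : ℕ
  seminar : ℕ
  size : ℕ

/-- The record in the memory. -/
def raiseRecord (s : Mem) : RaiseRecord :=
  ⟨s.real 6 0 0, s.nat 24 0 0, s.nat 25 0 0, s.nat 26 0 0⟩

/-- The record is empty or describes an element of `inc(S)`. -/
def RaiseRecord.Valid (x : SAP m n) (S : Selection m) (u : RaiseRecord) : Prop :=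
  u.den ≤ n ∧ (u.den ≠ 0 → ∃ c : Fin m, u.seminar = c ∧ S c < u.size ∧
    x.Inc S (S.raise c u.size) ∧ x.density S (S.raise c u.size) = u.num / u.den)

/-- The record has density at least `d`. -/
def RaiseRecord.Beats (u : RaiseRecord) (d : ℝ) : Prop := u.den ≠ 0 ∧ d ≤ u.num / u.den

theorem considerRaise_runs (hz : x.size < z) (h : x.Input s) {S : Selection m}
    (hS : SelectedIn S 20 s) (hfeas : x.FeasibleSel S) (hp : s.real 5 0 0 = x.selProfit S)
    {c : Fin m} {j : ℕ} (hc : s.nat 21 0 0 = c) (hj : s.nat 22 0 0 = j)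
    (hk : s.nat 3 c j ∈ x.K c) (hu : (raiseRecord s).Valid x S) :
    Runs z considerRaise s fun s' => (raiseRecord s').Valid x S ∧
      ((raiseRecord s).den ≠ 0 →
        (raiseRecord s').Beats ((raiseRecord s).num / (raiseRecord s).den)) ∧
      (S c < s.nat 3 c j → x.Inc S (S.raise c (s.nat 3 c j)) →
        (raiseRecord s').Beats (x.density S (S.raise c (s.nat 3 c j)))) := by
  have hzm : m < z ∧ n < z := by rw [size] at hz; lia
  obtain ⟨k, hk'⟩ : ∃ k, s.nat 3 c j = k := ⟨_, rfl⟩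
  rw [hk'] at hk ⊢
  have hsize : ∀ s', s'.nat 21 = s.nat 21 → s'.nat 22 = s.nat 22 → s'.nat 3 = s.nat 3 →
      (NExpr.size 21 22).eval s' = k := by
    intro s' e e' e''
    simp [NExpr.size, NExpr.eval, e, e', e'', hc, hj, hk']
  have htest : (Test.natLe (.size 21 22) (.entry 20 (.var 21))).holds s ↔ k ≤ S c := by
    simp [Test.holds, hsize s rfl rfl rfl, hc, hS c]
  refine Runs.ite (fun hb => Runs.skip ?_) fun hb => ?_
  · rw [htest] at hb
    exact ⟨hu, fun h => ⟨h, le_rfl⟩, fun h => absurd hb (not_le.2 h)⟩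
  rw [htest, not_le] at hb
  refine Runs.seq (loadTarget_runs hz h hS) fun s₁ hF₁ h₁ => Runs.store_seq fun s₂ hF₂ h₂ => ?_
  have hsel : SelectedIn (S.raise c k) 15 s₂ := by
    intro b
    rw [h₂, hsize s₁ (hF₁.nat _ rfl) (hF₁.nat _ rfl) (hF₁.nat _ rfl), NExpr.eval_var,
      hF₁.nat 21 rfl, hc]
    by_cases e : b = c
    · subst e
      simp [Selection.raise, hb.le]
    · have e' : (b : ℕ) ≠ c := fun e' => e (Fin.ext e')
      rw [Selection.raise, Function.update_of_ne e, Function.update_of_ne e']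
      exact h₁ b
  have hI₂ := (h.frame hF₁ rfl).frame hF₂ rfl
  refine Runs.seq (Runs.sumNat (N := m) (fun v => s₂.nat 15 v 0) (by lia) (by decide)
    (fun s' hF => (hI₂.frame hF rfl).seminars) fun v _ s' hF hv => ?_) fun s₃ hF₃ h₃ => ?_
  · rw [NExpr.eval_entry, NExpr.eval_var, hv, hF.nat 15 rfl]
  rw [hsel.sum_eq] at h₃
  have hI₃ := hI₂.frame hF₃ rfl
  have hrec₃ : raiseRecord s₃ = raiseRecord s := by
    simp only [raiseRecord, hF₃.real 6 rfl, hF₃.nat 24 rfl, hF₃.nat 25 rfl, hF₃.nat 26 rfl,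
      hF₂.real 6 rfl, hF₂.nat 24 rfl, hF₂.nat 25 rfl, hF₂.nat 26 rfl,
      hF₁.real 6 rfl, hF₁.nat 24 rfl, hF₁.nat 25 rfl, hF₁.nat 26 rfl]
  have htest₃ : (Test.natLe (.var 23) (.var 1)).holds s₃ ↔ (S.raise c k).cost ≤ n := by
    simp [Test.holds, h₃, hI₃.students]
  refine Runs.ite (fun hb' => Runs.skip ?_) fun hb' => ?_
  · rw [Test.holds, htest₃] at hb'
    rw [hrec₃]
    exact ⟨hu, fun h => ⟨h, le_rfl⟩, fun _ h => absurd h.1.2 hb'⟩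
  rw [Test.holds, htest₃, not_not] at hb'
  have hinc : x.Inc S (S.raise c k) := Inc.raise x hfeas hk hb hb'
  refine Runs.seq (optimize_isOptimalFor hz hI₃ (S := S.raise c k)
    (fun b => by rw [hF₃.nat 15 rfl]; exact hsel b) hb') fun s₄ hF₄ ⟨A, hA, _, h₄⟩ =>
    Runs.assign_seq fun s₅ hF₅ h₅ => Runs.assignReal_seq fun s₆ hF₆ h₆ => ?_
  have e20 : s₄.nat 20 = s.nat 20 := by
    rw [hF₄.nat 20 rfl, hF₃.nat 20 rfl, hF₂.nat 20 rfl, hF₁.nat 20 rfl]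
  have e21 : s₄.nat 21 = s.nat 21 := by
    rw [hF₄.nat 21 rfl, hF₃.nat 21 rfl, hF₂.nat 21 rfl, hF₁.nat 21 rfl]
  have e22 : s₄.nat 22 = s.nat 22 := by
    rw [hF₄.nat 22 rfl, hF₃.nat 22 rfl, hF₂.nat 22 rfl, hF₁.nat 22 rfl]
  have e3 : s₄.nat 3 = s.nat 3 := by
    rw [hF₄.nat 3 rfl, hF₃.nat 3 rfl, hF₂.nat 3 rfl, hF₁.nat 3 rfl]
  have r5 : s₄.real 5 = s.real 5 := by
    rw [hF₄.real 5 rfl, hF₃.real 5 rfl, hF₂.real 5 rfl, hF₁.real 5 rfl]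
  have hrec₄ : raiseRecord s₄ = raiseRecord s := by
    rw [← hrec₃]
    simp only [raiseRecord, hF₄.real 6 rfl, hF₄.nat 24 rfl, hF₄.nat 25 rfl, hF₄.nat 26 rfl]
  -- the marginal cost and the marginal profit of the raise
  have hden : s₆.nat 27 0 0 = k - S c := by
    rw [hF₆.nat 27 rfl, h₅, NExpr.eval, hsize s₄ e21 e22 e3, NExpr.eval_entry, NExpr.eval_var,
      e20, e21, hc, hS c]
  have hnum : s₆.real 7 0 0 = x.selProfit (S.raise c k) - x.selProfit S := by
    rw [h₆, RExpr.eval, RExpr.eval_var, RExpr.eval_var, hF₅.real 3 rfl, hF₅.real 5 rfl, r5, h₄, hp,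
      hA.selProfit_eq]
  have hrec₆ : raiseRecord s₆ = raiseRecord s := by
    rw [← hrec₄]
    simp only [raiseRecord, hF₆.real 6 rfl, hF₆.nat 24 rfl, hF₆.nat 25 rfl, hF₆.nat 26 rfl,
      hF₅.real 6 rfl, hF₅.nat 24 rfl, hF₅.nat 25 rfl, hF₅.nat 26 rfl]
  have hkn : k - S c ≤ n := by
    rw [Selection.cost_raise] at hb'
    lia
  have hdens : x.density S (S.raise c k) = s₆.real 7 0 0 / s₆.nat 27 0 0 := by
    rw [density, hnum, hden, Selection.cost_raise, Nat.cast_add, add_sub_cancel_left]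
  have hbden : s₆.nat 24 0 0 = (raiseRecord s).den := by rw [← hrec₆]; rfl
  have hbnum : s₆.real 6 0 0 = (raiseRecord s).num := by rw [← hrec₆]; rfl
  refine Runs.seq (Runs.sumReal (N := s₆.nat 24 0 0) (fun _ => s₆.real 7 0 0)
    (by have := hu.1; lia) (fun s' hF => by rw [NExpr.eval_var, hF.nat 24 rfl])
    fun v _ s' hF _ => by rw [RExpr.eval_var, hF.real 7 rfl]) fun s₇ hF₇ h₇ => ?_
  refine Runs.seq (Runs.sumReal (N := s₇.nat 27 0 0) (fun _ => s₇.real 6 0 0)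
    (by rw [hF₇.nat 27 rfl]; lia) (fun s' hF => by rw [NExpr.eval_var, hF.nat 27 rfl])
    fun v _ s' hF _ => by rw [RExpr.eval_var, hF.real 6 rfl]) fun s₈ hF₈ h₈ => ?_
  have hrec₈ : raiseRecord s₈ = raiseRecord s := by
    rw [← hrec₆]
    simp only [raiseRecord, hF₈.real 6 rfl, hF₈.nat 24 rfl, hF₈.nat 25 rfl, hF₈.nat 26 rfl,
      hF₇.real 6 rfl, hF₇.nat 24 rfl, hF₇.nat 25 rfl, hF₇.nat 26 rfl]
  have hden0 : (0 : ℝ) < s₆.nat 27 0 0 := by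
    rw [hden]
    exact Nat.cast_pos.2 (by lia)
  have htest₈ : (Test.and (.not (.natLe (.var 24) (.const 0)))
      (.realLe (.var 8) (.var 9))).holds s₈ ↔
      (raiseRecord s).Beats (x.density S (S.raise c k)) := by
    have e24 : s₈.nat 24 0 0 = (raiseRecord s).den := by rw [← hrec₈]; rfl
    have r8 : s₈.real 8 0 0 = (raiseRecord s).den * s₆.real 7 0 0 := by
      rw [hF₈.real 8 rfl, h₇, hbden]
      simp
    have r9 : s₈.real 9 0 0 = s₆.nat 27 0 0 * (raiseRecord s).num := by
      rw [h₈, hF₇.nat 27 rfl, hF₇.real 6 rfl, hbnum]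
      simp
    -- cross-multiplication
    simp only [Test.holds, NExpr.eval_var, RExpr.eval_var, e24, r8, r9, NExpr.eval,
      RaiseRecord.Beats, nonpos_iff_eq_zero, hdens, ne_eq]
    refine and_congr_right fun hne => ?_
    rw [div_le_div_iff₀ hden0 (Nat.cast_pos.2 (Nat.pos_of_ne_zero hne)), mul_comm, mul_comm
      (s₆.nat 27 0 0 : ℝ)]
  refine Runs.ite (fun hb'' => Runs.skip ?_) fun hb'' => ?_
  · rw [htest₈] at hb''
    rw [hrec₈]
    exact ⟨hu, fun h => ⟨h, le_rfl⟩, fun _ _ => hb''⟩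
  rw [htest₈] at hb''
  refine Runs.assignReal_seq fun s₉ hF₉ h₉ => Runs.assign_seq fun t₁ hG₁ k₁ =>
    Runs.assign_seq fun t₂ hG₂ k₂ => Runs.assign ?_
  have hnew : raiseRecord (t₂.setNat 26 0 0 ((NExpr.size 21 22).eval t₂)) =
      ⟨s₆.real 7 0 0, s₆.nat 27 0 0, c, k⟩ := by
    have a21 : s₉.nat 21 = s.nat 21 := by
      rw [hF₉.nat 21 rfl, hF₈.nat 21 rfl, hF₇.nat 21 rfl, hF₆.nat 21 rfl, hF₅.nat 21 rfl, e21]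
    have a22 : s₉.nat 22 = s.nat 22 := by
      rw [hF₉.nat 22 rfl, hF₈.nat 22 rfl, hF₇.nat 22 rfl, hF₆.nat 22 rfl, hF₅.nat 22 rfl, e22]
    have a3 : s₉.nat 3 = s.nat 3 := by
      rw [hF₉.nat 3 rfl, hF₈.nat 3 rfl, hF₇.nat 3 rfl, hF₆.nat 3 rfl, hF₅.nat 3 rfl, e3]
    have b1 : t₂.real 6 0 0 = s₆.real 7 0 0 := by
      rw [hG₂.real 6 rfl, hG₁.real 6 rfl, h₉, RExpr.eval_var, hF₈.real 7 rfl, hF₇.real 7 rfl]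
    have b2 : t₂.nat 24 0 0 = s₆.nat 27 0 0 := by
      rw [hG₂.nat 24 rfl, k₁, NExpr.eval_var, hF₉.nat 27 rfl, hF₈.nat 27 rfl, hF₇.nat 27 rfl]
    have b3 : t₂.nat 25 0 0 = c := by
      rw [k₂, NExpr.eval_var, hG₁.nat 21 rfl, a21, hc]
    have b4 : (NExpr.size 21 22).eval t₂ = k :=
      hsize t₂ (by rw [hG₂.nat 21 rfl, hG₁.nat 21 rfl, a21])
        (by rw [hG₂.nat 22 rfl, hG₁.nat 22 rfl, a22]) (by rw [hG₂.nat 3 rfl, hG₁.nat 3 rfl, a3])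
    simp [raiseRecord, Mem.setNat, b1, b2, b3, b4]
  have hne : s₆.nat 27 0 0 ≠ 0 := by lia
  rw [hnew]
  refine ⟨⟨by simpa only [hden] using hkn, fun _ => ⟨c, rfl, hb, hinc, hdens⟩⟩, fun h0 => ?_,
    fun _ _ => ⟨hne, hdens.le⟩⟩
  refine ⟨hne, ?_⟩
  rw [← hdens]
  exact le_of_not_ge fun hle => hb'' ⟨h0, hle⟩

theorem searchRaise_runs (hz : x.size < z) (h : x.Input s) {S : Selection m}
    (hS : SelectedIn S 20 s) (hfeas : x.FeasibleSel S) :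
    Runs z searchRaise s fun s' =>
      (s'.nat 24 0 0 = 0 ∧ ¬ ∃ T, x.Inc S T) ∨
      (s'.nat 24 0 0 ≠ 0 ∧ ∃ c : Fin m, s'.nat 25 0 0 = c ∧ S c < s'.nat 26 0 0 ∧
        x.GreedyStep S (S.raise c (s'.nat 26 0 0))) := by
  refine Runs.seq (loadTarget_runs hz h hS) fun s₁ hF₁ h₁ => ?_
  have hI₁ := h.frame hF₁ rfl
  refine Runs.seq (optimize_isOptimalFor hz hI₁ h₁ hfeas.2) fun s₂ hF₂ ⟨A, hA, _, h₂⟩ => ?_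
  have hI₂ := hI₁.frame hF₂ rfl
  refine Runs.assignReal_seq fun s₃ hF₃ h₃ => Runs.assign_seq fun s₄ hF₄ h₄ => ?_
  have hI₄ := (hI₂.frame hF₃ rfl).frame hF₄ rfl
  have e20 : s₄.nat 20 = s.nat 20 := by
    rw [hF₄.nat 20 rfl, hF₃.nat 20 rfl, hF₂.nat 20 rfl, hF₁.nat 20 rfl]
  have r5 : s₄.real 5 0 0 = x.selProfit S := by
    rw [hF₄.real 5 rfl, h₃, RExpr.eval_var, h₂, hA.selProfit_eq]
  have hden₄ : (raiseRecord s₄).den = 0 := h₄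
  refine Runs.conseq (forPair_runs (x := x) raiseRecord (RaiseRecord.Valid x S)
    (fun u v => u.den ≠ 0 → v.Beats (u.num / u.den))
    (fun c k u => S c < k → x.Inc S (S.raise c k) → u.Beats (x.density S (S.raise c k)))
    hz hI₄ rfl rfl rfl (fun _ _ => rfl) (fun _ _ => rfl) (fun u h => ⟨h, le_rfl⟩)
    (fun u v w h h' hu => ⟨(h' (h hu).1).1, (h hu).2.trans (h' (h hu).1).2⟩)
    (fun c k u v h h' hk hinc => ⟨(h (h' hk hinc).1).1, (h' hk hinc).2.trans (h (h' hk hinc).1).2⟩)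
    ⟨by lia, fun h => absurd hden₄ h⟩
    fun s' c j hF hI hc hj _ hk hJ => considerRaise_runs hz hI
      (fun b => by rw [hF.nat 20 rfl, e20]; exact hS b) hfeas (by rw [hF.real 5 rfl, r5]) hc hj hk
      hJ) ?_
  rintro s' - ⟨hJ, -, hG⟩
  by_cases hd : (raiseRecord s').den = 0
  · refine .inl ⟨hd, ?_⟩
    rintro ⟨T, hT⟩
    obtain ⟨c, k, hk, hlt, rfl⟩ := hT.exists_raise
    exact (hG c k hk hlt hT).1 hd
  · obtain ⟨c, hc, hlt, hinc, hdens⟩ := hJ.2 hd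
    refine .inr ⟨hd, c, hc, hlt, hinc, fun T hT => ?_⟩
    obtain ⟨c', k, hk, hlt', rfl⟩ := hT.exists_raise
    exact ((hG c' k hk hlt' hT).2).trans_eq hdens.symm

/-- `A` is optimal for a terminal selection of a greedy run from `S₀`. -/
def Terminal (x : SAP m n) (S₀ : Selection m) (A : Assignment m n) : Prop :=
  ∃ S, Relation.ReflTransGen x.GreedyStep S₀ S ∧ (¬ ∃ T, x.Inc S T) ∧ x.IsOptimalFor S A

theorem greedyRun_runs (hz : x.size < z) (h : x.Input s) {S₀ : Selection m}
    (hS : SelectedIn S₀ 20 s) (hfeas : x.FeasibleSel S₀) {B : Assignment m n}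
    (hB : x.BestIn B s) :
    Runs z greedyRun s fun s' => ∃ A B', x.Terminal S₀ A ∧ x.BestIn B' s' ∧
      (B' = B ∨ B' = A) ∧ x.profit B ≤ x.profit B' ∧ x.profit A ≤ x.profit B' := by
  refine Runs.seq (searchRaise_runs hz h hS hfeas) fun s₁ hF₁ h₁ => ?_
  have hI₁ := h.frame hF₁ rfl
  refine Runs.seq (Runs.whileLoop (k₀ := n - S₀.cost) (fun k s' => ∃ S : Selection m,
    n - S.cost = k ∧ SelectedIn S 20 s' ∧ x.FeasibleSel S ∧
    Relation.ReflTransGen x.GreedyStep S₀ S ∧ ((s'.nat 24 0 0 = 0 ∧ ¬ ∃ T, x.Inc S T) ∨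
      (s'.nat 24 0 0 ≠ 0 ∧ ∃ c : Fin m, s'.nat 25 0 0 = c ∧ S c < s'.nat 26 0 0 ∧
        x.GreedyStep S (S.raise c (s'.nat 26 0 0)))))
    ⟨S₀, rfl, fun b => by rw [hF₁.nat 20 rfl]; exact hS b, hfeas, .refl, h₁⟩
    (by rw [size] at hz; lia) ?_) ?_
  · rintro k s₂ hF₂ ⟨S, rfl, hS₂, hfeas₂, hreach, h₂⟩ hb
    have hI₂ := hI₁.frame hF₂ rfl
    obtain ⟨-, c, hc, hlt, hstep⟩ := h₂.resolve_left fun h₂ => by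
      simp [Test.holds, NExpr.eval, h₂.1] at hb
    refine Runs.store_seq fun s₃ hF₃ h₃ => ?_
    have hcost := hstep.1.cost_lt
    have hle := hstep.1.1.2
    refine (searchRaise_runs hz (hI₂.frame hF₃ rfl) (S := S.raise c (s₂.nat 26 0 0)) ?_
      hstep.1.1).conseq fun s₄ hF₄ h₄ => ⟨n - (S.raise c (s₂.nat 26 0 0)).cost, by lia, _, rfl, ?_,
        hstep.1.1, hreach.tail hstep, h₄⟩
    all_goals
      intro b
      try rw [hF₄.nat 20 rfl]
      rw [h₃, NExpr.eval_var, NExpr.eval_var, hc]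
      by_cases e : b = c
      · subst e
        simp [Selection.raise, hlt.le]
      · have e' : (b : ℕ) ≠ c := fun e' => e (Fin.ext e')
        rw [Selection.raise, Function.update_of_ne e, Function.update_of_ne e']
        exact hS₂ b
  rintro s₂ hF₂ ⟨⟨k, S, -, hS₂, hfeas₂, hreach, h₂⟩, hb⟩
  have hI₂ := hI₁.frame hF₂ rfl
  obtain ⟨-, hend⟩ := h₂.resolve_right fun h₂ => by
    simp only [Test.holds, NExpr.eval, NExpr.eval_var] at hb
    lia
  refine Runs.seq (loadTarget_runs hz hI₂ hS₂) fun s₃ hF₃ h₃ => ?_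
  have hI₃ := hI₂.frame hF₃ rfl
  refine Runs.seq (optimize_isOptimalFor hz hI₃ h₃ hfeas₂.2) fun s₄ hF₄ ⟨A, hA, hA', h₄⟩ => ?_
  have e30 : s₄.nat 30 = s.nat 30 := by
    rw [hF₄.nat 30 rfl, hF₃.nat 30 rfl, hF₂.nat 30 rfl, hF₁.nat 30 rfl]
  have r10 : s₄.real 10 = s.real 10 := by
    rw [hF₄.real 10 rfl, hF₃.real 10 rfl, hF₂.real 10 rfl, hF₁.real 10 rfl]
  refine (offer_runs hz (hI₃.frame hF₄ rfl) hA' h₄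
    (B := B) ⟨fun i => by rw [e30]; exact hB.1 i, by rw [r10]; exact hB.2⟩).conseq ?_
  rintro s' - ⟨B', hB', hor, hle, hle'⟩
  exact ⟨A, B', ⟨S, hreach, hend, hA⟩, hB', hor, hle, hle'⟩

end SAP

/-! ### The enumeration of the starts -/

namespace RAM

/-- Offer the best assignment that puts the students into the seminar in the variable `37` only and
their number is the allowable size of index in the variable `38`. -/
def considerSingle : Prog :=
  .seq (.fill 17 (.var 0) 15 (.const 0)) <|
  .seq (.natStore 15 (.var 37) (.const 0) (.size 37 38)) <|
  .ite (.natLe (.size 37 38) (.var 1)) (.seq optimize offer) .skip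

/-- Run the greedy loop from the selection given by the variables `31`, …, `36`, unless it is too
large. -/
def considerStart : Prog :=
  .seq (.fill 17 (.var 0) 20 (.const 0)) <|
  .seq (.natStore 20 (.var 31) (.const 0) (.size 31 32)) <|
  .seq (.natStore 20 (.var 33) (.const 0) (.size 33 34)) <|
  .seq (.natStore 20 (.var 35) (.const 0) (.size 35 36)) <|
  .seq (.sumNat 17 (.var 0) 23 (.entry 20 (.var 17))) <|
  .ite (.natLe (.var 23) (.var 1)) greedyRun .skip

/-- Convert the best assignment to the format of the output. -/
def writeOutput : Prog :=
  .forLoop 17 (.var 1) <|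
    .ite (.natLe (.var 0) (.entry 30 (.var 17)))
      (.natStore 4 (.var 17) (.const 0) (.const 0))
      (.natStore 4 (.var 17) (.const 0) (.add (.entry 30 (.var 17)) (.const 1)))

/-- The enumerated greedy algorithm. The best assignment is initially the empty one. The
assignments to a single seminar are considered once and for all, with the start `0`; a start with
`S₀ b > 0` for some `b` admits no others. -/
def enumGreedy : Prog :=
  .seq (.fill 17 (.var 1) 30 (.var 0)) <|
  .seq (.assignReal 10 .zero) <|
  .seq (.forPair 37 38 considerSingle) <|
  .seq (.fill 17 (.var 0) 20 (.const 0)) <|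
  .seq greedyRun <|
  .seq (.forPair 31 32 (.forPair 33 34 (.forPair 35 36 considerStart))) <|
  writeOutput

end RAM

namespace SAP

open RAM

variable {m n : ℕ} {x : SAP m n} {z : ℕ} {s : Mem}

/-- The part of the memory that records the best assignment and its profit. -/
def bestRecord (s : Mem) : (ℕ → ℕ) × ℝ := (fun i => s.nat 30 i 0, s.real 10 0 0)

/-- `A` is obtained in one of the two ways in which the algorithm generates assignments. -/
def Generated (x : SAP m n) (A : Assignment m n) : Prop :=
  x.SingleSeminar 0 A ∨ ∃ S₀, x.IsStart S₀ ∧ x.Terminal S₀ A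

/-- The record contains a generated assignment and its profit. -/
def GoodRecord (x : SAP m n) (u : (ℕ → ℕ) × ℝ) : Prop :=
  ∃ A : Assignment m n, (∀ i : Fin n, u.1 i = node (A i)) ∧ u.2 = x.profit A ∧ x.Generated A

/-- Some result of the greedy loop from `S₀` has profit at most `v`. -/
def Handled (x : SAP m n) (S₀ : Selection m) (v : ℝ) : Prop :=
  ∃ A, x.Terminal S₀ A ∧ x.profit A ≤ v

theorem Handled.mono {S₀ : Selection m} {v w : ℝ} (h : x.Handled S₀ v) (hvw : v ≤ w) :
    x.Handled S₀ w := by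
  obtain ⟨A, hA, hv⟩ := h
  exact ⟨A, hA, hv.trans hvw⟩

theorem size_eval {l l' : ℕ} {c : Fin m} {j : ℕ} (hc : s.nat l 0 0 = c) (hj : s.nat l' 0 0 = j) :
    (NExpr.size l l').eval s = s.nat 3 c j := by
  simp [NExpr.size, NExpr.eval, hc, hj]

theorem fill_zero_runs {a : ℕ} (hz : x.size < z) (h : x.Input s) (ha : 17 ≠ a)
    (hin : (Prog.fill 17 (.var 0) a (.const 0)).writesNat 0 = false) :
    Runs z (.fill 17 (.var 0) a (.const 0)) s (SelectedIn (0 : Selection m) a) := by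
  rw [size] at hz
  refine Runs.conseq (Runs.fill (N := m) (fun _ => 0) (by lia) ha
    (fun s' hF => ?_) fun _ _ _ _ _ => rfl) fun s' _ h' b => h' b b.2
  rw [NExpr.eval_var, hF.nat 0 hin, h.seminars]

theorem SelectedIn.update {S : Selection m} {a : ℕ} (hS : SelectedIn S a s) {s' : Mem} (c : Fin m)
    {k : ℕ} (h : ∀ j, s'.nat a j 0 = Function.update (fun j => s.nat a j 0) c k j) :
    SelectedIn (Function.update S c k) a s' := by
  intro b
  rw [h]
  by_cases e : b = c
  · subst e
    simp
  · have e' : (b : ℕ) ≠ c := fun e' => e (Fin.ext e')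
    rw [Function.update_of_ne e, Function.update_of_ne e']
    exact hS b

theorem count_pos {A : Assignment m n} {i : Fin n} {b : Fin m} (h : A i = some b) :
    0 < A.count b :=
  Finset.card_pos.2 ⟨i, by simp [h]⟩

theorem considerSingle_runs (hz : x.size < z) (h : x.Input s) {c : Fin m} {j : ℕ}
    (hc : s.nat 37 0 0 = c) (hj : s.nat 38 0 0 = j) (hk : s.nat 3 c j ∈ x.K c)
    (hB : x.GoodRecord (bestRecord s)) :
    Runs z considerSingle s fun s' => x.GoodRecord (bestRecord s') ∧
      (bestRecord s).2 ≤ (bestRecord s').2 ∧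
      ∀ A : Assignment m n, Corresponds (Function.update 0 c (s.nat 3 c j)) A →
        x.profit A ≤ (bestRecord s').2 := by
  refine Runs.seq (fill_zero_runs hz h (by decide) rfl) fun s₁ hF₁ h₁ =>
    Runs.store_seq fun s₂ hF₂ h₂ => ?_
  have hI₂ := (h.frame hF₁ rfl).frame hF₂ rfl
  have hsize : ∀ s', s'.nat 37 = s.nat 37 → s'.nat 38 = s.nat 38 → s'.nat 3 = s.nat 3 →
      (NExpr.size 37 38).eval s' = s.nat 3 c j := by
    intro s' e e' e''
    rw [size_eval (c := c) (j := j) (by rw [e, hc]) (by rw [e', hj]), e'']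
  rw [hsize s₁ (hF₁.nat _ rfl) (hF₁.nat _ rfl) (hF₁.nat _ rfl), NExpr.eval_var, hF₁.nat 37 rfl,
    hc] at h₂
  have hsel := h₁.update c h₂
  have hrec : bestRecord s₂ = bestRecord s := by
    simp only [bestRecord, hF₂.nat 30 rfl, hF₁.nat 30 rfl, hF₂.real 10 rfl, hF₁.real 10 rfl]
  have htest : (Test.natLe (.size 37 38) (.var 1)).holds s₂ ↔ s.nat 3 c j ≤ n := by
    rw [Test.holds, hsize s₂ ((hF₂.nat _ rfl).trans (hF₁.nat _ rfl))
      ((hF₂.nat _ rfl).trans (hF₁.nat _ rfl)) ((hF₂.nat _ rfl).trans (hF₁.nat _ rfl)),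
      NExpr.eval_var, hI₂.students]
  generalize s.nat 3 c j = k at *
  refine Runs.ite (fun hb => ?_) fun hb => Runs.skip ?_
  · rw [htest] at hb
    have hcost : Selection.cost (Function.update (0 : Selection m) c k) ≤ n := by
      rw [Selection.cost, Finset.sum_update_of_mem (Finset.mem_univ c)]
      simpa using hb
    refine Runs.seq (optimize_isOptimalFor hz hI₂ hsel hcost) fun s₃ hF₃ ⟨A, hA, hA', h₃⟩ => ?_
    have hrec₃ : bestRecord s₃ = bestRecord s := by
      rw [← hrec]
      simp only [bestRecord, hF₃.nat 30 rfl, hF₃.real 10 rfl]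
    rw [← hrec₃] at hB ⊢
    obtain ⟨B, hB₁, hB₂, hBgen⟩ := hB
    have hAgen : x.SingleSeminar 0 A := by
      have hsome : ∀ i b, A i = some b → b = c := by
        intro i b hb
        by_contra e
        have := count_pos hb
        rw [hA.1 b, Function.update_of_ne e] at this
        exact absurd this (lt_irrefl _)
      refine ⟨fun b => ?_, fun i i' b b' hb hb' => (hsome i b hb).trans (hsome i' b' hb').symm,
        fun _ _ _ => rfl⟩
      rw [hA.1 b]
      by_cases e : b = c
      · subst e
        rwa [Function.update_self]
      · rw [Function.update_of_ne e]
        exact x.zero_mem b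
    refine (offer_runs hz (hI₂.frame hF₃ rfl) hA' h₃ (B := B) ⟨hB₁, hB₂⟩).conseq ?_
    rintro s₄ - ⟨B', hB', hor, hle, hle'⟩
    refine ⟨⟨B', hB'.1, hB'.2, ?_⟩, ?_, fun A' hA'' => ?_⟩
    · rcases hor with rfl | rfl
      exacts [hBgen, .inl hAgen]
    · rw [hB₂]
      exact hle.trans_eq hB'.2.symm
    · exact ((hA.2 A' hA'').trans hle').trans_eq hB'.2.symm
  · rw [htest] at hb
    rw [hrec]
    -- more than `n` places cannot be filled by any assignment
    refine ⟨hB, le_rfl, fun A hA => absurd ?_ hb⟩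
    have := hA c
    rw [Function.update_self] at this
    rw [← this]
    exact (Finset.card_le_univ _).trans_eq (Fintype.card_fin n)

/-- The selection with the sizes `k₁`, `k₂`, `k₃` at `c₁`, `c₂`, `c₃`; later entries take
precedence if the seminars coincide. -/
def selectThree (c₁ : Fin m) (k₁ : ℕ) (c₂ : Fin m) (k₂ : ℕ) (c₃ : Fin m) (k₃ : ℕ) : Selection m :=
  Function.update (Function.update (Function.update 0 c₁ k₁) c₂ k₂) c₃ k₃

theorem selectThree_mem {c₁ c₂ c₃ : Fin m} {k₁ k₂ k₃ : ℕ} (h₁ : k₁ ∈ x.K c₁) (h₂ : k₂ ∈ x.K c₂)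
    (h₃ : k₃ ∈ x.K c₃) (b : Fin m) : selectThree c₁ k₁ c₂ k₂ c₃ k₃ b ∈ x.K b := by
  simp only [selectThree, Function.update_apply]
  split_ifs with e₁ e₂ e₃
  · rwa [e₁]
  · rwa [e₂]
  · rwa [e₃]
  · exact x.zero_mem b

theorem isStart_selectThree {c₁ c₂ c₃ : Fin m} {k₁ k₂ k₃ : ℕ} (h₁ : k₁ ∈ x.K c₁)
    (h₂ : k₂ ∈ x.K c₂) (h₃ : k₃ ∈ x.K c₃)
    (hc : (selectThree c₁ k₁ c₂ k₂ c₃ k₃).cost ≤ n) :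
    x.IsStart (selectThree c₁ k₁ c₂ k₂ c₃ k₃) := by
  refine ⟨⟨selectThree_mem h₁ h₂ h₃, hc⟩, (Finset.card_le_card ?_).trans
    (Finset.card_le_three (a := c₁) (b := c₂) (c := c₃))⟩
  intro b hb
  by_contra hne
  simp only [Finset.mem_insert, Finset.mem_singleton, not_or] at hne
  have hpos := (Finset.mem_filter.1 hb).2
  simp [selectThree, hne.1, hne.2.1, hne.2.2] at hpos

theorem IsStart.exists_selectThree {S₀ : Selection m} (h : x.IsStart S₀) (hm : 0 < m) :
    ∃ c₁ c₂ c₃, S₀ = selectThree c₁ (S₀ c₁) c₂ (S₀ c₂) c₃ (S₀ c₃) := by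
  obtain ⟨D, hD⟩ : ∃ D, Finset.univ.filter (fun b => 0 < S₀ b) = D := ⟨_, rfl⟩
  have hcard := h.2
  rw [hD] at hcard
  obtain ⟨c₁, c₂, c₃, hsub⟩ : ∃ c₁ c₂ c₃, D ⊆ {c₁, c₂, c₃} := by
    have h0 : Fin m := ⟨0, hm⟩
    rcases (by lia : D.card = 0 ∨ D.card = 1 ∨ D.card = 2 ∨ D.card = 3) with e | e | e | e
    · exact ⟨h0, h0, h0, by simp [Finset.card_eq_zero.1 e]⟩
    · obtain ⟨a, rfl⟩ := Finset.card_eq_one.1 e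
      exact ⟨a, a, a, by simp⟩
    · obtain ⟨a, b, -, rfl⟩ := Finset.card_eq_two.1 e
      exact ⟨a, b, b, by simp⟩
    · obtain ⟨a, b, c, -, -, -, rfl⟩ := Finset.card_eq_three.1 e
      exact ⟨a, b, c, le_rfl⟩
  refine ⟨c₁, c₂, c₃, funext fun b => ?_⟩
  simp only [selectThree, Function.update_apply]
  split_ifs with e₁ e₂ e₃
  · rw [e₁]
  · rw [e₂]
  · rw [e₃]
  · by_contra hb
    have : b ∈ D := by
      rw [← hD]
      simpa using Nat.pos_of_ne_zero hb
    simpa [e₁, e₂, e₃] using hsub this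

theorem greedyRun_record (hz : x.size < z) (h : x.Input s) {S₀ : Selection m}
    (hS : SelectedIn S₀ 20 s) (hstart : x.IsStart S₀) (hB : x.GoodRecord (bestRecord s)) :
    Runs z greedyRun s fun s' => x.GoodRecord (bestRecord s') ∧
      (bestRecord s).2 ≤ (bestRecord s').2 ∧ x.Handled S₀ (bestRecord s').2 := by
  obtain ⟨B, hB₁, hB₂, hBgen⟩ := hB
  refine (greedyRun_runs hz h hS hstart.1 (B := B) ⟨hB₁, hB₂⟩).conseq ?_
  rintro s' - ⟨A, B', hA, hB', hor, hle, hle'⟩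
  refine ⟨⟨B', hB'.1, hB'.2, ?_⟩, ?_, ⟨A, hA, hle'.trans_eq hB'.2.symm⟩⟩
  · rcases hor with rfl | rfl
    exacts [hBgen, .inr ⟨S₀, hstart, hA⟩]
  · rw [hB₂]
    exact hle.trans_eq hB'.2.symm

theorem considerStart_runs (hz : x.size < z) (h : x.Input s) {c₁ c₂ c₃ : Fin m} {j₁ j₂ j₃ : ℕ}
    (hc₁ : s.nat 31 0 0 = c₁) (hj₁ : s.nat 32 0 0 = j₁) (hk₁ : s.nat 3 c₁ j₁ ∈ x.K c₁)
    (hc₂ : s.nat 33 0 0 = c₂) (hj₂ : s.nat 34 0 0 = j₂) (hk₂ : s.nat 3 c₂ j₂ ∈ x.K c₂)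
    (hc₃ : s.nat 35 0 0 = c₃) (hj₃ : s.nat 36 0 0 = j₃) (hk₃ : s.nat 3 c₃ j₃ ∈ x.K c₃)
    (hB : x.GoodRecord (bestRecord s)) :
    Runs z considerStart s fun s' => x.GoodRecord (bestRecord s') ∧
      (bestRecord s).2 ≤ (bestRecord s').2 ∧
      ((selectThree c₁ (s.nat 3 c₁ j₁) c₂ (s.nat 3 c₂ j₂) c₃ (s.nat 3 c₃ j₃)).cost ≤ n →
        x.Handled (selectThree c₁ (s.nat 3 c₁ j₁) c₂ (s.nat 3 c₂ j₂) c₃ (s.nat 3 c₃ j₃))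
          (bestRecord s').2) := by
  refine Runs.seq (fill_zero_runs hz h (by decide) rfl) fun s₁ hF₁ h₁ =>
    Runs.store_seq fun s₂ hF₂ h₂ => Runs.store_seq fun s₃ hF₃ h₃ => Runs.store_seq
      fun s₄ hF₄ h₄ => ?_
  have hI₁ := h.frame hF₁ rfl
  have hI₂ := hI₁.frame hF₂ rfl
  have hI₃ := hI₂.frame hF₃ rfl
  have hI₄ := hI₃.frame hF₄ rfl
  have e3 : ∀ {s'}, x.Input s' → s'.nat 3 = s.nat 3 := fun h' =>
    (h'.nat 3 (by lia)).trans (h.nat 3 (by lia)).symm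
  rw [size_eval (c := c₁) (j := j₁) (by rw [hF₁.nat 31 rfl, hc₁]) (by rw [hF₁.nat 32 rfl, hj₁]),
    e3 hI₁, NExpr.eval_var, hF₁.nat 31 rfl, hc₁] at h₂
  rw [size_eval (c := c₂) (j := j₂) (by rw [hF₂.nat 33 rfl, hF₁.nat 33 rfl, hc₂])
    (by rw [hF₂.nat 34 rfl, hF₁.nat 34 rfl, hj₂]),
    e3 hI₂, NExpr.eval_var, hF₂.nat 33 rfl, hF₁.nat 33 rfl, hc₂] at h₃
  rw [size_eval (c := c₃) (j := j₃) (by rw [hF₃.nat 35 rfl, hF₂.nat 35 rfl, hF₁.nat 35 rfl, hc₃])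
    (by rw [hF₃.nat 36 rfl, hF₂.nat 36 rfl, hF₁.nat 36 rfl, hj₃]),
    e3 hI₃, NExpr.eval_var, hF₃.nat 35 rfl, hF₂.nat 35 rfl, hF₁.nat 35 rfl, hc₃] at h₄
  have hsel : SelectedIn
      (selectThree c₁ (s.nat 3 c₁ j₁) c₂ (s.nat 3 c₂ j₂) c₃ (s.nat 3 c₃ j₃)) 20 s₄ :=
    ((h₁.update c₁ h₂).update c₂ h₃).update c₃ h₄
  refine Runs.seq (Runs.sumNat (N := m) (fun v => s₄.nat 20 v 0) (by rw [size] at hz; lia)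
    (by decide) (fun s' hF => (hI₄.frame hF rfl).seminars) fun v _ s' hF hv => ?_)
    fun s₅ hF₅ h₅ => ?_
  · rw [NExpr.eval_entry, NExpr.eval_var, hv, hF.nat 20 rfl]
  have hI₅ := hI₄.frame hF₅ rfl
  rw [hsel.sum_eq] at h₅
  have hrec : bestRecord s₅ = bestRecord s := by
    simp only [bestRecord, hF₅.nat 30 rfl, hF₅.real 10 rfl, hF₄.nat 30 rfl, hF₄.real 10 rfl,
      hF₃.nat 30 rfl, hF₃.real 10 rfl, hF₂.nat 30 rfl, hF₁.nat 30 rfl, hF₂.real 10 rfl,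
      hF₁.real 10 rfl]
  rw [← hrec] at hB ⊢
  refine Runs.ite (fun hb => ?_) fun hb => Runs.skip ⟨hB, le_rfl, fun hcost => absurd ?_ hb⟩
  · have hcost : (selectThree c₁ (s.nat 3 c₁ j₁) c₂ (s.nat 3 c₂ j₂) c₃ (s.nat 3 c₃ j₃)).cost ≤
        n := by
      simpa [Test.holds, h₅, hI₅.students] using hb
    exact (greedyRun_record hz hI₅ (fun b => by rw [hF₅.nat 20 rfl]; exact hsel b)
      (isStart_selectThree hk₁ hk₂ hk₃ hcost) hB).conseq fun s' _ ⟨h, h', h''⟩ =>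
        ⟨h, h', fun _ => h''⟩
  · simpa [Test.holds, h₅, hI₅.students] using hcost

theorem enumerateStarts_runs (hz : x.size < z) (h : x.Input s)
    (hB : x.GoodRecord (bestRecord s)) :
    Runs z (.forPair 31 32 (.forPair 33 34 (.forPair 35 36 considerStart))) s fun s' =>
      x.GoodRecord (bestRecord s') ∧ (bestRecord s).2 ≤ (bestRecord s').2 ∧
      ∀ c₁, ∀ k₁ ∈ x.K c₁, ∀ c₂, ∀ k₂ ∈ x.K c₂, ∀ c₃, ∀ k₃ ∈ x.K c₃,
        (selectThree c₁ k₁ c₂ k₂ c₃ k₃).cost ≤ n →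
          x.Handled (selectThree c₁ k₁ c₂ k₂ c₃ k₃) (bestRecord s').2 := by
  refine forPair_runs (x := x) bestRecord x.GoodRecord (fun u v => u.2 ≤ v.2)
    (fun c₁ k₁ u => ∀ c₂, ∀ k₂ ∈ x.K c₂, ∀ c₃, ∀ k₃ ∈ x.K c₃,
        (selectThree c₁ k₁ c₂ k₂ c₃ k₃).cost ≤ n →
          x.Handled (selectThree c₁ k₁ c₂ k₂ c₃ k₃) u.2)
    hz h rfl rfl rfl (fun _ _ => rfl) (fun _ _ => rfl) (fun _ => le_rfl)
    (fun _ _ _ => le_trans) (fun _ _ _ _ h h' c₂ k₂ hk₂ c₃ k₃ hk₃ hc =>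
      (h' c₂ k₂ hk₂ c₃ k₃ hk₃ hc).mono h) hB
    fun s₁ c₁ j₁ _ hI₁ hc₁ hj₁ _ hk₁ hJ₁ => ?_
  refine forPair_runs (x := x) bestRecord x.GoodRecord (fun u v => u.2 ≤ v.2)
    (fun c₂ k₂ u => ∀ c₃, ∀ k₃ ∈ x.K c₃,
        (selectThree c₁ (s₁.nat 3 c₁ j₁) c₂ k₂ c₃ k₃).cost ≤ n →
          x.Handled (selectThree c₁ (s₁.nat 3 c₁ j₁) c₂ k₂ c₃ k₃) u.2)
    hz hI₁ rfl rfl rfl (fun _ _ => rfl) (fun _ _ => rfl) (fun _ => le_rfl)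
    (fun _ _ _ => le_trans) (fun _ _ _ _ h h' c₃ k₃ hk₃ hc => (h' c₃ k₃ hk₃ hc).mono h) hJ₁
    fun s₂ c₂ j₂ hF₂ hI₂ hc₂ hj₂ _ hk₂ hJ₂ => ?_
  refine forPair_runs (x := x) bestRecord x.GoodRecord (fun u v => u.2 ≤ v.2)
    (fun c₃ k₃ u => (selectThree c₁ (s₁.nat 3 c₁ j₁) c₂ (s₂.nat 3 c₂ j₂) c₃ k₃).cost ≤ n →
          x.Handled (selectThree c₁ (s₁.nat 3 c₁ j₁) c₂ (s₂.nat 3 c₂ j₂) c₃ k₃) u.2)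
    hz hI₂ rfl rfl rfl (fun _ _ => rfl) (fun _ _ => rfl) (fun _ => le_rfl)
    (fun _ _ _ => le_trans) (fun _ _ _ _ h h' hc => (h' hc).mono h) hJ₂
    fun s₃ c₃ j₃ hF₃ hI₃ hc₃ hj₃ _ hk₃ hJ₃ => ?_
  have e3 := hF₃.nat 3 rfl
  have e3' := hF₂.nat 3 rfl
  have := considerStart_runs hz hI₃ (c₁ := c₁) (c₂ := c₂) (c₃ := c₃) (j₁ := j₁) (j₂ := j₂)
    (j₃ := j₃) (by rw [hF₃.nat 31 rfl, hF₂.nat 31 rfl, hc₁])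
    (by rw [hF₃.nat 32 rfl, hF₂.nat 32 rfl, hj₁]) (by rwa [e3, e3'])
    (by rw [hF₃.nat 33 rfl, hc₂]) (by rw [hF₃.nat 34 rfl, hj₂]) (by rwa [e3]) hc₃ hj₃ hk₃ hJ₃
  rw [e3, e3'] at this
  rw [e3, e3']
  exact this

theorem writeOutput_runs (hz : x.size < z) (h : x.Input s) {A : Assignment m n}
    (hA : StoredIn A 30 s) : Runs z writeOutput s fun s' => s'.Holds A := by
  refine Runs.conseq (Runs.forLoop (N := n) (fun k s' => ∀ i < k, s'.nat 4 i 0 =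
    if m ≤ s.nat 30 i 0 then 0 else s.nat 30 i 0 + 1) (by rw [size] at hz; lia) rfl
    (fun s' hF => ?_) (fun _ _ _ h => h) (by simp) fun k s₁ hk hF hk' hI => ?_) fun s' _ h' i => ?_
  · rw [NExpr.eval_var, hF.nat 1 rfl, h.students]
  · have htest : (Test.natLe (.var 0) (.entry 30 (.var 17))).holds s₁ ↔ m ≤ s.nat 30 k 0 := by
      rw [Test.holds, NExpr.eval_var, NExpr.eval_entry, NExpr.eval_var, hk', hF.nat 30 rfl,
        hF.nat 0 rfl, h.seminars]
    refine Runs.ite (fun hb => ?_) fun hb => ?_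
    all_goals
      rw [htest] at hb
      refine Runs.natStore fun i hi => ?_
      by_cases e : i = k
      · subst e
        simp [Mem.setNat, NExpr.eval, hk', hb, hF.nat 30 rfl]
      · simpa [Mem.setNat, NExpr.eval, hk', e] using hI i (by lia)
  · rw [h' i i.2, hA i]
    cases A i with
    | none => simp [node]
    | some b => simp [node, Nat.not_le.2 b.2]

theorem SingleSeminar.corresponds {A : Assignment m n} {S₀ : Selection m}
    (h : x.SingleSeminar S₀ A) {i : Fin n} {c : Fin m} (hi : A i = some c) :
    Corresponds (Function.update 0 c (A.count c)) A := by
  intro b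
  by_cases e : b = c
  · subst e
    rw [Function.update_self]
  · rw [Function.update_of_ne e, Assignment.count]
    refine Finset.card_eq_zero.2 (Finset.filter_eq_empty_iff.2 fun i' _ hi' => ?_)
    exact e (h.2.1 i' i b c hi' hi)

theorem exists_best_singleSeminar (x : SAP m n) (S₀ : Selection m) :
    ∃ A, x.SingleSeminar S₀ A ∧ ∀ A', x.SingleSeminar S₀ A' → x.profit A' ≤ x.profit A := by
  have h0 : x.SingleSeminar S₀ fun _ => none :=
    ⟨fun b => by simpa [Assignment.count] using x.zero_mem b, by simp, by simp⟩
  obtain ⟨A, hA, hmax⟩ := Set.exists_max_image {A | x.SingleSeminar S₀ A} x.profit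
    (Set.toFinite _) ⟨_, h0⟩
  exact ⟨A, hA, hmax⟩

theorem isStart_zero (x : SAP m n) : x.IsStart 0 :=
  ⟨⟨x.zero_mem, by simp [Selection.cost]⟩, by simp⟩

/-- An assignment that the algorithm generates and that is at least as good as all others is a
possible result. -/
theorem Generated.enumGreedyOutput {A : Assignment m n} (hA : x.Generated A)
    (hsingle : ∀ B, x.SingleSeminar 0 B → x.profit B ≤ x.profit A)
    (hstart : ∀ S₀, x.IsStart S₀ → x.Handled S₀ (x.profit A)) : x.EnumGreedyOutput A := by
  have hsingle' : ∀ S₀ B, x.SingleSeminar S₀ B → x.profit B ≤ x.profit A :=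
    fun S₀ B hB => hsingle B ⟨hB.1, hB.2.1, fun _ _ _ => rfl⟩
  obtain ⟨S₀, hS₀, hout⟩ : ∃ S₀, x.IsStart S₀ ∧ x.GreedyOutput S₀ A := by
    rcases hA with hA | ⟨S₀, hS₀, S, hreach, hend, hopt⟩
    · obtain ⟨A₁, ⟨S, hreach, hend, hopt⟩, hle⟩ := hstart 0 x.isStart_zero
      exact ⟨0, x.isStart_zero, S, A₁, A, hreach, hend, hopt, ⟨hA, hsingle⟩, .inr ⟨rfl, hle⟩⟩
    · obtain ⟨A₂, hA₂, hmax⟩ := x.exists_best_singleSeminar S₀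
      exact ⟨S₀, hS₀, S, A, A₂, hreach, hend, hopt, ⟨hA₂, hmax⟩, .inl ⟨rfl, hsingle' _ _ hA₂⟩⟩
  have hall : ∀ S₁, ∃ B, (x.IsStart S₁ → x.GreedyOutput S₁ B ∧ x.profit B ≤ x.profit A) ∧
      (S₁ = S₀ → B = A) := by
    intro S₁
    by_cases e : S₁ = S₀
    · exact ⟨A, fun _ => ⟨e ▸ hout, le_rfl⟩, fun _ => rfl⟩
    by_cases h₁ : x.IsStart S₁
    · obtain ⟨A₁, ⟨S, hreach, hend, hopt⟩, hle⟩ := hstart S₁ h₁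
      obtain ⟨A₂, hA₂, hmax⟩ := x.exists_best_singleSeminar S₁
      rcases le_total (x.profit A₂) (x.profit A₁) with h | h
      · exact ⟨A₁, fun _ => ⟨⟨S, A₁, A₂, hreach, hend, hopt, ⟨hA₂, hmax⟩, .inl ⟨rfl, h⟩⟩, hle⟩,
          fun h => absurd h e⟩
      · exact ⟨A₂, fun _ => ⟨⟨S, A₁, A₂, hreach, hend, hopt, ⟨hA₂, hmax⟩, .inr ⟨rfl, h⟩⟩,
          hsingle' _ _ hA₂⟩, fun h => absurd h e⟩
    · exact ⟨A, fun h => absurd h h₁, fun _ => rfl⟩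
  choose F hF hF₀ using hall
  exact ⟨F, fun S₁ h₁ => (hF S₁ h₁).1, S₀, hS₀, (hF₀ S₀ rfl).symm, fun S₁ h₁ => (hF S₁ h₁).2⟩

theorem enumGreedy_runs (hz : x.size < z) (h : x.Input s) :
    Runs z enumGreedy s fun s' => ∃ A : Assignment m n, s'.Holds A ∧ x.EnumGreedyOutput A := by
  have hsz : m < z ∧ n < z := by rw [size] at hz; lia
  refine Runs.seq (Runs.fill (N := n) (fun _ => m) hsz.2.le (by decide)
    (fun s' hF => (h.frame hF rfl).students) fun _ _ s' hF _ => (h.frame hF rfl).seminars)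
    fun s₁ hF₁ h₁ => Runs.assignReal_seq fun s₂ hF₂ h₂ => ?_
  have hI₂ := (h.frame hF₁ rfl).frame hF₂ rfl
  have hB₂ : x.GoodRecord (bestRecord s₂) := by
    refine ⟨fun _ => none, fun i => ?_, ?_, .inl ⟨fun b => ?_, by simp, by simp⟩⟩
    · simp only [bestRecord, hF₂.nat 30 rfl]
      exact h₁ i i.2
    · simp [bestRecord, h₂, RExpr.eval, profit]
    · simpa [Assignment.count] using x.zero_mem b
  have h0 : (bestRecord s₂).2 = 0 := h₂
  refine Runs.seq (forPair_runs (x := x) bestRecord x.GoodRecord (fun u v => u.2 ≤ v.2)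
    (fun c k u => ∀ A : Assignment m n, Corresponds (Function.update 0 c k) A → x.profit A ≤ u.2)
    hz hI₂ rfl rfl rfl (fun _ _ => rfl) (fun _ _ => rfl) (fun _ => le_rfl)
    (fun _ _ _ => le_trans) (fun _ _ _ _ h h' A hA => (h' A hA).trans h) hB₂
    fun s' c j _ hI hc hj _ hk hJ => considerSingle_runs hz hI hc hj hk hJ)
    fun s₃ hF₃ ⟨hB₃, hle₃, hsingle⟩ => ?_
  have hI₃ := hI₂.frame hF₃ rfl
  refine Runs.seq (fill_zero_runs hz hI₃ (by decide) rfl) fun s₄ hF₄ h₄ => ?_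
  have hI₄ := hI₃.frame hF₄ rfl
  have hrec₄ : bestRecord s₄ = bestRecord s₃ := by
    simp only [bestRecord, hF₄.nat 30 rfl, hF₄.real 10 rfl]
  rw [← hrec₄] at hB₃ hle₃ hsingle
  refine Runs.seq (greedyRun_record hz hI₄ h₄ x.isStart_zero hB₃)
    fun s₅ hF₅ ⟨hB₅, hle₅, hzero⟩ => ?_
  have hI₅ := hI₄.frame hF₅ rfl
  refine Runs.seq (enumerateStarts_runs hz hI₅ hB₅) fun s₆ hF₆ ⟨⟨A, hA, hp, hgen⟩, hle₆, hall⟩ => ?_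
  have hI₆ := hI₅.frame hF₆ rfl
  refine (writeOutput_runs hz hI₆ (A := A) hA).conseq fun s' _ hout =>
    ⟨A, hout, hgen.enumGreedyOutput (fun B hB => ?_) fun S₀ hS₀ => ?_⟩
  · rw [← hp]
    -- the empty assignment is dominated because the best profit starts at `0`
    by_cases hsome : ∃ i c, B i = some c
    · obtain ⟨i, c, hi⟩ := hsome
      exact ((hsingle c _ (hB.1 c) B (hB.corresponds hi)).trans hle₅).trans hle₆
    · have : x.profit B = 0 := Finset.sum_eq_zero fun i _ => by
        cases hi : B i with
        | none => rfl
        | some c => exact absurd ⟨i, c, hi⟩ hsome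
      rw [this, ← h0]
      exact (hle₃.trans hle₅).trans hle₆
  · rw [← hp]
    -- without seminars the loops over the triples are empty, and `0` is the only start
    rcases Nat.eq_zero_or_pos m with hm | hm
    · have : S₀ = 0 := funext fun b => absurd b.2 (by lia)
      rw [this]
      exact hzero.mono hle₆
    · obtain ⟨c₁, c₂, c₃, e⟩ := hS₀.exists_selectThree hm
      have := hall c₁ _ (hS₀.1.1 c₁) c₂ _ (hS₀.1.1 c₂) c₃ _ (hS₀.1.1 c₃)
      rw [← e] at this
      exact this hS₀.1.2

end SAP

theorem corollary1 :
    (∃ (P : RAM.Prog) (q : Polynomial ℕ), ∀ (m n : ℕ) (x : SAP m n),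
      ∃ (t : ℕ) (s : RAM.Mem) (A : Assignment m n),
        RAM.Exec P x.initMem t s ∧ t ≤ q.eval x.size ∧ s.Holds A ∧
        x.EnumGreedyOutput A ∧ x.IsApprox (1 - Real.exp (-1)) A) ∧
    (∀ (m n : ℕ) (x : SAP m n) (A : Assignment m n),
      x.EnumGreedyOutput A → x.IsApprox (1 - Real.exp (-1)) A) := by
  refine ⟨?_, fun m n x A h => h.isApprox⟩
  obtain ⟨q, hq⟩ := RAM.enumGreedy.exists_polynomial_timeBound
  refine ⟨RAM.enumGreedy, q.comp (.X + 1), fun m n x => ?_⟩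
  obtain ⟨t, s, hexec, ht, A, hA, hout⟩ := SAP.enumGreedy_runs (x := x) (s := x.initMem)
    (Nat.lt_succ_self _) ⟨fun _ _ => rfl, rfl⟩
  refine ⟨t, s, A, hexec, ?_, hA, hout, hout.isApprox⟩
  rw [hq] at ht
  simpa using ht
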